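/- **Setting.** Let $T\subset\mathbb{R}^2$ be a bounded open polygonal element, star-shaped with respect to a ball centred at $x_T\in T$, whose boundary is the union of the closures of finitely many nondegenerate open straight edges $E\in\mathcal{E}_T$ that are pairwise disjoint (consecutive edges may be aligned); let $\mathcal{V}_T$ be the set of endpoints of the edges and $n_T$ the outward unit normal on $\partial T$. For $X=T$ or $X\in\mathcal{E}_T$, $\mathcal{P}^{\ell}(X)$ denotes the polynomials on $X$ of total degree $\le\ell$ (with $\mathcal{P}^{-1}(X)=\{0\}$) and $\pi^\ell_X$ the $L^2$-orthogonal projector onto $\mathcal{P}^\ell(X)$ (or onto $\mathcal{P}^\ell(X;\mathbb{R}^2)$ for vector functions). Fix an integer $k\ge 0$ and a complement $\mathcal{P}^{k-1|k+1}(T)$ of $\mathcal{P}^{k-1}(T)$ in $\mathcal{P}^{k+1}(T)$. The virtual space $\mathrm{V}_T$ is the set of $v\in H^1(T)$ such that the trace of $v$ on each $E\in\mathcal{E}_T$ belongs to $\mathcal{P}^{k+1}(E)$, $\Delta v\in\mathcal{P}^{k+1}(T)$, and $$\int_T(\nabla v-\pi^k_T\nabla v)\cdot(x-x_T)\,w=0\qquad\text{for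 all } w\in\mathcal{P}^{k-1|k+1}(T).$$ The trace of such a $v$ has a continuous representative on $\partial T$, denoted $v_{|\partial T}$. The space of degrees of freedom is $\mathbb{V}_T=\mathcal{P}^{k-1}(T)\times\prod_{E\in\mathcal{E}_T}\mathcal{P}^{k-1}(E)\times\mathbb{R}^{\mathcal{V}_T}$, and $\sigma_T:\mathrm{V}_T\to\mathbb{V}_T$ is $$\sigma_Tv=\big(\pi^{k-1}_Tv,\ (\pi^{k-1}_Ev_{|E})_{E\in\mathcal{E}_T},\ (v(x_V))_{V\in\mathcal{V}_T}\big).$$ For $d=(d_T,(d_E)_E,(d_V)_V)\in\mathbb{V}_T$: * $\gamma_{\partial T}d\in C(\partial T)$ is the function whose restriction to each edge $E$ is the unique $q\in\mathcal{P}^{k+1}(E)$ with $\pi_E^{k-1}q=d_E$ and $q(x_V)=d_V$ at the two endpoints $V$ of $E$; * $G_Td\in\mathcal{P}^k(T;\mathbb{R}^2)$ satisfies $\int_TG_Td\cdot\tau=-\int_Td_T\operatorname{div}\tau+\int_{\partial T}\gamma_{\partial T}d\,(\tau\cdot n_T)$ for all $\tau\in\mathcal{P}^k(T;\mathbb{R}^2)$;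 * $R^a_Td\in\mathcal{P}^{k+1}(T)$ satisfies $\int_TR^a_Td\,\operatorname{div}\tau=-\int_TG_Td\cdot\tau+\int_{\partial T}\gamma_{\partial T}d\,(\tau\cdot n_T)$ for all $\tau\in(x-x_T)\mathcal{P}^{k+1}(T)$. Set $\Pi^a_T=R^a_T\circ\sigma_T$ and $R^L_T=\pi^k_T\circ\sigma_T^{-1}:\mathbb{V}_T\to\mathcal{P}^k(T)$. **Statement.** For all $v\in\mathrm{V}_T$, $$\gamma_{\partial T}(\sigma_Tv)=v_{|\partial T},\qquad G_T(\sigma_Tv)=\pi^k_T(\nabla v),\qquad \Pi^a_Tv=R^a_T(\sigma_Tv)=\pi^{k+1}_Tv.$$ Moreover $\sigma_T:\mathrm{V}_T\to\mathbb{V}_T$ is a bijection, so that $R_T^L$ is well defined, and $$R^L_T=\pi^k_T\circ R^a_T\qquad\text{on }\mathbb{V}_T.$$ -/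

import Mathlib

open MeasureTheory Filter Topology
open scoped ContDiff

noncomputable section

namespace NodalVEM

/-- The Euclidean plane. -/
abbrev Plane : Type := EuclideanSpace ℝ (Fin 2)

/-! ### Polynomials -/

/-- Polynomials in two variables of total degree `≤ ℓ`; for `ℓ = -1` this is `{0}`. On a nonempty
open set such polynomials are identified with the functions they define. -/
def Poly (ℓ : ℤ) : Submodule ℝ (MvPolynomial (Fin 2) ℝ) :=
  MvPolynomial.restrictSupport ℝ {m : Fin 2 →₀ ℕ | (m.degree : ℤ) ≤ ℓ}

/-- Vector-valued polynomials whose components have total degree `≤ ℓ`. -/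
def VecPoly (ℓ : ℤ) : Submodule ℝ (Fin 2 → MvPolynomial (Fin 2) ℝ) :=
  Submodule.pi Set.univ fun _ => Poly ℓ

/-- Polynomials of degree `≤ ℓ` on an edge with endpoints `a`, `b`, written in the affine
coordinate `s ∈ [0, 1]` of the point `a + s (b - a)`; for `ℓ = -1` this is `{0}`. -/
def EdgePoly (ℓ : ℤ) : Submodule ℝ (Polynomial ℝ) :=
  Polynomial.degreeLT ℝ (ℓ + 1).toNat

/-- The function on the plane defined by a polynomial. -/
def ev (p : MvPolynomial (Fin 2) ℝ) (x : Plane) : ℝ :=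
  MvPolynomial.eval (fun j => x j) p

/-- The vector field on the plane defined by a vector-valued polynomial. -/
def evVec (τ : Fin 2 → MvPolynomial (Fin 2) ℝ) (x : Plane) : Plane :=
  WithLp.toLp 2 fun j => ev (τ j) x

/-- The divergence of a polynomial vector field. -/
def divPoly (τ : Fin 2 → MvPolynomial (Fin 2) ℝ) : MvPolynomial (Fin 2) ℝ :=
  ∑ j, MvPolynomial.pderiv j (τ j)

/-- The polynomial vector field `(x - c) w`. -/
def radial (c : Plane) (w : MvPolynomial (Fin 2) ℝ) : Fin 2 → MvPolynomial (Fin 2) ℝ :=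
  fun j => (MvPolynomial.X j - MvPolynomial.C (c j)) * w

open Classical in
/-- The `L²(0,1)`-orthogonal projection onto the edge polynomials of degree `≤ ℓ`. As the arclength
on an edge is a constant multiple of `ds`, applied to `s ↦ f (a + s (b - a))` this is the
`L²`-orthogonal projection of `f` on the edge. -/
def edgeProj (ℓ : ℤ) (f : ℝ → ℝ) : EdgePoly ℓ :=
  if h : ∃ q : EdgePoly ℓ, ∀ r : EdgePoly ℓ,
      ∫ s in (0 : ℝ)..1, (f s - (q : Polynomial ℝ).eval s) * (r : Polynomial ℝ).eval s = 0
  then h.choose else 0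

/-! ### Polygonal elements -/

/-- A bounded open polygonal element of the plane, star-shaped with respect to a ball, with
boundary split into finitely many nondegenerate edges whose relative interiors are disjoint.
Consecutive edges may be aligned. The endpoints of an edge are listed in an arbitrary order. -/
structure PolygonalElement where
  carrier : Set Plane
  center : Plane
  numEdges : ℕ
  a : Fin numEdges → Plane
  b : Fin numEdges → Plane
  isOpen_carrier : IsOpen carrier
  isBounded_carrier : Bornology.IsBounded carrier
  center_mem : center ∈ carrier
  starShaped : ∃ r : ℝ, 0 < r ∧ ∀ y ∈ Metric.ball center r, StarConvex ℝ y carrier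
  a_ne_b : ∀ i, a i ≠ b i
  disjoint_edges : Pairwise fun i j =>
    Disjoint (openSegment ℝ (a i) (b i)) (openSegment ℝ (a j) (b j))
  frontier_eq : frontier carrier = ⋃ i, segment ℝ (a i) (b i)

namespace PolygonalElement

variable (T : PolygonalElement)

/-- Lebesgue measure on the element. -/
abbrev vol : Measure Plane := volume.restrict T.carrier

/-- The vertices of the element, i.e. the endpoints of its edges. -/
def vertices : Set Plane := Set.range T.a ∪ Set.range T.b

lemma a_mem (i : Fin T.numEdges) : T.a i ∈ T.vertices := Or.inl ⟨i, rfl⟩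

lemma b_mem (i : Fin T.numEdges) : T.b i ∈ T.vertices := Or.inr ⟨i, rfl⟩

/-- The point `a + s (b - a)` of the edge `i`. -/
def edgePt (i : Fin T.numEdges) (s : ℝ) : Plane := AffineMap.lineMap (T.a i) (T.b i) s

/-- The integral over the edge `i` with respect to arclength. -/
def edgeIntegral (i : Fin T.numEdges) (f : Plane → ℝ) : ℝ :=
  dist (T.a i) (T.b i) * ∫ s in (0 : ℝ)..1, f (T.edgePt i s)

open Classical in
/-- The unit vector normal to the edge `i` that points out of the element. -/
def normal (i : Fin T.numEdges) : Plane :=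
  if h : ∃ n : Plane, ‖n‖ = 1 ∧ inner ℝ n (T.b i - T.a i) = 0 ∧
      ∀ x ∈ openSegment ℝ (T.a i) (T.b i), ∀ᶠ t : ℝ in 𝓝[>] 0, x + t • n ∉ T.carrier
  then h.choose else 0

/-- The boundary integral `∫_∂T g (τ · n_T)`. -/
def boundaryFlux (g : Plane → ℝ) (τ : Fin 2 → MvPolynomial (Fin 2) ℝ) : ℝ :=
  ∑ i, T.edgeIntegral i fun x => g x * inner ℝ (evVec τ x) (T.normal i)

/-! ### Projections on the element -/

open Classical in
/-- The `L²(T)`-orthogonal projection onto the polynomials of degree `≤ ℓ`. -/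
def proj (ℓ : ℤ) (f : Plane → ℝ) : Poly ℓ :=
  if h : ∃ p : Poly ℓ, ∀ q : Poly ℓ,
      ∫ x in T.carrier, (f x - ev (p : MvPolynomial (Fin 2) ℝ) x) * ev q x = 0
  then h.choose else 0

open Classical in
/-- The `L²(T; ℝ²)`-orthogonal projection onto the vector polynomials of degree `≤ ℓ`. -/
def vecProj (ℓ : ℤ) (f : Plane → Plane) : VecPoly ℓ :=
  if h : ∃ p : VecPoly ℓ, ∀ τ : VecPoly ℓ,
      ∫ x in T.carrier,
        inner ℝ (f x - evVec (p : Fin 2 → MvPolynomial (Fin 2) ℝ) x) (evVec τ x) = 0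
  then h.choose else 0

/-! ### Sobolev space, traces, weak Laplacian -/

/-- Test functions: smooth functions with compact support contained in the element. -/
def IsTest (φ : Plane → ℝ) : Prop :=
  ContDiff ℝ ∞ φ ∧ HasCompactSupport φ ∧ tsupport φ ⊆ T.carrier

/-- `g` is the weak gradient of `v` in the element. -/
def IsWeakGrad (v : Plane → ℝ) (g : Plane → Plane) : Prop :=
  ∀ φ : Plane → ℝ, T.IsTest φ →
    ∫ x in T.carrier, v x • gradient φ x = - ∫ x in T.carrier, φ x • g x

/-- The Sobolev space `H¹(T)`. An element is a function of `L²(T)` together with its (unique) weak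
gradient in `L²(T; ℝ²)`. -/
def H1 : Type :=
  {u : Lp ℝ 2 T.vol × Lp Plane 2 T.vol // T.IsWeakGrad u.1 u.2}

variable {T} in
/-- The function underlying an element of `H¹(T)`. -/
def H1.fn (v : T.H1) : Plane → ℝ := v.1.1

variable {T} in
/-- The weak gradient of an element of `H¹(T)`. -/
def H1.grad (v : T.H1) : Plane → Plane := v.1.2

/-- `g` is the trace of `v ∈ H¹(T)` on `∂T`: some functions smooth up to the boundary converge to
`v` in `H¹(T)` while their restrictions to each edge converge to `g` in `L²`. Only the values of
`g` on `∂T` are involved. -/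
def HasTrace (v : T.H1) (g : Plane → ℝ) : Prop :=
  ∃ φ : ℕ → Plane → ℝ, (∀ n, ContDiff ℝ ∞ (φ n)) ∧
    Tendsto (fun n => eLpNorm (fun x => φ n x - v.fn x) 2 T.vol) atTop (𝓝 0) ∧
    Tendsto (fun n => eLpNorm (fun x => gradient (φ n) x - v.grad x) 2 T.vol) atTop (𝓝 0) ∧
    ∀ i, Tendsto (fun n => eLpNorm (fun s => φ n (T.edgePt i s) - g (T.edgePt i s)) 2
      (volume.restrict (Set.Icc (0 : ℝ) 1))) atTop (𝓝 0)

/-- `g` is a continuous function on `∂T` that is the trace of `v`. -/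
def IsContTrace (v : T.H1) (g : Plane → ℝ) : Prop :=
  ContinuousOn g (frontier T.carrier) ∧ T.HasTrace v g

open Classical in
/-- The continuous representative on `∂T` of the trace of `v`, which gives a meaning to the values
of `v` on the edges and at the vertices. -/
def trace (v : T.H1) : Plane → ℝ :=
  if h : ∃ g : Plane → ℝ, T.IsContTrace v g then h.choose else 0

/-- The distributional Laplacian of `v ∈ H¹(T)` is the function `p`. -/
def HasLaplacian (v : T.H1) (p : Plane → ℝ) : Prop :=
  ∀ φ : Plane → ℝ, T.IsTest φ →
    ∫ x in T.carrier, inner ℝ (v.grad x) (gradient φ x) = - ∫ x in T.carrier, p x * φ x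

/-! ### Virtual space and degrees of freedom -/

variable (k : ℕ)

/-- The local virtual space `V_T`, for a complement `C` of the polynomials of degree `≤ k - 1` in
those of degree `≤ k + 1`. -/
def virtualSpace (C : Submodule ℝ (MvPolynomial (Fin 2) ℝ)) : Set T.H1 :=
  {v | (∃ g : Plane → ℝ, T.HasTrace v g ∧ ∀ i, ∃ q ∈ EdgePoly ((k : ℤ) + 1),
          ∀ᵐ s ∂(volume.restrict (Set.Icc (0 : ℝ) 1)), g (T.edgePt i s) = q.eval s) ∧
       (∃ p ∈ Poly ((k : ℤ) + 1), T.HasLaplacian v (ev p)) ∧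
       ∀ w ∈ C, ∫ x in T.carrier,
          inner ℝ (v.grad x - evVec (T.vecProj k v.grad) x) (x - T.center) * ev w x = 0}

/-- The space of degrees of freedom of the element: a polynomial of degree `≤ k - 1` on the element,
one on each edge, and a value at each vertex. -/
abbrev DOF : Type :=
  Poly ((k : ℤ) - 1) × (Fin T.numEdges → EdgePoly ((k : ℤ) - 1)) × (T.vertices → ℝ)

/-- The degrees-of-freedom map `σ_T`. -/
def dofs (v : T.H1) : T.DOF k :=
  (T.proj ((k : ℤ) - 1) v.fn,
   fun i => edgeProj ((k : ℤ) - 1) fun s => T.trace v (T.edgePt i s),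
   fun x => T.trace v x)

/-! ### Reconstructions from the degrees of freedom -/

variable {T k}

open Classical in
/-- The edge reconstruction: the polynomial of degree `≤ k + 1` on the edge `i` with prescribed
projection on degree `≤ k - 1` and prescribed values at the endpoints. -/
def edgeRec (d : T.DOF k) (i : Fin T.numEdges) : EdgePoly ((k : ℤ) + 1) :=
  if h : ∃ q : EdgePoly ((k : ℤ) + 1),
      edgeProj ((k : ℤ) - 1) (fun s => (q : Polynomial ℝ).eval s) = d.2.1 i ∧
      (q : Polynomial ℝ).eval 0 = d.2.2 ⟨T.a i, T.a_mem i⟩ ∧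
      (q : Polynomial ℝ).eval 1 = d.2.2 ⟨T.b i, T.b_mem i⟩
  then h.choose else 0

open Classical in
/-- The boundary reconstruction `γ_∂T`: the continuous function on `∂T` that coincides with the edge
reconstruction on each edge. Its values outside `∂T` are immaterial. -/
def traceRec (d : T.DOF k) : Plane → ℝ :=
  if h : ∃ g : Plane → ℝ, ContinuousOn g (frontier T.carrier) ∧
      ∀ i, ∀ s ∈ Set.Icc (0 : ℝ) 1, g (T.edgePt i s) = (edgeRec d i : Polynomial ℝ).eval s
  then h.choose else 0

open Classical in
/-- The discrete gradient `G_T`. -/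
def gradRec (d : T.DOF k) : VecPoly k :=
  if h : ∃ G : VecPoly k, ∀ τ : VecPoly k,
      ∫ x in T.carrier, inner ℝ (evVec (G : Fin 2 → MvPolynomial (Fin 2) ℝ) x) (evVec τ x) =
        - (∫ x in T.carrier, ev d.1 x * ev (divPoly τ) x) + T.boundaryFlux (traceRec d) τ
  then h.choose else 0

open Classical in
/-- The potential reconstruction `R_T^a`. -/
def potRec (d : T.DOF k) : Poly ((k : ℤ) + 1) :=
  if h : ∃ R : Poly ((k : ℤ) + 1), ∀ w ∈ Poly ((k : ℤ) + 1),
      ∫ x in T.carrier,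
          ev (R : MvPolynomial (Fin 2) ℝ) x * ev (divPoly (radial T.center w)) x =
        - (∫ x in T.carrier, inner ℝ (evVec (gradRec d) x) (evVec (radial T.center w) x)) +
          T.boundaryFlux (traceRec d) (radial T.center w)
  then h.choose else 0

variable (T k)

/-- The operator `Π_T^a = R_T^a ∘ σ_T`. -/
def projA (v : T.H1) : Poly ((k : ℤ) + 1) := potRec (T.dofs k v)

open Classical in
/-- The reconstruction `R_T^L = π_T^k ∘ σ_T⁻¹`, with `σ_T` considered on the virtual space. -/
def recL (C : Submodule ℝ (MvPolynomial (Fin 2) ℝ)) (d : T.DOF k) : Poly k :=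
  if h : ∃ v : T.virtualSpace k C, T.dofs k v = d then T.proj k h.choose.1.fn else 0

end PolygonalElement

end NodalVEM

end

/-! The identities are integrations by parts. If τ has degree ≤ k then div τ has degree ≤ k - 1, so
Green's formula for v tested with τ involves only the boundary values and moments kept by σ_T v, and
it is the equation defining G_T: hence `gradRec_eq`. Given this, Green's formula for τ = (x - x_T) w
shows that R^a_T(σ_T v) and v agree against div((x - x_T) w) exactly when ∇v - π^k ∇v is orthogonal
to (x - x_T) w (`moment_iff`). For w of degree ≤ k - 1 the field has degree ≤ k and the projection
gives orthogonality; for w in the complement it is the condition in V_T. As w ↦ div((x - x_T) w) is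
an automorphism of P^{k+1} (`exists_divPoly_radial_eq`), R^a_T(σ_T v) = π^{k+1} v
(`virtualSpace_spec`), and π^k of this is the formula for R^L.

Injectivity of σ_T: the difference of two functions with the same degrees of freedom has zero trace,
a Laplacian in P^{k+1} and zero projection on P^{k+1}. Testing its Laplacian with the function
itself gives zero energy (`Approx.eq_zero`). The function is not a test function, so it is cut off
near ∂T; the large gradient of the cut-off is compensated by the smallness of the function there
(`Approx.collar_le`).

Surjectivity: given d, solve a Dirichlet problem with boundary values γ_∂T d and with the P^{k+1}
moments of R^a_T d (`exists_constrained_solution`). From a Lipschitz lifting with these data one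
removes the potential whose gradient is the projection of the lifting's gradient onto gradients with
vanishing trace and moments; the Lagrange multiplier of the moment constraint is the polynomial
Laplacian. Reading `moment_iff` backwards puts the solution in V_T, and `integral_potRec` identifies
its lower moments with those of d.

The analysis rests on polar coordinates about points of the kernel of T. Integrating d/dr (r² g)
along rays gives Green's formula for (x - y) g, and comparing two centres gives it for constant
directions (`green`). Traces are limits of restrictions of smooth functions. At a vertex, the
difference of the traces on two edges is square integrable against dr / r, so it cannot tend to a
nonzero limit (`Approx.corner`); this makes the trace continuous. -/

namespace NodalVEM

/-! ### Finite-dimensional linear algebra -/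

/-- A bilinear form on a finite-dimensional space with trivial left kernel represents every
linear functional. -/
lemma exists_represents {W : Type*} [AddCommGroup W] [Module ℝ W] [FiniteDimensional ℝ W]
    (B : W →ₗ[ℝ] W →ₗ[ℝ] ℝ) (hB : ∀ w, (∀ u, B w u = 0) → w = 0) (l : W →ₗ[ℝ] ℝ) :
    ∃ w, ∀ u, B w u = l u := by
  have hinj : Function.Injective B := by
    rw [injective_iff_map_eq_zero]
    intro w hw
    exact hB w fun u => by rw [hw]; rfl
  have hsurj : Function.Surjective B :=
    (LinearMap.injective_iff_surjective_of_finrank_eq_finrank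
      (Subspace.dual_finrank_eq (K := ℝ) (V := W)).symm).1 hinj
  obtain ⟨w, hw⟩ := hsurj l
  exact ⟨w, fun u => by rw [hw]⟩

/-! ### Polynomials in two variables -/

lemma mem_poly {l : ℤ} {p : MvPolynomial (Fin 2) ℝ} :
    p ∈ Poly l ↔ ∀ m ∈ p.support, (m.degree : ℤ) ≤ l := by
  rw [Poly, MvPolynomial.mem_restrictSupport_iff]
  rfl

lemma poly_mono {l m : ℤ} (h : l ≤ m) : Poly l ≤ Poly m := fun _ hp =>
  mem_poly.2 fun n hn => (mem_poly.1 hp n hn).trans h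

lemma monomial_mem_poly {l : ℤ} {m : Fin 2 →₀ ℕ} (h : (m.degree : ℤ) ≤ l) (r : ℝ) :
    MvPolynomial.monomial m r ∈ Poly l := by
  rw [Poly, MvPolynomial.monomial_mem_restrictSupport]
  exact Or.inl h

instance (l : ℤ) : FiniteDimensional ℝ (Poly l) := by
  have hfin : Set.Finite {m : Fin 2 →₀ ℕ | (m.degree : ℤ) ≤ l} := by
    refine (Finsupp.finite_of_degree_le (σ := Fin 2) l.toNat).subset ?_
    intro m hm
    have hm' : (m.degree : ℤ) ≤ l := hm
    show m.degree ≤ l.toNat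
    omega
  have := hfin.to_subtype
  exact Module.Finite.of_basis (MvPolynomial.basisRestrictSupport ℝ _)

instance (l : ℤ) : FiniteDimensional ℝ (VecPoly l) := by
  let f : VecPoly l →ₗ[ℝ] (Fin 2 → Poly l) :=
    LinearMap.pi fun j => LinearMap.codRestrict (Poly l)
      ((LinearMap.proj j).comp (VecPoly l).subtype) fun τ => τ.2 j (Set.mem_univ j)
  refine FiniteDimensional.of_injective f fun x y h => ?_
  ext1
  funext j
  exact congrArg Subtype.val (congrFun h j)

/-- Monomials span `Poly l`, so degree bounds for the derivations and multiplications below need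
only be checked on them. -/
lemma poly_induction {l : ℤ} {S : Submodule ℝ (MvPolynomial (Fin 2) ℝ)}
    {f : MvPolynomial (Fin 2) ℝ →ₗ[ℝ] MvPolynomial (Fin 2) ℝ}
    (h : ∀ m : Fin 2 →₀ ℕ, (m.degree : ℤ) ≤ l → f (MvPolynomial.monomial m 1) ∈ S)
    {p : MvPolynomial (Fin 2) ℝ} (hp : p ∈ Poly l) : f p ∈ S := by
  have : Poly l ≤ S.comap f := by
    rw [Poly, MvPolynomial.restrictSupport_eq_span, Submodule.span_le]
    rintro _ ⟨m, hm, rfl⟩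
    exact h m hm
  exact this hp

lemma pderiv_mem_poly {l : ℤ} {p : MvPolynomial (Fin 2) ℝ} (hp : p ∈ Poly l) (j : Fin 2) :
    MvPolynomial.pderiv j p ∈ Poly (l - 1) := by
  refine poly_induction (f := (MvPolynomial.pderiv j).toLinearMap) (fun m hm => ?_) hp
  show MvPolynomial.pderiv j (MvPolynomial.monomial m 1) ∈ _
  rw [MvPolynomial.pderiv_monomial]
  by_cases h : m j = 0
  · simp [h]
  · refine monomial_mem_poly ?_ _
    -- The subtraction of exponents is truncated; the degree really drops by one because `m j ≠ 0`.
    have h1 : (m - Finsupp.single j 1).degree + 1 = m.degree := by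
      have : m - Finsupp.single j 1 + Finsupp.single j 1 = m :=
        tsub_add_cancel_of_le (by rw [Finsupp.single_le_iff]; omega)
      conv_rhs => rw [← this]
      rw [map_add, Finsupp.degree_single]
    omega

lemma X_sub_C_mul_mem_poly {l : ℤ} {p : MvPolynomial (Fin 2) ℝ} (hp : p ∈ Poly l) (j : Fin 2)
    (c : ℝ) : (MvPolynomial.X j - MvPolynomial.C c) * p ∈ Poly (l + 1) := by
  refine poly_induction (f := LinearMap.mulLeft ℝ (MvPolynomial.X j - MvPolynomial.C c))
    (fun m hm => ?_) hp
  rw [LinearMap.mulLeft_apply, sub_mul, MvPolynomial.X, MvPolynomial.monomial_mul,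
    MvPolynomial.C_mul_monomial]
  refine Submodule.sub_mem _ (monomial_mem_poly ?_ _) (monomial_mem_poly (by omega) _)
  rw [map_add, Finsupp.degree_single]
  push_cast
  omega

lemma radial_mem_vecPoly {l : ℤ} {w : MvPolynomial (Fin 2) ℝ} (hw : w ∈ Poly l) (c : Plane) :
    radial c w ∈ VecPoly (l + 1) := fun j _ => X_sub_C_mul_mem_poly hw j (c j)

lemma divPoly_mem_poly {l : ℤ} {τ : Fin 2 → MvPolynomial (Fin 2) ℝ} (hτ : τ ∈ VecPoly l) :
    divPoly τ ∈ Poly (l - 1) :=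
  Submodule.sum_mem _ fun j _ => pderiv_mem_poly (hτ j (Set.mem_univ j)) j

lemma divPoly_radial_mem_poly {l : ℤ} {w : MvPolynomial (Fin 2) ℝ} (hw : w ∈ Poly l)
    (c : Plane) : divPoly (radial c w) ∈ Poly l := by
  simpa using divPoly_mem_poly (radial_mem_vecPoly hw c)

/-! ### Polynomial functions -/

@[simp] lemma ev_add (p q : MvPolynomial (Fin 2) ℝ) (x : Plane) : ev (p + q) x = ev p x + ev q x :=
  map_add _ _ _

@[simp] lemma ev_sub (p q : MvPolynomial (Fin 2) ℝ) (x : Plane) : ev (p - q) x = ev p x - ev q x :=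
  map_sub _ _ _

@[simp] lemma ev_mul (p q : MvPolynomial (Fin 2) ℝ) (x : Plane) : ev (p * q) x = ev p x * ev q x :=
  map_mul _ _ _

@[simp] lemma ev_smul (r : ℝ) (p : MvPolynomial (Fin 2) ℝ) (x : Plane) :
    ev (r • p) x = r * ev p x := by
  simp [ev, MvPolynomial.smul_eval]

@[simp] lemma ev_zero (x : Plane) : ev 0 x = 0 := map_zero _

@[simp] lemma ev_sum {ι : Type*} (s : Finset ι) (p : ι → MvPolynomial (Fin 2) ℝ) (x : Plane) :
    ev (∑ i ∈ s, p i) x = ∑ i ∈ s, ev (p i) x := map_sum _ _ _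

@[simp] lemma ev_X (j : Fin 2) (x : Plane) : ev (MvPolynomial.X j) x = x j := by simp [ev]

@[simp] lemma ev_C (r : ℝ) (x : Plane) : ev (MvPolynomial.C r) x = r := by simp [ev]

@[simp] lemma evVec_apply (τ : Fin 2 → MvPolynomial (Fin 2) ℝ) (x : Plane) (j : Fin 2) :
    evVec τ x j = ev (τ j) x := rfl

@[simp] lemma evVec_add (σ τ : Fin 2 → MvPolynomial (Fin 2) ℝ) (x : Plane) :
    evVec (σ + τ) x = evVec σ x + evVec τ x := by ext j; simp

@[simp] lemma evVec_sub (σ τ : Fin 2 → MvPolynomial (Fin 2) ℝ) (x : Plane) :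
    evVec (σ - τ) x = evVec σ x - evVec τ x := by ext j; simp

@[simp] lemma evVec_smul (r : ℝ) (τ : Fin 2 → MvPolynomial (Fin 2) ℝ) (x : Plane) :
    evVec (r • τ) x = r • evVec τ x := by ext j; simp

lemma evVec_radial (c : Plane) (w : MvPolynomial (Fin 2) ℝ) (x : Plane) :
    evVec (radial c w) x = ev w x • (x - c) := by
  ext j; simp [radial, mul_comm]

@[fun_prop]
lemma contDiff_ev (p : MvPolynomial (Fin 2) ℝ) {n : WithTop ℕ∞} : ContDiff ℝ n (ev p) := by
  induction p using MvPolynomial.induction_on with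
  | C r => simpa [funext (ev_C r)] using contDiff_const
  | add p q hp hq => simpa [funext (ev_add p q)] using hp.add hq
  | mul_X p j hp =>
    have : ev (p * MvPolynomial.X j) = fun x => ev p x * x j := by ext x; simp
    rw [this]
    fun_prop

@[fun_prop]
lemma continuous_ev (p : MvPolynomial (Fin 2) ℝ) : Continuous (ev p) :=
  (contDiff_ev p (n := 0)).continuous

@[fun_prop]
lemma continuous_evVec (τ : Fin 2 → MvPolynomial (Fin 2) ℝ) : Continuous (evVec τ) := by
  unfold evVec
  fun_prop

lemma hasFDerivAt_ev (p : MvPolynomial (Fin 2) ℝ) (x : Plane) :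
    HasFDerivAt (ev p)
      (∑ j, ev (MvPolynomial.pderiv j p) x • (EuclideanSpace.proj j : Plane →L[ℝ] ℝ)) x := by
  induction p using MvPolynomial.induction_on with
  | C r =>
    have : ev (MvPolynomial.C r) = fun _ => r := funext (ev_C r)
    simpa [this] using hasFDerivAt_const r x
  | add p q hp hq =>
    have : ev (p + q) = ev p + ev q := funext (ev_add p q)
    rw [this]
    refine (hp.add hq).congr_fderiv ?_
    simp only [map_add, ev_add, add_smul, Finset.sum_add_distrib]
  | mul_X p j hp =>
    have : ev (p * MvPolynomial.X j) = fun x => ev p x * (EuclideanSpace.proj j : Plane →L[ℝ] ℝ) x := by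
      ext x; simp
    rw [this]
    refine (hp.mul (EuclideanSpace.proj j : Plane →L[ℝ] ℝ).hasFDerivAt).congr_fderiv ?_
    ext v
    simp only [Fin.sum_univ_two, Derivation.leibniz, MvPolynomial.pderiv_X]
    fin_cases j <;> simp <;> ring

lemma fderiv_ev_apply (p : MvPolynomial (Fin 2) ℝ) (x v : Plane) :
    fderiv ℝ (ev p) x v = ∑ j, ev (MvPolynomial.pderiv j p) x * v j := by
  rw [(hasFDerivAt_ev p x).fderiv]
  simp

lemma ev_divPoly_radial (c : Plane) (w : MvPolynomial (Fin 2) ℝ) (x : Plane) :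
    ev (divPoly (radial c w)) x = 2 * ev w x + fderiv ℝ (ev w) x (x - c) := by
  simp [divPoly, radial, fderiv_ev_apply, Derivation.leibniz, Fin.sum_univ_two]
  ring

/-- A polynomial vanishing on a nonempty open set is zero. -/
lemma eq_zero_of_ev_eq_zero {U : Set Plane} (hU : IsOpen U) (hne : U.Nonempty)
    {p : MvPolynomial (Fin 2) ℝ} (h : ∀ x ∈ U, ev p x = 0) : p = 0 := by
  obtain ⟨x, hx⟩ := hne
  have hU' : IsOpen ((WithLp.toLp 2 : (Fin 2 → ℝ) → Plane) ⁻¹' U) :=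
    hU.preimage (PiLp.continuous_toLp 2 _)
  obtain ⟨ε, hε, hb⟩ := Metric.isOpen_iff.1 hU' (WithLp.ofLp x) hx
  -- An open set contains a product of intervals, and a polynomial vanishing on a product of
  -- infinite sets is zero.
  refine MvPolynomial.funext_set (s := fun j => Metric.ball (x j) ε) (fun j => ?_) fun y hy => ?_
  · rw [Real.ball_eq_Ioo]
    exact Set.Ioo_infinite (by linarith)
  · rw [map_zero]
    refine h (WithLp.toLp 2 y) (hb ?_)
    rw [ball_pi _ hε]
    exact hy

/-- By Euler's formula, t · div((x - c) w) at c + t (x - c) is the derivative of t² w(c + t (x -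
c)). If the divergence vanishes this function of t is constant, and its values at 0 and 1 are 0 and
w(x). -/
lemma divPoly_radial_injective {c : Plane} {w : MvPolynomial (Fin 2) ℝ}
    (h : divPoly (radial c w) = 0) : w = 0 := by
  refine eq_zero_of_ev_eq_zero isOpen_univ ⟨c, trivial⟩ fun x _ => ?_
  have hd : ∀ t : ℝ, HasDerivAt (fun t : ℝ => t ^ 2 * ev w (c + t • (x - c))) 0 t := by
    intro t
    have h1 : HasDerivAt (fun t : ℝ => c + t • (x - c)) (x - c) t := by
      simpa using ((hasDerivAt_id t).smul_const (x - c)).const_add c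
    have h2 := (((contDiff_ev w (n := 1)).differentiable (by simp))
      (c + t • (x - c))).hasFDerivAt.comp_hasDerivAt t h1
    refine ((hasDerivAt_pow 2 t).mul h2).congr_deriv ?_
    have h3 := ev_divPoly_radial c w (c + t • (x - c))
    rw [h, ev_zero] at h3
    simp only [add_sub_cancel_left, map_smul, smul_eq_mul] at h3
    simp only [Function.comp]
    linear_combination -t * h3
  have hc := is_const_of_deriv_eq_zero (fun t => (hd t).differentiableAt) (fun t => (hd t).deriv) 1 0
  simpa using hc

/-- The map `w ↦ div ((x - c) w)` is onto on polynomials of degree `≤ l`. -/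
lemma exists_divPoly_radial_eq {l : ℤ} (c : Plane) {p : MvPolynomial (Fin 2) ℝ} (hp : p ∈ Poly l) :
    ∃ w ∈ Poly l, divPoly (radial c w) = p := by
  let f : MvPolynomial (Fin 2) ℝ →ₗ[ℝ] MvPolynomial (Fin 2) ℝ :=
    { toFun := fun w => divPoly (radial c w)
      map_add' := fun u v => by simp only [divPoly, radial, mul_add, map_add, Finset.sum_add_distrib]
      map_smul' := fun r u => by
        simp only [divPoly, radial, mul_smul_comm, Derivation.map_smul, Finset.smul_sum,
          RingHom.id_apply] }
  let g : Poly l →ₗ[ℝ] Poly l := f.restrict fun w hw => divPoly_radial_mem_poly hw c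
  -- The map preserves the finite-dimensional space `Poly l`, where injectivity implies
  -- surjectivity.
  have hg : Function.Injective g := by
    rw [injective_iff_map_eq_zero]
    intro w hw
    exact Subtype.ext (divPoly_radial_injective (c := c) (congrArg Subtype.val hw))
  obtain ⟨w, hw⟩ := LinearMap.injective_iff_surjective.1 hg ⟨p, hp⟩
  exact ⟨w, w.2, congrArg Subtype.val hw⟩

/-! ### Polynomials on an edge -/

lemma mem_edgePoly {l : ℤ} {q : Polynomial ℝ} :
    q ∈ EdgePoly l ↔ q.degree < ((l + 1).toNat : ℕ) := Polynomial.mem_degreeLT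

lemma finrank_edgePoly (l : ℤ) : Module.finrank ℝ (EdgePoly l) = (l + 1).toNat := by
  rw [EdgePoly, (Polynomial.degreeLTEquiv ℝ (l + 1).toNat).finrank_eq, Module.finrank_fin_fun]

instance (l : ℤ) : FiniteDimensional ℝ (EdgePoly l) :=
  Module.Finite.equiv (Polynomial.degreeLTEquiv ℝ (l + 1).toNat).symm

/-- The weight may vanish at the endpoints: it is 1 for projections and s (1 - s) for the
unisolvence of the edge degrees of freedom. -/
lemma polynomial_eq_zero_of_integral {r : Polynomial ℝ} {b : ℝ → ℝ} (hb : Continuous b)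
    (hpos : ∀ s ∈ Set.Ioo (0 : ℝ) 1, 0 < b s)
    (h : ∫ s in (0 : ℝ)..1, b s * r.eval s ^ 2 = 0) : r = 0 := by
  refine Polynomial.eq_zero_of_infinite_isRoot r
    ((Set.Ioo_infinite (zero_lt_one' ℝ)).mono fun s hs => ?_)
  by_contra hne
  have hbnn : ∀ s ∈ Set.Icc (0 : ℝ) 1, 0 ≤ b s := by
    have : Set.Icc (0 : ℝ) 1 ⊆ closure (Set.Ioo 0 1) := by rw [closure_Ioo (by norm_num)]
    intro s hs
    exact closure_minimal (fun x hx => (hpos x hx).le) (isClosed_Ici.preimage hb) (this hs)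
  have : 0 < ∫ s in (0 : ℝ)..1, b s * r.eval s ^ 2 :=
    intervalIntegral.integral_pos zero_lt_one (by fun_prop)
      (fun x hx => mul_nonneg (hbnn x ⟨hx.1.le, hx.2⟩) (sq_nonneg _))
      ⟨s, ⟨hs.1.le, hs.2.le⟩, mul_pos (hpos s hs) (pow_pos_of_ne hne)⟩
  exact this.ne' h
where
  pow_pos_of_ne {x : ℝ} (h : x ≠ 0) : 0 < x ^ 2 := by positivity

/-- The `L²(0,1)` pairing of a function with polynomials. -/
noncomputable def edgePairing (l : ℤ) (f : ℝ → ℝ) (hf : ContinuousOn f (Set.Icc 0 1)) :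
    EdgePoly l →ₗ[ℝ] ℝ where
  toFun r := ∫ s in (0 : ℝ)..1, f s * (r : Polynomial ℝ).eval s
  map_add' r r' := by
    rw [← intervalIntegral.integral_add]
    · simp [mul_add]
    all_goals
      refine ContinuousOn.intervalIntegrable ?_
      rw [Set.uIcc_of_le zero_le_one]
      fun_prop
  map_smul' c r := by
    rw [RingHom.id_apply, smul_eq_mul, ← intervalIntegral.integral_const_mul]
    congr 1 with s
    simp
    ring

lemma intervalIntegrable_mul_eval {f : ℝ → ℝ} (hf : ContinuousOn f (Set.Icc 0 1))
    (q : Polynomial ℝ) : IntervalIntegrable (fun s => f s * q.eval s) volume 0 1 := by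
  refine ContinuousOn.intervalIntegrable ?_
  rw [Set.uIcc_of_le zero_le_one]
  fun_prop

lemma integral_sub_mul_eval {f : ℝ → ℝ} (hf : ContinuousOn f (Set.Icc 0 1))
    (q r : Polynomial ℝ) : ∫ s in (0 : ℝ)..1, (f s - q.eval s) * r.eval s =
      (∫ s in (0 : ℝ)..1, f s * r.eval s) - ∫ s in (0 : ℝ)..1, q.eval s * r.eval s := by
  rw [← intervalIntegral.integral_sub (intervalIntegrable_mul_eval hf r)
    (intervalIntegrable_mul_eval (by fun_prop) r)]
  simp [sub_mul]

/-- The `L²(0,1)` inner product of edge polynomials. -/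
noncomputable def edgeMass (l m : ℤ) : EdgePoly l →ₗ[ℝ] EdgePoly m →ₗ[ℝ] ℝ where
  toFun q := edgePairing m (fun s => (q : Polynomial ℝ).eval s) (by fun_prop)
  map_add' q q' := by
    ext r
    simp only [edgePairing, LinearMap.coe_mk, AddHom.coe_mk, LinearMap.add_apply]
    rw [← intervalIntegral.integral_add (intervalIntegrable_mul_eval (by fun_prop) _)
      (intervalIntegrable_mul_eval (by fun_prop) _)]
    simp [add_mul]
  map_smul' c q := by
    ext r
    simp only [edgePairing, LinearMap.coe_mk, AddHom.coe_mk, LinearMap.smul_apply,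
      RingHom.id_apply, smul_eq_mul]
    rw [← intervalIntegral.integral_const_mul]
    congr 1 with s
    simp
    ring

lemma exists_edgeProj (l : ℤ) {f : ℝ → ℝ} (hf : ContinuousOn f (Set.Icc 0 1)) :
    ∃ q : EdgePoly l, ∀ r : EdgePoly l,
      ∫ s in (0 : ℝ)..1, (f s - (q : Polynomial ℝ).eval s) * (r : Polynomial ℝ).eval s = 0 := by
  obtain ⟨q, hq⟩ := exists_represents (edgeMass l l) (fun w hw => by
    have h := hw w
    refine Subtype.ext (polynomial_eq_zero_of_integral (b := fun _ => 1) (by fun_prop)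
      (fun _ _ => one_pos) ?_)
    refine Eq.trans ?_ h
    simp only [edgeMass, edgePairing, LinearMap.coe_mk, AddHom.coe_mk, one_mul, sq])
    (edgePairing l f hf)
  refine ⟨q, fun r => ?_⟩
  rw [integral_sub_mul_eval hf, sub_eq_zero]
  exact (hq r).symm

/-- Continuity on [0, 1] makes the orthogonality problem solvable, so the default value in
`edgeProj` is not taken. -/
lemma edgeProj_spec (l : ℤ) {f : ℝ → ℝ} (hf : ContinuousOn f (Set.Icc 0 1)) (r : EdgePoly l) :
    ∫ s in (0 : ℝ)..1,
      (f s - (edgeProj l f : Polynomial ℝ).eval s) * (r : Polynomial ℝ).eval s = 0 := by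
  have h := exists_edgeProj l hf
  rw [edgeProj, dif_pos h]
  exact h.choose_spec r

lemma edgeProj_eq_iff {l : ℤ} {f : ℝ → ℝ} (hf : ContinuousOn f (Set.Icc 0 1)) {q : EdgePoly l} :
    edgeProj l f = q ↔ ∀ r : EdgePoly l,
      ∫ s in (0 : ℝ)..1, (f s - (q : Polynomial ℝ).eval s) * (r : Polynomial ℝ).eval s = 0 := by
  refine ⟨fun h => h ▸ edgeProj_spec l hf, fun h => ?_⟩
  rw [← sub_eq_zero]
  refine Subtype.ext (polynomial_eq_zero_of_integral (b := fun _ => 1) (by fun_prop)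
      (fun _ _ => one_pos) ?_)
  have h1 := edgeProj_spec l hf (edgeProj l f - q)
  have h2 := h (edgeProj l f - q)
  rw [integral_sub_mul_eval hf] at h1 h2
  rw [← sub_eq_zero] at h1
  have h3 := intervalIntegral.integral_sub (μ := volume)
    (intervalIntegrable_mul_eval (f := fun s => (edgeProj l f : Polynomial ℝ).eval s)
      (by fun_prop) (edgeProj l f - q : EdgePoly l))
    (intervalIntegrable_mul_eval (f := fun s => (q : Polynomial ℝ).eval s)
      (by fun_prop) (edgeProj l f - q : EdgePoly l))
  have h4 : ∀ s, 1 * ((edgeProj l f - q : EdgePoly l) : Polynomial ℝ).eval s ^ 2 =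
      (edgeProj l f : Polynomial ℝ).eval s * ((edgeProj l f - q : EdgePoly l) : Polynomial ℝ).eval s
      - (q : Polynomial ℝ).eval s * ((edgeProj l f - q : EdgePoly l) : Polynomial ℝ).eval s := by
    intro s
    simp
    ring
  simp only [h4]
  rw [h3]
  linarith

lemma edgeProj_congr {l : ℤ} {f g : ℝ → ℝ} (hf : ContinuousOn f (Set.Icc 0 1))
    (h : Set.EqOn f g (Set.Icc 0 1)) : edgeProj l f = edgeProj l g := by
  rw [edgeProj_eq_iff hf]
  intro r
  refine (intervalIntegral.integral_congr fun s hs => ?_).trans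
    (edgeProj_spec l (hf.congr h.symm) r)
  rw [Set.uIcc_of_le zero_le_one] at hs
  simp only [h hs]

/-- A polynomial of degree `≤ k + 1` on `[0, 1]` is determined by its moments of degree `≤ k - 1`
and its endpoint values. -/
lemma edgePoly_eq_zero {k : ℕ} {q : Polynomial ℝ} (hq : q ∈ EdgePoly ((k : ℤ) + 1))
    (h0 : q.eval 0 = 0) (h1 : q.eval 1 = 0)
    (h : ∀ r ∈ EdgePoly ((k : ℤ) - 1), ∫ s in (0 : ℝ)..1, q.eval s * r.eval s = 0) : q = 0 := by
  -- The two endpoint zeros give q = s (s - 1) r with r of degree ≤ k - 1. So r is itself an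
  -- admissible test function, and -q r = s (1 - s) r² has integral zero.
  obtain ⟨q1, rfl⟩ := Polynomial.dvd_iff_isRoot.2 h0
  have h1' : q1.eval 1 = 0 := by simpa using h1
  obtain ⟨r, rfl⟩ := Polynomial.dvd_iff_isRoot.2 h1'
  by_cases hr0 : r = 0
  · simp [hr0]
  have hr : r ∈ EdgePoly ((k : ℤ) - 1) := by
    rw [mem_edgePoly, ← Polynomial.natDegree_lt_iff_degree_lt hr0]
    rw [mem_edgePoly, ← Polynomial.natDegree_lt_iff_degree_lt
      (mul_ne_zero (Polynomial.X_sub_C_ne_zero _) (mul_ne_zero (Polynomial.X_sub_C_ne_zero _) hr0)),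
      Polynomial.natDegree_mul (Polynomial.X_sub_C_ne_zero _)
        (mul_ne_zero (Polynomial.X_sub_C_ne_zero _) hr0),
      Polynomial.natDegree_mul (Polynomial.X_sub_C_ne_zero _) hr0,
      Polynomial.natDegree_X_sub_C, Polynomial.natDegree_X_sub_C] at hq
    omega
  refine absurd (polynomial_eq_zero_of_integral (r := r) (b := fun s => s * (1 - s))
    (by fun_prop) (fun s hs => mul_pos hs.1 (by linarith [hs.2])) ?_) hr0
  have h2 := h r hr
  rw [← neg_eq_zero, ← intervalIntegral.integral_neg, ← h2]
  congr 1 with s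
  simp
  ring

/-- Existence and uniqueness of the edge reconstruction. -/
lemma exists_edgePoly (k : ℕ) (e : EdgePoly ((k : ℤ) - 1)) (α β : ℝ) :
    ∃ q : EdgePoly ((k : ℤ) + 1),
      edgeProj ((k : ℤ) - 1) (fun s => (q : Polynomial ℝ).eval s) = e ∧
      (q : Polynomial ℝ).eval 0 = α ∧ (q : Polynomial ℝ).eval 1 = β := by
  let E : ℝ → EdgePoly ((k : ℤ) + 1) →ₗ[ℝ] ℝ := fun t =>
    (Polynomial.leval t).comp (Submodule.subtype _)
  let F := (edgeMass _ ((k : ℤ) - 1)).prod ((E 0).prod (E 1))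
  have hinj : Function.Injective F := by
    rw [injective_iff_map_eq_zero]
    intro q hq
    refine Subtype.ext (edgePoly_eq_zero q.2 (congrArg (fun z => z.2.1) hq)
      (congrArg (fun z => z.2.2) hq) fun r hr => ?_)
    exact LinearMap.congr_fun (congrArg (fun z => z.1) hq) ⟨r, hr⟩
  -- Both sides have dimension k + 2; for k = 0 the space of moments is trivial and the two endpoint
  -- values suffice.
  have hdim : Module.finrank ℝ (EdgePoly ((k : ℤ) + 1)) =
      Module.finrank ℝ (Module.Dual ℝ (EdgePoly ((k : ℤ) - 1)) × ℝ × ℝ) := by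
    rw [Module.finrank_prod, Module.finrank_prod, Subspace.dual_finrank_eq, finrank_edgePoly,
      finrank_edgePoly, Module.finrank_self]
    omega
  obtain ⟨q, hq⟩ := (LinearMap.injective_iff_surjective_of_finrank_eq_finrank hdim).1 hinj
    (edgePairing _ (fun s => (e : Polynomial ℝ).eval s) (by fun_prop), α, β)
  refine ⟨q, ?_, congrArg (fun z => z.2.1) hq, congrArg (fun z => z.2.2) hq⟩
  rw [edgeProj_eq_iff (by fun_prop)]
  intro r
  rw [integral_sub_mul_eval (by fun_prop), sub_eq_zero]
  exact LinearMap.congr_fun (congrArg (fun z => z.1) hq) r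

lemma edgePoly_unique {k : ℕ} {q q' : EdgePoly ((k : ℤ) + 1)}
    (h : edgeProj ((k : ℤ) - 1) (fun s => (q : Polynomial ℝ).eval s) =
      edgeProj ((k : ℤ) - 1) (fun s => (q' : Polynomial ℝ).eval s))
    (h0 : (q : Polynomial ℝ).eval 0 = (q' : Polynomial ℝ).eval 0)
    (h1 : (q : Polynomial ℝ).eval 1 = (q' : Polynomial ℝ).eval 1) : q = q' := by
  rw [← sub_eq_zero]
  refine Subtype.ext (edgePoly_eq_zero (q - q').2 (by simpa [sub_eq_zero] using h0)
    (by simpa [sub_eq_zero] using h1) fun r hr => ?_)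
  have e1 := edgeProj_spec ((k : ℤ) - 1) (f := fun s => (q : Polynomial ℝ).eval s)
    (by fun_prop) ⟨r, hr⟩
  have e2 := edgeProj_spec ((k : ℤ) - 1) (f := fun s => (q' : Polynomial ℝ).eval s)
    (by fun_prop) ⟨r, hr⟩
  rw [integral_sub_mul_eval (by fun_prop), sub_eq_zero] at e1 e2
  rw [← h, ← e1] at e2
  have e3 := integral_sub_mul_eval (f := fun s => (q : Polynomial ℝ).eval s) (by fun_prop)
    (q' : Polynomial ℝ) r
  rw [e2, sub_self] at e3
  refine Eq.trans ?_ e3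
  simp

/-! ### Plane geometry -/

/-- The determinant of two plane vectors. -/
def cross (u v : Plane) : ℝ := u 0 * v 1 - u 1 * v 0

lemma inner_plane (u v : Plane) : inner ℝ u v = u 0 * v 0 + u 1 * v 1 := by
  simp [PiLp.inner_apply, Fin.sum_univ_two, mul_comm]

lemma norm_sq_plane (u : Plane) : ‖u‖ ^ 2 = u 0 ^ 2 + u 1 ^ 2 := by
  rw [EuclideanSpace.norm_sq_eq]
  simp [Fin.sum_univ_two]

lemma plane_ext {u v : Plane} (h0 : u 0 = v 0) (h1 : u 1 = v 1) : u = v := by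
  ext j; fin_cases j <;> assumption

@[fun_prop]
lemma Continuous.cross {X : Type*} [TopologicalSpace X] {u v : X → Plane} (hu : Continuous u)
    (hv : Continuous v) : Continuous fun x => cross (u x) (v x) := by
  unfold NodalVEM.cross
  fun_prop

/-- Cramer's rule. -/
lemma cross_smul_eq (u v w : Plane) : cross u v • w = cross w v • u + cross u w • v := by
  apply plane_ext <;> simp [cross] <;> ring

lemma exists_smul_of_cross_eq_zero {u v : Plane} (hu : u ≠ 0) (h : cross u v = 0) :
    ∃ c : ℝ, v = c • u := by
  have hn : ‖u‖ ^ 2 ≠ 0 := by simpa using hu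
  rw [norm_sq_plane] at hn
  refine ⟨inner ℝ u v / (u 0 ^ 2 + u 1 ^ 2), ?_⟩
  rw [inner_plane]
  unfold cross at h
  apply plane_ext
  · simp only [PiLp.smul_apply, smul_eq_mul]
    field_simp
    linear_combination (-u 1) * h
  · simp only [PiLp.smul_apply, smul_eq_mul]
    field_simp
    linear_combination (u 0) * h

namespace PolygonalElement

variable {T : PolygonalElement}

/-! ### Geometry of the element -/

/-- The element is star-shaped with respect to some ball centred at `y`. -/
def IsKernelPt (T : PolygonalElement) (y : Plane) : Prop :=
  ∃ r : ℝ, 0 < r ∧ ∀ z ∈ Metric.ball y r, StarConvex ℝ z T.carrier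

lemma isKernelPt_center : T.IsKernelPt T.center := T.starShaped

/-- Having more than one kernel point is what allows `green` to compare radial formulas with two
different centres. -/
lemma exists_ball_isKernelPt : ∃ r : ℝ, 0 < r ∧ ∀ y ∈ Metric.ball T.center r, T.IsKernelPt y := by
  obtain ⟨r, hr, h⟩ := T.starShaped
  refine ⟨r, hr, fun y hy => ?_⟩
  obtain ⟨ε, hε, hb⟩ := Metric.isOpen_iff.1 Metric.isOpen_ball y hy
  exact ⟨ε, hε, fun z hz => h z (hb hz)⟩

lemma IsKernelPt.mem {y : Plane} (hy : T.IsKernelPt y) : y ∈ T.carrier := by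
  obtain ⟨r, hr, h⟩ := hy
  exact (h y (Metric.mem_ball_self hr)).mem ⟨_, T.center_mem⟩

/-- A point w of the small ball is (1 - t) u + t p with u in the ball about y. When p is only in the
closure, it is replaced by a nearby q in the element; the corresponding u still lies in the open
ball, and star-convexity about u gives w. -/
lemma ball_subset_of_starConvex {y : Plane} {r : ℝ}
    (h : ∀ z ∈ Metric.ball y r, StarConvex ℝ z T.carrier) {p : Plane}
    (hp : p ∈ closure T.carrier) {t : ℝ} (ht0 : 0 ≤ t) (ht1 : t < 1) :
    Metric.ball (AffineMap.lineMap y p t) ((1 - t) * r) ⊆ T.carrier := by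
  intro w hw
  have h1t : 0 < 1 - t := sub_pos.2 ht1
  have hu : Continuous fun q : Plane => (1 - t)⁻¹ • (w - t • q) := by
    fun_prop
  have hup : (1 - t)⁻¹ • (w - t • p) ∈ Metric.ball y r := by
    rw [mem_ball_iff_norm] at hw ⊢
    have : (1 - t)⁻¹ • (w - t • p) - y = (1 - t)⁻¹ • (w - AffineMap.lineMap y p t) := by
      rw [AffineMap.lineMap_apply_module, eq_inv_smul_iff₀ h1t.ne', smul_sub,
        smul_inv_smul₀ h1t.ne']
      abel
    rw [this, norm_smul, Real.norm_eq_abs, abs_of_pos (inv_pos.2 h1t), inv_mul_lt_iff₀ h1t]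
    exact hw
  have hO : IsOpen {q : Plane | (1 - t)⁻¹ • (w - t • q) ∈ Metric.ball y r} :=
    Metric.isOpen_ball.preimage hu
  obtain ⟨q, hq, hqT⟩ : ({q : Plane | (1 - t)⁻¹ • (w - t • q) ∈ Metric.ball y r} ∩
    T.carrier).Nonempty := mem_closure_iff.1 hp _ hO hup
  change (1 - t)⁻¹ • (w - t • q) ∈ Metric.ball y r at hq
  have hwq : (1 - t) • ((1 - t)⁻¹ • (w - t • q)) + t • q = w := by
    rw [smul_inv_smul₀ h1t.ne', sub_add_cancel]
  have h2 := (h _ hq) hqT h1t.le ht0 (sub_add_cancel 1 t)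
  rw [← hwq]
  exact h2

lemma IsKernelPt.lineMap_mem {y : Plane} (hy : T.IsKernelPt y) {p : Plane}
    (hp : p ∈ closure T.carrier) {t : ℝ} (ht0 : 0 ≤ t) (ht1 : t < 1) :
    AffineMap.lineMap y p t ∈ T.carrier := by
  obtain ⟨r, hr, h⟩ := hy
  exact ball_subset_of_starConvex h hp ht0 ht1
    (Metric.mem_ball_self (mul_pos (by linarith) hr))

lemma notMem_of_mem_frontier {p : Plane} (hp : p ∈ frontier T.carrier) : p ∉ T.carrier := by
  rw [T.isOpen_carrier.frontier_eq] at hp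
  exact hp.2

lemma IsKernelPt.lineMap_notMem {y : Plane} (hy : T.IsKernelPt y) {p : Plane}
    (hp : p ∈ frontier T.carrier) {t : ℝ} (ht : 1 ≤ t) :
    AffineMap.lineMap y p t ∉ T.carrier := by
  intro h
  rcases ht.eq_or_lt with rfl | ht
  · rw [AffineMap.lineMap_apply_one] at h
    exact notMem_of_mem_frontier hp h
  · have := hy.lineMap_mem (subset_closure h) (t := t⁻¹) (by positivity)
      (inv_lt_one_of_one_lt₀ ht)
    rw [AffineMap.lineMap_lineMap_right, inv_mul_cancel₀ (by positivity),
      AffineMap.lineMap_apply_one] at this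
    exact notMem_of_mem_frontier hp this

/-- A ray from a kernel point meets the boundary only once, since every earlier point of the ray is
in the open element. This is the injectivity of polar coordinates. -/
lemma IsKernelPt.lineMap_inj {y : Plane} (hy : T.IsKernelPt y) {p p' : Plane}
    (hp : p ∈ frontier T.carrier) (hp' : p' ∈ frontier T.carrier) {t t' : ℝ} (ht : 0 < t)
    (ht' : 0 < t') (h : AffineMap.lineMap y p t = (AffineMap.lineMap y p' t' : Plane)) :
    t = t' ∧ p = p' := by
  have key : ∀ {p p' : Plane} {t t' : ℝ}, p ∈ frontier T.carrier → p' ∈ frontier T.carrier →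
      0 < t → 0 < t' → AffineMap.lineMap y p t = (AffineMap.lineMap y p' t' : Plane) → ¬ t' < t := by
    intro p p' t t' hp hp' ht ht' h hlt
    have h1 : p = AffineMap.lineMap y p' (t⁻¹ * t') := by
      rw [← AffineMap.lineMap_lineMap_right, ← h, AffineMap.lineMap_lineMap_right,
        inv_mul_cancel₀ ht.ne', AffineMap.lineMap_apply_one]
    refine notMem_of_mem_frontier hp (h1 ▸ hy.lineMap_mem hp'.1 (by positivity) ?_)
    rwa [inv_mul_lt_iff₀ ht, mul_one]
  have htt : t = t' := le_antisymm (not_lt.1 (key hp hp' ht ht' h))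
    (not_lt.1 (key hp' hp ht' ht h.symm))
  subst htt
  refine ⟨rfl, ?_⟩
  simpa [AffineMap.lineMap_apply, ht.ne'] using h

lemma exists_frontier {y : Plane} {x : Plane}
    (hx : x ∈ T.carrier) (hxy : x ≠ y) :
    ∃ p ∈ frontier T.carrier, ∃ t ∈ Set.Ioo (0 : ℝ) 1, x = AffineMap.lineMap y p t := by
  obtain ⟨R, hR⟩ := T.isBounded_carrier.subset_closedBall y
  have hd : 0 < ‖x - y‖ := norm_pos_iff.2 (sub_ne_zero.2 hxy)
  have hR0 : 0 ≤ R := Metric.nonneg_of_mem_closedBall (hR hx)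
  -- At parameter N the ray is at distance R + ‖x - y‖ from y, outside the bounding ball;
  -- connectedness of the piece from x onwards then yields a boundary point.
  let N : ℝ := R / ‖x - y‖ + 1
  have hN : AffineMap.lineMap y x N ∉ T.carrier := by
    intro h
    have := hR h
    rw [mem_closedBall_iff_norm, AffineMap.lineMap_apply, vadd_eq_add, vsub_eq_sub,
      add_sub_cancel_right, norm_smul, Real.norm_eq_abs, abs_of_nonneg (by positivity)] at this
    have h2 : N * ‖x - y‖ = R + ‖x - y‖ := by simp only [N]; field_simp
    linarith
  have hN1 : 1 ≤ N := le_add_of_nonneg_left (by positivity)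
  have hconn : IsPreconnected ((fun t : ℝ => (AffineMap.lineMap y x t : Plane)) '' Set.Icc 1 N) :=
    isPreconnected_Icc.image _ (by fun_prop)
  obtain ⟨_, ⟨t, ht, rfl⟩, hp⟩ : (((fun t : ℝ => (AffineMap.lineMap y x t : Plane)) ''
      Set.Icc 1 N) ∩ frontier T.carrier).Nonempty := by
    by_contra hemp
    have hsub : ∀ z ∈ (fun t : ℝ => (AffineMap.lineMap y x t : Plane)) '' Set.Icc 1 N,
        z ∉ T.carrier → z ∉ closure T.carrier := fun z hz hzT hzc =>
      hemp ⟨z, hz, by rw [T.isOpen_carrier.frontier_eq]; exact ⟨hzc, hzT⟩⟩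
    obtain ⟨z, -, hz1, hz2⟩ := hconn T.carrier (closure T.carrier)ᶜ T.isOpen_carrier
      isClosed_closure.isOpen_compl
      (fun z hz => (em (z ∈ T.carrier)).imp id (hsub z hz))
      ⟨x, ⟨1, ⟨le_rfl, hN1⟩, by simp⟩, hx⟩
      ⟨_, ⟨N, ⟨hN1, le_rfl⟩, rfl⟩, hsub _ ⟨N, ⟨hN1, le_rfl⟩, rfl⟩ hN⟩
    exact hz2 (subset_closure hz1)
  have ht1 : 1 < t := by
    refine ht.1.lt_of_ne fun h => notMem_of_mem_frontier hp ?_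
    simpa [← h] using hx
  refine ⟨_, hp, t⁻¹, ⟨by positivity, inv_lt_one_of_one_lt₀ ht1⟩, ?_⟩
  rw [AffineMap.lineMap_lineMap_right, inv_mul_cancel₀ (by positivity), AffineMap.lineMap_apply_one]

lemma openSegment_eq (i : Fin T.numEdges) :
    openSegment ℝ (T.a i) (T.b i) = T.edgePt i '' Set.Ioo 0 1 :=
  openSegment_eq_image_lineMap ℝ _ _

lemma segment_eq (i : Fin T.numEdges) : segment ℝ (T.a i) (T.b i) = T.edgePt i '' Set.Icc 0 1 :=
  segment_eq_image_lineMap ℝ _ _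

lemma segment_subset_frontier (i : Fin T.numEdges) :
    segment ℝ (T.a i) (T.b i) ⊆ frontier T.carrier := by
  rw [T.frontier_eq]
  exact Set.subset_iUnion (fun i => segment ℝ (T.a i) (T.b i)) i

lemma edgePt_mem_frontier (i : Fin T.numEdges) {s : ℝ} (hs : s ∈ Set.Icc (0 : ℝ) 1) :
    T.edgePt i s ∈ frontier T.carrier :=
  segment_subset_frontier i (segment_eq i ▸ Set.mem_image_of_mem _ hs)

lemma exists_edgePt {p : Plane} (hp : p ∈ frontier T.carrier) :
    ∃ i, ∃ s ∈ Set.Icc (0 : ℝ) 1, T.edgePt i s = p := by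
  rw [T.frontier_eq, Set.mem_iUnion] at hp
  obtain ⟨i, hi⟩ := hp
  rw [segment_eq] at hi
  exact ⟨i, hi⟩

@[simp] lemma edgePt_zero (i : Fin T.numEdges) : T.edgePt i 0 = T.a i :=
  AffineMap.lineMap_apply_zero _ _

@[simp] lemma edgePt_one (i : Fin T.numEdges) : T.edgePt i 1 = T.b i :=
  AffineMap.lineMap_apply_one _ _

lemma edgePt_eq (i : Fin T.numEdges) (s : ℝ) :
    T.edgePt i s = T.a i + s • (T.b i - T.a i) := by
  rw [edgePt, AffineMap.lineMap_apply, vadd_eq_add, vsub_eq_sub, add_comm]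

@[fun_prop]
lemma contDiff_edgePt (i : Fin T.numEdges) {n : WithTop ℕ∞} : ContDiff ℝ n (T.edgePt i) := by
  rw [show T.edgePt i = fun s => T.a i + s • (T.b i - T.a i) from funext (edgePt_eq i)]
  fun_prop

@[fun_prop]
lemma continuous_edgePt (i : Fin T.numEdges) : Continuous (T.edgePt i) :=
  (contDiff_edgePt i (n := 0)).continuous

lemma edgePt_injective (i : Fin T.numEdges) : Function.Injective (T.edgePt i) := by
  intro s t h
  rw [edgePt_eq, edgePt_eq, add_right_inj] at h
  exact smul_left_injective ℝ (sub_ne_zero.2 (T.a_ne_b i).symm) h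

lemma a_mem_frontier (i : Fin T.numEdges) : T.a i ∈ frontier T.carrier := by
  simpa using edgePt_mem_frontier i (s := 0) (by simp)

lemma b_mem_frontier (i : Fin T.numEdges) : T.b i ∈ frontier T.carrier := by
  simpa using edgePt_mem_frontier i (s := 1) (by simp)

/-- Twice the signed area of the triangle with apex `y` over the edge `i`. -/
def apexDet (T : PolygonalElement) (y : Plane) (i : Fin T.numEdges) : ℝ :=
  cross (T.a i - y) (T.b i - y)

/-- If y were on the line of the edge, then b - y = c (a - y). For c > 0 one ray from y would meet
the boundary at both endpoints; for c ≤ 0 the point y would lie on the edge itself. Both contradict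
that y is a kernel point. -/
lemma IsKernelPt.apexDet_ne_zero {y : Plane} (hy : T.IsKernelPt y) (i : Fin T.numEdges) :
    T.apexDet y i ≠ 0 := by
  intro h
  have hay : T.a i - y ≠ 0 := fun h0 =>
    notMem_of_mem_frontier (a_mem_frontier i) (sub_eq_zero.1 h0 ▸ hy.mem)
  obtain ⟨c, hc⟩ := exists_smul_of_cross_eq_zero hay h
  rcases lt_or_ge 0 c with hc0 | hc0
  · have := hy.lineMap_inj (a_mem_frontier i) (b_mem_frontier i) hc0 one_pos (by
      rw [AffineMap.lineMap_apply_one, AffineMap.lineMap_apply, vadd_eq_add, vsub_eq_sub, ← hc]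
      abel)
    exact T.a_ne_b i this.2
  · have h1 : 0 < 1 - c := by linarith
    refine notMem_of_mem_frontier (edgePt_mem_frontier i (s := (1 - c)⁻¹) ⟨by positivity,
      inv_le_one_of_one_le₀ (by linarith)⟩) ?_
    have : T.edgePt i (1 - c)⁻¹ = y := by
      rw [edgePt_eq, show T.b i - T.a i = (c - 1) • (T.a i - y) by
        rw [sub_smul, ← hc, one_smul]; abel, smul_smul,
        show (1 - c)⁻¹ * (c - 1) = -1 by field_simp; ring]
      simp
    rw [this]
    exact hy.mem

/-- A point whose barycentric coordinates with respect to `a i`, `b i` are positive. -/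
lemma exists_lineMap_edgePt {y z : Plane} {i : Fin T.numEdges} {α β : ℝ} (hα : 0 < α) (hβ : 0 < β)
    (hz : z - y = α • (T.a i - y) + β • (T.b i - y)) :
    ∃ s ∈ Set.Ioo (0 : ℝ) 1, z = AffineMap.lineMap y (T.edgePt i s) (α + β) := by
  have h : 0 < α + β := by positivity
  refine ⟨β / (α + β), ⟨by positivity, (div_lt_one h).2 (by linarith)⟩, ?_⟩
  rw [AffineMap.lineMap_apply, vadd_eq_add, vsub_eq_sub, ← sub_eq_iff_eq_add, hz, edgePt_eq]
  match_scalars <;> field_simp <;> ring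

/-- The coordinates of z - y in the basis a - y, b - y are continuous and equal to 1 - s and s at a
point of the open edge, so they stay positive nearby. Their sum is the polar radius t, and Cramer's
rule expresses it by a determinant. -/
lemma IsKernelPt.eventually_cone {y : Plane} (hy : T.IsKernelPt y) {i : Fin T.numEdges}
    {x : Plane} (hx : x ∈ openSegment ℝ (T.a i) (T.b i)) :
    ∀ᶠ z in 𝓝 x, ∃ s ∈ Set.Ioo (0 : ℝ) 1, ∃ t > 0,
      z = AffineMap.lineMap y (T.edgePt i s) t ∧
      t * T.apexDet y i = cross (z - y) (T.b i - T.a i) := by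
  have hD := hy.apexDet_ne_zero i
  let α : Plane → ℝ := fun z => cross (z - y) (T.b i - y) / T.apexDet y i
  let β : Plane → ℝ := fun z => cross (T.a i - y) (z - y) / T.apexDet y i
  have hαc : Continuous α := by fun_prop
  have hβc : Continuous β := by fun_prop
  obtain ⟨s, hs, rfl⟩ := (openSegment_eq i ▸ hx : x ∈ T.edgePt i '' Set.Ioo 0 1)
  have hαx : 0 < α (T.edgePt i s) := by
    have : α (T.edgePt i s) = 1 - s := by
      simp only [α]
      rw [div_eq_iff hD, edgePt_eq]
      simp [apexDet, cross]
      ring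
    rw [this]
    linarith [hs.2]
  have hβx : 0 < β (T.edgePt i s) := by
    have : β (T.edgePt i s) = s := by
      simp only [β]
      rw [div_eq_iff hD, edgePt_eq]
      simp [apexDet, cross]
      ring
    rw [this]
    exact hs.1
  filter_upwards [hαc.continuousAt.eventually (lt_mem_nhds hαx),
    hβc.continuousAt.eventually (lt_mem_nhds hβx)] with z hz1 hz2
  have hz : z - y = α z • (T.a i - y) + β z • (T.b i - y) := by
    have := cross_smul_eq (T.a i - y) (T.b i - y) (z - y)
    rw [← apexDet] at this
    rw [← smul_right_inj hD, this]
    simp only [α, β, smul_add, smul_smul]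
    congr 2 <;> field_simp
  obtain ⟨s', hs', h⟩ := exists_lineMap_edgePt hz1 hz2 hz
  refine ⟨s', hs', α z + β z, by positivity, h, ?_⟩
  simp only [α, β]
  rw [← add_div, div_mul_cancel₀ _ hD]
  simp [cross]
  ring

/-- A relative interior point of an edge belongs to no other closed edge. -/
lemma eq_of_mem_openSegment {i j : Fin T.numEdges} {z : Plane}
    (hi : z ∈ openSegment ℝ (T.a i) (T.b i)) (hj : z ∈ segment ℝ (T.a j) (T.b j)) : i = j := by
  by_contra hij
  have hdisj := T.disjoint_edges hij
  rw [segment_eq] at hj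
  obtain ⟨s, hs, rfl⟩ := hj
  have hy := T.isKernelPt_center
  -- The point may be an endpoint of edge j, so it is approached by points of the open edge j. Near
  -- it these lie in the open cone over edge i, and since rays meet the boundary once they lie on
  -- the open edge i, against disjointness.
  have hcl : s ∈ closure (Set.Ioo (0 : ℝ) 1) := by rwa [closure_Ioo (by norm_num)]
  obtain ⟨s', hs', s'', hs'', t, ht, h, -⟩ := ((mem_closure_iff_frequently.1 hcl).and_eventually
    ((continuous_edgePt j).continuousAt.eventually (hy.eventually_cone hi))).exists
  obtain ⟨-, h2⟩ := hy.lineMap_inj (edgePt_mem_frontier j (Set.Ioo_subset_Icc_self hs'))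
    (edgePt_mem_frontier i (Set.Ioo_subset_Icc_self hs'')) one_pos ht (by simpa using h)
  refine Set.disjoint_left.1 hdisj (?_ : T.edgePt j s' ∈ _) ?_
  · rw [openSegment_eq, h2]
    exact Set.mem_image_of_mem _ hs''
  · rw [openSegment_eq]
    exact Set.mem_image_of_mem _ hs'

/-! ### The unit normals -/

/-- The vector n is the rotated unit edge vector with the sign for which moving by t n multiplies
the polar radius by 1 + t ‖e‖ / |D|, D being `apexDet`. So positive t leaves the element and small
negative t enters it. The last identity is twice the area of a triangle as base times height. -/
lemma IsKernelPt.exists_normal {y : Plane} (hy : T.IsKernelPt y) (i : Fin T.numEdges) :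
    ∃ n : Plane, ‖n‖ = 1 ∧ inner ℝ n (T.b i - T.a i) = 0 ∧
      (∀ x ∈ openSegment ℝ (T.a i) (T.b i), ∀ᶠ t : ℝ in 𝓝[>] 0, x + t • n ∉ T.carrier) ∧
      (∀ x ∈ openSegment ℝ (T.a i) (T.b i), ∀ᶠ t : ℝ in 𝓝[>] 0, x - t • n ∈ T.carrier) ∧
      dist (T.a i) (T.b i) * inner ℝ (T.a i - y) n = |T.apexDet y i| := by
  have hD := hy.apexDet_ne_zero i
  set e := T.b i - T.a i with he
  have he0 : 0 < ‖e‖ := norm_pos_iff.2 (sub_ne_zero.2 (T.a_ne_b i).symm)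
  have hdist : dist (T.a i) (T.b i) = ‖e‖ := by rw [dist_comm, dist_eq_norm]
  have hDe : T.apexDet y i = cross (T.a i - y) e := by
    simp [apexDet, cross, he]; ring
  -- σ is the orientation sign of the edge seen from y.
  obtain ⟨σ, hσ, hσD⟩ : ∃ σ : ℝ, σ ^ 2 = 1 ∧ σ * T.apexDet y i = |T.apexDet y i| := by
    rcases abs_choice (T.apexDet y i) with h | h
    · exact ⟨1, by norm_num, by rw [h, one_mul]⟩
    · exact ⟨-1, by norm_num, by rw [h, neg_one_mul]⟩
  let n : Plane := (σ / ‖e‖) • !₂[e 1, -e 0]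
  have hn0 : n 0 = σ / ‖e‖ * e 1 := by simp [n]
  have hn1 : n 1 = -(σ / ‖e‖ * e 0) := by simp [n]
  have hen := norm_sq_plane e
  have hin : ∀ v : Plane, ‖e‖ * inner ℝ v n = σ * cross v e := by
    intro v
    rw [inner_plane, hn0, hn1, cross]
    field_simp
    ring
  have hcr : ∀ v : Plane, ∀ t : ℝ, cross (v + t • n - y) e = cross (v - y) e + t * (σ * ‖e‖) := by
    intro v t
    have : cross n e = σ * ‖e‖ := by
      rw [cross, hn0, hn1]
      field_simp
      rw [hen]
      ring
    rw [← this]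
    simp [cross]
    ring
  have hxe : ∀ x ∈ openSegment ℝ (T.a i) (T.b i), cross (x - y) e = T.apexDet y i := by
    intro x hx
    obtain ⟨s, hs, rfl⟩ := (openSegment_eq i ▸ hx : x ∈ T.edgePt i '' Set.Ioo 0 1)
    rw [edgePt_eq, ← he, hDe]
    simp [cross]
    ring
  have hev : ∀ x ∈ openSegment ℝ (T.a i) (T.b i), ∀ᶠ t : ℝ in 𝓝 0,
      ∃ s ∈ Set.Ioo (0 : ℝ) 1, ∃ t' > 0, x + t • n = AffineMap.lineMap y (T.edgePt i s) t' ∧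
        t' = 1 + t * (‖e‖ / |T.apexDet y i|) := by
    intro x hx
    have hc : Tendsto (fun t : ℝ => x + t • n) (𝓝 0) (𝓝 x) := by
      have : Continuous fun t : ℝ => x + t • n := by fun_prop
      simpa using this.tendsto 0
    filter_upwards [hc.eventually (hy.eventually_cone hx)] with t ⟨s, hs, t', ht', h1, h2⟩
    refine ⟨s, hs, t', ht', h1, ?_⟩
    rw [← he, hcr, hxe x hx] at h2
    have h3 : t' = 1 + t * (σ * ‖e‖) / T.apexDet y i := by
      field_simp
      linarith
    rw [h3, ← hσD]
    have hσ0 : σ ≠ 0 := by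
      rintro rfl
      norm_num at hσ
    have : σ * ‖e‖ / T.apexDet y i = ‖e‖ / (σ * T.apexDet y i) := by
      field_simp
      rw [hσ]
    rw [← this]
    ring
  refine ⟨n, ?_, ?_, fun x hx => ?_, fun x hx => ?_, ?_⟩
  · rw [← sq_eq_sq₀ (norm_nonneg _) zero_le_one, norm_sq_plane, hn0, hn1, one_pow, neg_sq, mul_pow,
      mul_pow, ← mul_add, add_comm, ← hen, div_pow, hσ]
    field_simp
  · rw [inner_plane, hn0, hn1]
    ring
  · filter_upwards [nhdsWithin_le_nhds (hev x hx), self_mem_nhdsWithin]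
      with t ⟨s, hs, t', ht', h1, h2⟩ ht
    rw [h1]
    refine hy.lineMap_notMem (edgePt_mem_frontier i (Set.Ioo_subset_Icc_self hs)) ?_
    have : 0 < t := ht
    rw [h2]
    have : 0 ≤ t * (‖e‖ / |T.apexDet y i|) := by positivity
    linarith
  · have hneg : Tendsto (fun t : ℝ => -t) (𝓝 0) (𝓝 0) := by
      simpa using (continuous_neg (G := ℝ)).tendsto 0
    filter_upwards [nhdsWithin_le_nhds (hneg.eventually (hev x hx)), self_mem_nhdsWithin]
      with t ⟨s, hs, t', ht', h1, h2⟩ ht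
    rw [neg_smul, ← sub_eq_add_neg] at h1
    rw [h1]
    refine hy.lineMap_mem (edgePt_mem_frontier i (Set.Ioo_subset_Icc_self hs)).1 ht'.le ?_
    have h0 : 0 < t := ht
    rw [h2]
    have : 0 < t * (‖e‖ / |T.apexDet y i|) :=
      mul_pos h0 (div_pos he0 (abs_pos.2 hD))
    linarith
  · rw [hdist, hin, ← hDe, hσD]

lemma normal_spec (i : Fin T.numEdges) : ‖T.normal i‖ = 1 ∧
    inner ℝ (T.normal i) (T.b i - T.a i) = 0 ∧
    ∀ x ∈ openSegment ℝ (T.a i) (T.b i), ∀ᶠ t : ℝ in 𝓝[>] 0, x + t • T.normal i ∉ T.carrier := by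
  have h : ∃ n : Plane, ‖n‖ = 1 ∧ inner ℝ n (T.b i - T.a i) = 0 ∧
      ∀ x ∈ openSegment ℝ (T.a i) (T.b i), ∀ᶠ t : ℝ in 𝓝[>] 0, x + t • n ∉ T.carrier := by
    obtain ⟨n, h1, h2, h3, -⟩ := T.isKernelPt_center.exists_normal i
    exact ⟨n, h1, h2, h3⟩
  rw [normal, dif_pos h]
  exact h.choose_spec

lemma eq_or_eq_neg_of_inner_eq_zero {m n e : Plane} (he : e ≠ 0) (hm : ‖m‖ = 1) (hn : ‖n‖ = 1)
    (hme : inner ℝ m e = 0) (hne : inner ℝ n e = 0) : m = n ∨ m = -n := by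
  have hc : cross n m = 0 := by
    rw [inner_plane] at hme hne
    unfold cross
    have h0 : e 0 * (n 0 * m 1 - n 1 * m 0) = 0 := by
      linear_combination m 1 * hne - n 1 * hme
    have h1 : e 1 * (n 0 * m 1 - n 1 * m 0) = 0 := by
      linear_combination n 0 * hme - m 0 * hne
    by_contra hne'
    exact he (plane_ext (by simpa [hne'] using h0) (by simpa [hne'] using h1))
  obtain ⟨c, rfl⟩ := exists_smul_of_cross_eq_zero (by rintro rfl; simp at hn) hc
  rw [norm_smul, hn, mul_one, Real.norm_eq_abs] at hm
  rcases eq_or_eq_neg_of_abs_eq hm with rfl | rfl <;> simp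

/-- The distance of a kernel point to an edge line, in terms of the normal. -/
lemma IsKernelPt.dist_mul_inner_normal {y : Plane} (hy : T.IsKernelPt y) (i : Fin T.numEdges) :
    dist (T.a i) (T.b i) * inner ℝ (T.a i - y) (T.normal i) = |T.apexDet y i| := by
  obtain ⟨n, h1, h2, h3, h4, h5⟩ := hy.exists_normal i
  obtain ⟨m1, m2, m3⟩ := T.normal_spec i
  rcases eq_or_eq_neg_of_inner_eq_zero (sub_ne_zero.2 (T.a_ne_b i).symm) m1 h1 m2 h2 with h | h
  · rw [h, h5]
  -- The opposite sign is excluded because moving inwards along n stays in the element.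
  · exfalso
    have hx : T.edgePt i (1 / 2) ∈ openSegment ℝ (T.a i) (T.b i) := by
      rw [openSegment_eq]
      exact Set.mem_image_of_mem _ (by norm_num)
    obtain ⟨t, ht1, ht2⟩ := ((m3 _ hx).and (h4 _ hx)).exists
    rw [h, smul_neg, ← sub_eq_add_neg] at ht1
    exact ht1 ht2

end PolygonalElement

/-! ### Integration over triangles -/

/-- Coordinates `(s, r)` on the triangle with apex `P` and base `A`, `B`. -/
noncomputable def triMap (P A B : Plane) (z : ℝ × ℝ) : Plane :=
  AffineMap.lineMap P (AffineMap.lineMap A B z.1 : Plane) z.2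

lemma triMap_eq (P A B : Plane) (z : ℝ × ℝ) :
    triMap P A B z = P + z.2 • (A - P + z.1 • (B - A)) := by
  simp only [triMap, AffineMap.lineMap_apply, vadd_eq_add, vsub_eq_sub]
  module

lemma triMap_apply (P A B : Plane) (z : ℝ × ℝ) (j : Fin 2) :
    triMap P A B z j = P j + z.2 * (A j - P j + z.1 * (B j - A j)) := by
  simp [triMap_eq]
  ring

@[fun_prop]
lemma contDiff_triMap (P A B : Plane) {n : WithTop ℕ∞} : ContDiff ℝ n (triMap P A B) := by
  rw [show triMap P A B = _ from funext (triMap_eq P A B)]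
  fun_prop

@[fun_prop]
lemma continuous_triMap (P A B : Plane) : Continuous (triMap P A B) :=
  (contDiff_triMap P A B (n := 0)).continuous

lemma triMap_injOn {P A B : Plane} (hD : cross (A - P) (B - P) ≠ 0) :
    Set.InjOn (triMap P A B) {z | 0 < z.2} := by
  rintro ⟨s, r⟩ (hr : 0 < r) ⟨s', r'⟩ (hr' : 0 < r') h
  have h0 := congrFun (congrArg WithLp.ofLp h) 0
  have h1 := congrFun (congrArg WithLp.ofLp h) 1
  rw [triMap_apply, triMap_apply] at h0 h1
  have hD' : (A 0 - P 0) * (B 1 - P 1) - (A 1 - P 1) * (B 0 - P 0) ≠ 0 := hD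
  dsimp only at h0 h1
  have e1 : (r - r') * ((A 0 - P 0) * (B 1 - P 1) - (A 1 - P 1) * (B 0 - P 0)) = 0 := by
    linear_combination (B 1 - A 1) * h0 - (B 0 - A 0) * h1
  have e2 : (r * s - r' * s') * ((A 0 - P 0) * (B 1 - P 1) - (A 1 - P 1) * (B 0 - P 0)) = 0 := by
    linear_combination (A 0 - P 0) * h1 - (A 1 - P 1) * h0
  have hrr : r = r' := sub_eq_zero.1 ((mul_eq_zero.1 e1).resolve_right hD')
  subst hrr
  have hss := sub_eq_zero.1 ((mul_eq_zero.1 e2).resolve_right hD')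
  rw [mul_left_cancel₀ hr.ne' hss]

/-- The measure-preserving identification of `ℝ × ℝ` with the plane. -/
noncomputable def prodPlane : ℝ × ℝ ≃ᵐ Plane :=
  (MeasurableEquiv.finTwoArrow (α := ℝ)).symm.trans (MeasurableEquiv.toLp 2 (Fin 2 → ℝ))

lemma measurePreserving_prodPlane : MeasurePreserving prodPlane :=
  (PiLp.volume_preserving_toLp (Fin 2)).comp
    ((volume_preserving_finTwoArrow ℝ).symm MeasurableEquiv.finTwoArrow)

/-- `triMap` in coordinates. -/
noncomputable def triCoord (P A B : Plane) (z : ℝ × ℝ) : ℝ × ℝ := (triMap P A B z 0, triMap P A B z 1)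

lemma prodPlane_triCoord (P A B : Plane) (z : ℝ × ℝ) :
    prodPlane (triCoord P A B z) = triMap P A B z := plane_ext rfl rfl

lemma image_triMap (P A B : Plane) (S : Set (ℝ × ℝ)) :
    triMap P A B '' S = prodPlane '' (triCoord P A B '' S) := by
  rw [Set.image_image]
  exact Set.image_congr fun z _ => (prodPlane_triCoord P A B z).symm

noncomputable def triDeriv (P A B : Plane) (z : ℝ × ℝ) : ℝ × ℝ →L[ℝ] ℝ × ℝ :=
  LinearMap.toContinuousLinearMap (Matrix.toLin (Module.Basis.finTwoProd ℝ)
    (Module.Basis.finTwoProd ℝ)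
    !![z.2 * (B 0 - A 0), A 0 - P 0 + z.1 * (B 0 - A 0);
       z.2 * (B 1 - A 1), A 1 - P 1 + z.1 * (B 1 - A 1)])

lemma hasFDerivAt_triCoord (P A B : Plane) (z : ℝ × ℝ) :
    HasFDerivAt (triCoord P A B) (triDeriv P A B z) z := by
  have h : ∀ j : Fin 2, HasFDerivAt (fun z => triMap P A B z j)
      ((z.2 * (B j - A j)) • ContinuousLinearMap.fst ℝ ℝ ℝ +
        (A j - P j + z.1 * (B j - A j)) • ContinuousLinearMap.snd ℝ ℝ ℝ) z := by
    intro j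
    rw [show (fun z => triMap P A B z j) = _ from funext fun z => triMap_apply P A B z j]
    refine ((hasFDerivAt_snd.mul ((hasFDerivAt_fst.mul_const (B j - A j)).const_add
      (A j - P j))).const_add (P j)).congr_fderiv ?_
    ext <;> simp
  rw [triDeriv, Matrix.toLin_finTwoProd_toContinuousLinearMap]
  exact (h 0).prodMk (h 1)

lemma abs_det_triDeriv (P A B : Plane) {z : ℝ × ℝ} (hz : 0 < z.2) :
    |(triDeriv P A B z).det| = |cross (A - P) (B - P)| * z.2 := by
  rw [triDeriv, LinearMap.det_toContinuousLinearMap, LinearMap.det_toLin, Matrix.det_fin_two_of,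
    ← abs_of_pos hz, ← abs_mul, ← abs_neg, abs_of_pos hz]
  congr 1
  simp only [cross, PiLp.sub_apply]
  ring

section

variable {P A B : Plane} {S : Set (ℝ × ℝ)}

lemma triCoord_injOn (hD : cross (A - P) (B - P) ≠ 0) (hpos : ∀ z ∈ S, 0 < z.2) :
    Set.InjOn (triCoord P A B) S := fun x hx y hy h => by
  refine triMap_injOn hD (hpos x hx) (hpos y hy) ?_
  rw [← prodPlane_triCoord, ← prodPlane_triCoord, h]

lemma measurableSet_image_triMap (hS : MeasurableSet S) (hD : cross (A - P) (B - P) ≠ 0)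
    (hpos : ∀ z ∈ S, 0 < z.2) : MeasurableSet (triMap P A B '' S) := by
  rw [image_triMap, MeasurableEquiv.measurableSet_image]
  exact measurable_image_of_fderivWithin hS
    (fun z _ => (hasFDerivAt_triCoord P A B z).hasFDerivWithinAt) (triCoord_injOn hD hpos)

lemma integral_image_triMap (hS : MeasurableSet S) (hD : cross (A - P) (B - P) ≠ 0)
    (hpos : ∀ z ∈ S, 0 < z.2) (f : Plane → ℝ) :
    ∫ x in triMap P A B '' S, f x =
      |cross (A - P) (B - P)| * ∫ z in S, z.2 * f (triMap P A B z) := by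
  rw [image_triMap, measurePreserving_prodPlane.setIntegral_image_emb
    prodPlane.measurableEmbedding, integral_image_eq_integral_abs_det_fderiv_smul volume hS
    (fun z _ => (hasFDerivAt_triCoord P A B z).hasFDerivWithinAt) (triCoord_injOn hD hpos),
    ← integral_const_mul]
  refine setIntegral_congr_fun hS fun z hz => ?_
  simp only [abs_det_triDeriv P A B (hpos z hz), prodPlane_triCoord, smul_eq_mul, mul_assoc]

end

/-- The coordinate domain `0 < s < 1`, `ρ < r < 1`. -/
def triDom (ρ : ℝ) : Set (ℝ × ℝ) := Set.Ioo 0 1 ×ˢ Set.Ioo ρ 1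

lemma measurableSet_triDom (ρ : ℝ) : MeasurableSet (triDom ρ) :=
  measurableSet_Ioo.prod measurableSet_Ioo

lemma triDom_pos {ρ : ℝ} (hρ : 0 ≤ ρ) : ∀ z ∈ triDom ρ, 0 < z.2 := fun _ hz => hρ.trans_lt hz.2.1

lemma integrableOn_triDom {f : ℝ × ℝ → ℝ} (hf : Continuous f) (ρ : ℝ) :
    IntegrableOn f (triDom ρ) :=
  (hf.continuousOn.integrableOn_compact (isCompact_Icc.prod isCompact_Icc)).mono_set
    (Set.prod_mono Set.Ioo_subset_Icc_self Set.Ioo_subset_Icc_self)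

lemma integral_Ioo_eq {a b : ℝ} (hab : a ≤ b) (f : ℝ → ℝ) :
    ∫ s in Set.Ioo a b, f s = ∫ s in a..b, f s := by
  rw [intervalIntegral.integral_of_le hab, integral_Ioc_eq_integral_Ioo]

lemma integral_triDom {f : ℝ × ℝ → ℝ} (hf : Continuous f) {ρ : ℝ} (hρ : ρ ≤ 1) :
    ∫ z in triDom ρ, f z = ∫ s in (0 : ℝ)..1, ∫ r in ρ..1, f (s, r) := by
  rw [Measure.volume_eq_prod, triDom, setIntegral_prod _ (integrableOn_triDom hf ρ),
    integral_Ioo_eq zero_le_one]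
  simp_rw [integral_Ioo_eq hρ]

lemma integral_triDom_swap {f : ℝ × ℝ → ℝ} (hf : Continuous f) {ρ : ℝ} (hρ : ρ ≤ 1) :
    ∫ z in triDom ρ, f z = ∫ r in ρ..1, ∫ s in (0 : ℝ)..1, f (s, r) := by
  rw [Measure.volume_eq_prod, triDom, ← setIntegral_prod_swap, setIntegral_prod,
    integral_Ioo_eq hρ]
  · simp_rw [integral_Ioo_eq zero_le_one]
    rfl
  · exact ((hf.comp continuous_swap).continuousOn.integrableOn_compact
      (isCompact_Icc.prod isCompact_Icc)).mono_set
      (Set.prod_mono Set.Ioo_subset_Icc_self Set.Ioo_subset_Icc_self)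

namespace PolygonalElement

variable {T : PolygonalElement}

/-! ### Polar coordinates on the element -/

/-- The part of the element at relative distance greater than `ρ` from `y`. -/
noncomputable def collar (T : PolygonalElement) (y : Plane) (ρ : ℝ) : Set Plane :=
  ⋃ i, triMap y (T.a i) (T.b i) '' triDom ρ

lemma triMap_edge (y : Plane) (i : Fin T.numEdges) (z : ℝ × ℝ) :
    triMap y (T.a i) (T.b i) z = AffineMap.lineMap y (T.edgePt i z.1) z.2 := rfl

section

variable {y : Plane} {ρ : ℝ}

lemma IsKernelPt.triMap_image_subset (hy : T.IsKernelPt y) (hρ : 0 ≤ ρ) (i : Fin T.numEdges) :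
    triMap y (T.a i) (T.b i) '' triDom ρ ⊆ T.carrier := by
  rintro _ ⟨z, hz, rfl⟩
  exact hy.lineMap_mem (edgePt_mem_frontier i (Set.Ioo_subset_Icc_self hz.1)).1
    (triDom_pos hρ z hz).le hz.2.2

lemma IsKernelPt.collar_subset (hy : T.IsKernelPt y) (hρ : 0 ≤ ρ) :
    T.collar y ρ ⊆ T.carrier := Set.iUnion_subset fun i => hy.triMap_image_subset hρ i

lemma IsKernelPt.measurableSet_image (hy : T.IsKernelPt y) (hρ : 0 ≤ ρ) (i : Fin T.numEdges) :
    MeasurableSet (triMap y (T.a i) (T.b i) '' triDom ρ) :=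
  measurableSet_image_triMap (measurableSet_triDom ρ) (hy.apexDet_ne_zero i) (triDom_pos hρ)

lemma IsKernelPt.measurableSet_collar (hy : T.IsKernelPt y) (hρ : 0 ≤ ρ) :
    MeasurableSet (T.collar y ρ) := MeasurableSet.iUnion fun i => hy.measurableSet_image hρ i

/-- Two sectors can only share a point if their rays hit the same boundary point, which would lie on
two open edges. -/
lemma IsKernelPt.pairwise_disjoint (hy : T.IsKernelPt y) (hρ : 0 ≤ ρ) :
    Pairwise (Function.onFun Disjoint fun i => triMap y (T.a i) (T.b i) '' triDom ρ) := by
  intro i j hij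
  rw [Function.onFun, Set.disjoint_left]
  rintro _ ⟨z, hz, rfl⟩ ⟨z', hz', h⟩
  obtain ⟨-, h2⟩ := hy.lineMap_inj (edgePt_mem_frontier j (Set.Ioo_subset_Icc_self hz'.1))
    (edgePt_mem_frontier i (Set.Ioo_subset_Icc_self hz.1)) (triDom_pos hρ z' hz')
    (triDom_pos hρ z hz) h
  refine Set.disjoint_left.1 (T.disjoint_edges hij) (?_ : T.edgePt i z.1 ∈ _) ?_
  · rw [openSegment_eq]
    exact Set.mem_image_of_mem _ hz.1
  · rw [← h2, openSegment_eq]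
    exact Set.mem_image_of_mem _ hz'.1

lemma integrableOn_of_continuous {f : Plane → ℝ} (hf : Continuous f) :
    IntegrableOn f T.carrier :=
  (hf.continuousOn.integrableOn_compact T.isBounded_carrier.isCompact_closure).mono_set
    subset_closure

lemma IsKernelPt.integral_collar (hy : T.IsKernelPt y) (hρ : 0 ≤ ρ) (hρ1 : ρ ≤ 1) {f : Plane → ℝ}
    (hf : Continuous f) : ∫ x in T.collar y ρ, f x =
      ∑ i, |T.apexDet y i| *
        ∫ s in (0 : ℝ)..1, ∫ r in ρ..1, r * f (AffineMap.lineMap y (T.edgePt i s) r) := by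
  rw [collar, integral_iUnion_fintype (fun i => hy.measurableSet_image hρ i)
    (hy.pairwise_disjoint hρ)
    (fun i => (integrableOn_of_continuous hf).mono_set (hy.triMap_image_subset hρ i))]
  refine Finset.sum_congr rfl fun i _ => ?_
  rw [integral_image_triMap (measurableSet_triDom ρ) (hy.apexDet_ne_zero i) (triDom_pos hρ),
    integral_triDom (by fun_prop) hρ1]
  rfl

/-- The points of the element missed by the open sectors lie on the finitely many lines through y
and an endpoint of an edge, which are null sets. -/
lemma IsKernelPt.collar_ae_eq (hy : T.IsKernelPt y) : T.collar y 0 =ᵐ[volume] T.carrier := by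
  refine (hy.collar_subset le_rfl).eventuallyLE.antisymm ?_
  have hnull : ∀ p : Plane, ∀ᵐ x : Plane, x ∉ affineSpan ℝ ({y, p} : Set Plane) := by
    intro p
    refine compl_mem_ae_iff.2 ?_
    refine Measure.addHaar_affineSubspace volume _ fun htop => ?_
    have h1 : Module.finrank ℝ (vectorSpan ℝ ({y, p} : Set Plane)) ≤ 1 := by
      have := finrank_vectorSpan_insert_le_set ℝ ({p} : Set Plane) y
      rwa [vectorSpan_singleton, finrank_bot, zero_add] at this
    rw [← direction_affineSpan, htop, AffineSubspace.direction_top, finrank_top,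
      finrank_euclideanSpace_fin] at h1
    omega
  filter_upwards [ae_all_iff.2 fun i => hnull (T.a i), ae_all_iff.2 fun i => hnull (T.b i)]
    with x hxa hxb hxT
  -- Without edges the boundary would be empty and the element would be empty or the whole plane. An
  -- edge is needed to see that y itself lies on one of the null lines.
  have hne : Nonempty (Fin T.numEdges) := by
    by_contra hemp
    rw [not_nonempty_iff] at hemp
    obtain ⟨r, hr, h⟩ := hy
    obtain ⟨u, hu⟩ : ∃ u : Plane, u ≠ y := exists_ne y
    by_cases huT : u ∈ T.carrier
    · obtain ⟨p, hp, -⟩ := exists_frontier huT hu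
      exact hemp.elim (exists_edgePt hp).choose
    · have hfr : frontier T.carrier = ∅ := by rw [T.frontier_eq]; simp
      rcases frontier_eq_empty_iff.1 hfr with h0 | h0
      · exact (h0 ▸ T.center_mem : T.center ∈ (∅ : Set Plane))
      · exact huT (h0 ▸ trivial)
  have hxy : x ≠ y := by
    rintro rfl
    exact hxa hne.some (left_mem_affineSpan_pair ℝ _ _)
  obtain ⟨p, hp, t, ht, rfl⟩ := exists_frontier hxT hxy
  obtain ⟨i, s, hs, rfl⟩ := exists_edgePt hp
  refine Set.mem_iUnion.2 ⟨i, (s, t), ⟨⟨hs.1.lt_of_ne ?_, hs.2.lt_of_ne ?_⟩, ht⟩, rfl⟩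
  · rintro rfl
    refine hxa i ?_
    rw [edgePt_zero]
    exact AffineMap.lineMap_mem_affineSpan_pair _ _ _
  · rintro rfl
    refine hxb i ?_
    rw [edgePt_one]
    exact AffineMap.lineMap_mem_affineSpan_pair _ _ _

lemma IsKernelPt.integral_eq (hy : T.IsKernelPt y) {f : Plane → ℝ} (hf : Continuous f) :
    ∫ x in T.carrier, f x = ∑ i, |T.apexDet y i| *
        ∫ s in (0 : ℝ)..1, ∫ r in (0 : ℝ)..1, r * f (AffineMap.lineMap y (T.edgePt i s) r) := by
  rw [← setIntegral_congr_set hy.collar_ae_eq, hy.integral_collar le_rfl zero_le_one hf]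

/-! ### Green's formula -/

lemma hasDerivAt_comp_lineMap {g : Plane → ℝ} (hg : ContDiff ℝ 1 g) (p q : Plane) (r : ℝ) :
    HasDerivAt (fun r : ℝ => g (AffineMap.lineMap p q r))
      (fderiv ℝ g (AffineMap.lineMap p q r) (q - p)) r :=
  ((hg.differentiable (by simp)) _).hasFDerivAt.comp_hasDerivAt r AffineMap.hasDerivAt_lineMap

lemma continuous_fderiv_apply' {g : Plane → ℝ} (hg : ContDiff ℝ 1 g) {X : Type*}
    [TopologicalSpace X] {u v : X → Plane} (hu : Continuous u) (hv : Continuous v) :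
    Continuous fun x => fderiv ℝ g (u x) (v x) :=
  ((hg.continuous_fderiv (by simp)).comp hu).clm_apply hv

/-- Green's formula for the vector field `(x - y) g`. -/
lemma IsKernelPt.green_radial (hy : T.IsKernelPt y) {g : Plane → ℝ} (hg : ContDiff ℝ 1 g) :
    ∫ x in T.carrier, (2 * g x + fderiv ℝ g x (x - y)) =
      ∑ i, |T.apexDet y i| * ∫ s in (0 : ℝ)..1, g (T.edgePt i s) := by
  have hgc := hg.continuous
  rw [hy.integral_eq (f := fun x => 2 * g x + fderiv ℝ g x (x - y))
    ((continuous_const.mul hgc).add (continuous_fderiv_apply' hg continuous_id (by fun_prop)))]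
  refine Finset.sum_congr rfl fun i _ => ?_
  congr 1
  refine intervalIntegral.integral_congr fun s _ => ?_
  -- With the polar Jacobian r, the integrand is an exact radial derivative, leaving only the
  -- boundary value at r = 1.
  have hd : ∀ r : ℝ, HasDerivAt (fun r : ℝ => r ^ 2 * g (AffineMap.lineMap y (T.edgePt i s) r))
      (r * (2 * g (AffineMap.lineMap y (T.edgePt i s) r) +
        fderiv ℝ g (AffineMap.lineMap y (T.edgePt i s) r)
          (AffineMap.lineMap y (T.edgePt i s) r - y))) r := by
    intro r
    refine ((hasDerivAt_pow 2 r).mul (hasDerivAt_comp_lineMap hg y (T.edgePt i s) r)).congr_deriv ?_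
    rw [show (AffineMap.lineMap y (T.edgePt i s) r : Plane) - y = r • (T.edgePt i s - y) by
      simp [AffineMap.lineMap_apply], map_smul, smul_eq_mul]
    push_cast
    ring
  rw [intervalIntegral.integral_eq_sub_of_hasDerivAt (fun r _ => hd r)]
  · simp
  · refine Continuous.intervalIntegrable ?_ _ _
    refine continuous_id.mul ((continuous_const.mul (by fun_prop)).add ?_)
    exact continuous_fderiv_apply' hg (by fun_prop) (by fun_prop)

end

/-- Green's formula: the integral of a directional derivative is a boundary flux. -/
lemma green {g : Plane → ℝ} (hg : ContDiff ℝ 1 g) (e : Plane) :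
    ∫ x in T.carrier, fderiv ℝ g x e =
      ∑ i, dist (T.a i) (T.b i) * inner ℝ e (T.normal i) *
        ∫ s in (0 : ℝ)..1, g (T.edgePt i s) := by
  obtain ⟨ρ, hρ, hker⟩ := exists_ball_isKernelPt (T := T)
  -- Subtracting the radial formulas with centres x_T - η e and x_T leaves η times the derivative
  -- along e in the element. On each edge the difference of the two values of |`apexDet`| is η |E|
  -- (e · n).
  obtain ⟨η, hη, hηe⟩ : ∃ η : ℝ, 0 < η ∧ T.center - η • e ∈ Metric.ball T.center ρ := by
    refine ⟨ρ / (‖e‖ + 1), by positivity, ?_⟩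
    rw [mem_ball_iff_norm, sub_sub_cancel_left, norm_neg, norm_smul, Real.norm_eq_abs,
      abs_of_pos (by positivity), div_mul_eq_mul_div, div_lt_iff₀ (by positivity)]
    nlinarith [norm_nonneg e]
  have hy := hker _ hηe
  have hc := T.isKernelPt_center
  have hgc := hg.continuous
  have hint : ∀ y : Plane, IntegrableOn (fun x => 2 * g x + fderiv ℝ g x (x - y)) T.carrier :=
    fun y => integrableOn_of_continuous ((continuous_const.mul hgc).add
      (continuous_fderiv_apply' hg continuous_id (by fun_prop)))
  have h1 := congrArg₂ (· - ·) (hy.green_radial hg) (hc.green_radial hg)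
  rw [← integral_sub (hint _) (hint _), ← Finset.sum_sub_distrib] at h1
  have h2 : ∀ x, 2 * g x + fderiv ℝ g x (x - (T.center - η • e)) -
      (2 * g x + fderiv ℝ g x (x - T.center)) = η * fderiv ℝ g x e := by
    intro x
    rw [show x - (T.center - η • e) = (x - T.center) + η • e by abel, map_add, map_smul,
      smul_eq_mul]
    ring
  simp only [h2] at h1
  rw [integral_const_mul] at h1
  refine mul_left_cancel₀ hη.ne' (h1.trans ?_)
  rw [Finset.mul_sum]
  refine Finset.sum_congr rfl fun i _ => ?_
  rw [← hy.dist_mul_inner_normal, ← hc.dist_mul_inner_normal,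
    show T.a i - (T.center - η • e) = (T.a i - T.center) + η • e by abel, inner_add_left,
    real_inner_smul_left]
  ring

end PolygonalElement

/-! ### Inequalities for functions of class `C¹` -/

lemma sq_intervalIntegral_le {h : ℝ → ℝ} (hh : Continuous h) {a b : ℝ} (hab : a ≤ b) :
    (∫ t in a..b, h t) ^ 2 ≤ (b - a) * ∫ t in a..b, h t ^ 2 := by
  rcases hab.eq_or_lt with rfl | hab'
  · simp
  set I := ∫ t in a..b, h t with hI
  -- Cauchy–Schwarz against the constant 1, obtained by expanding the variance of h.
  have h0 : 0 ≤ ∫ t in a..b, (h t * (b - a) - I) ^ 2 :=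
    intervalIntegral.integral_nonneg hab fun t _ => sq_nonneg _
  have h1 : ∀ t, (h t * (b - a) - I) ^ 2 = (b - a) ^ 2 * h t ^ 2 - 2 * (b - a) * I * h t + I ^ 2 :=
    fun t => by ring
  simp only [h1] at h0
  rw [intervalIntegral.integral_add, intervalIntegral.integral_sub,
    intervalIntegral.integral_const_mul, intervalIntegral.integral_const_mul,
    intervalIntegral.integral_const, ← hI, smul_eq_mul] at h0
  · have h2 : 0 ≤ (b - a) * ((b - a) * (∫ t in a..b, h t ^ 2) - I ^ 2) := by nlinarith
    have := nonneg_of_mul_nonneg_right h2 (sub_pos.2 hab')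
    linarith
  all_goals exact Continuous.intervalIntegrable (by fun_prop) _ _

lemma norm_gradient (φ : Plane → ℝ) (x : Plane) : ‖gradient φ x‖ = ‖fderiv ℝ φ x‖ :=
  LinearIsometryEquiv.norm_map _ _

lemma continuous_gradient {φ : Plane → ℝ} (hφ : ContDiff ℝ 1 φ) : Continuous (gradient φ) :=
  (LinearIsometryEquiv.continuous _).comp (hφ.continuous_fderiv (by simp))

lemma abs_fderiv_le (φ : Plane → ℝ) (x v : Plane) :
    |fderiv ℝ φ x v| ≤ ‖gradient φ x‖ * ‖v‖ := by
  rw [norm_gradient, ← Real.norm_eq_abs]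
  exact (fderiv ℝ φ x).le_opNorm v

lemma sq_fderiv_le (φ : Plane → ℝ) (x : Plane) {v : Plane} {R : ℝ} (hv : ‖v‖ ≤ R) :
    fderiv ℝ φ x v ^ 2 ≤ R ^ 2 * ‖gradient φ x‖ ^ 2 := by
  rw [← mul_pow, ← sq_abs]
  refine pow_le_pow_left₀ (abs_nonneg _) ((abs_fderiv_le φ x v).trans ?_) 2
  rw [mul_comm]
  gcongr

lemma fderiv_sq {φ : Plane → ℝ} (hφ : ContDiff ℝ 1 φ) (x v : Plane) :
    fderiv ℝ (fun x => φ x ^ 2) x v = 2 * φ x * fderiv ℝ φ x v := by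
  rw [(((hφ.differentiable (by simp)) x).hasFDerivAt.pow 2).fderiv]
  simp

/-- Integrate φ' inwards from the boundary point p and use Cauchy–Schwarz. One factor 1 - ρ comes
from Cauchy–Schwarz and another from the length of the collar. The bound ρ ≥ 1/2 allows the Jacobian
weight r to be inserted at the cost of a factor 2. -/
lemma integral_collar_ray_le {φ : Plane → ℝ} (hφ : ContDiff ℝ 1 φ) {y p : Plane} {R : ℝ}
    (hp : ‖p - y‖ ≤ R) {ρ : ℝ} (hρ : 1 / 2 ≤ ρ) (hρ1 : ρ ≤ 1) :
    ∫ r in ρ..1, r * φ (AffineMap.lineMap y p r) ^ 2 ≤ 2 * (1 - ρ) * φ p ^ 2 +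
      4 * (1 - ρ) ^ 2 * R ^ 2 *
        ∫ r in ρ..1, r * ‖gradient φ (AffineMap.lineMap y p r)‖ ^ 2 := by
  have hφc := hφ.continuous
  have hgc := continuous_gradient hφ
  set K := ∫ r in ρ..1, r * ‖gradient φ (AffineMap.lineMap y p r)‖ ^ 2 with hK
  let h' : ℝ → ℝ := fun r => fderiv ℝ φ (AffineMap.lineMap y p r) (p - y)
  have hh' : Continuous h' :=
    PolygonalElement.continuous_fderiv_apply' hφ (by fun_prop) continuous_const
  have hJ : ∫ r in ρ..1, h' r ^ 2 ≤ 2 * R ^ 2 * K := by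
    rw [hK, ← intervalIntegral.integral_const_mul]
    refine intervalIntegral.integral_mono_on hρ1
      (Continuous.intervalIntegrable (by fun_prop) _ _)
      (Continuous.intervalIntegrable (by fun_prop) _ _) fun r hr => ?_
    refine (sq_fderiv_le φ _ hp).trans ?_
    have : 0 ≤ R ^ 2 * ‖gradient φ (AffineMap.lineMap y p r)‖ ^ 2 := by positivity
    nlinarith [hr.1]
  have hpt : ∀ r ∈ Set.Icc ρ 1,
      r * φ (AffineMap.lineMap y p r) ^ 2 ≤ 2 * φ p ^ 2 + 4 * (1 - ρ) * R ^ 2 * K := by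
    intro r hr
    have hftc : ∫ t in r..1, h' t = φ p - φ (AffineMap.lineMap y p r) := by
      rw [intervalIntegral.integral_eq_sub_of_hasDerivAt
        (fun t _ => PolygonalElement.hasDerivAt_comp_lineMap hφ y p t)
        (hh'.intervalIntegrable _ _), AffineMap.lineMap_apply_one]
    have hcs := sq_intervalIntegral_le hh' hr.2
    rw [hftc] at hcs
    have hmono : ∫ t in r..1, h' t ^ 2 ≤ ∫ t in ρ..1, h' t ^ 2 := by
      refine intervalIntegral.integral_mono_interval hr.1 hr.2 le_rfl
        (Eventually.of_forall fun t => sq_nonneg _)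
        (Continuous.intervalIntegrable (by fun_prop) _ _)
    have hnn : 0 ≤ ∫ t in r..1, h' t ^ 2 :=
      intervalIntegral.integral_nonneg hr.2 fun t _ => sq_nonneg _
    have h3 : (φ p - φ (AffineMap.lineMap y p r)) ^ 2 ≤ (1 - ρ) * (2 * R ^ 2 * K) :=
      hcs.trans (mul_le_mul (by linarith [hr.1]) (hmono.trans hJ) hnn (by linarith))
    have h4 : φ (AffineMap.lineMap y p r) ^ 2 ≤ 2 * φ p ^ 2 + 4 * (1 - ρ) * R ^ 2 * K := by
      nlinarith [sq_nonneg (2 * φ p - φ (AffineMap.lineMap y p r))]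
    refine le_trans ?_ h4
    exact mul_le_of_le_one_left (sq_nonneg _) hr.2
  have := intervalIntegral.integral_mono_on (μ := volume) hρ1
    (Continuous.intervalIntegrable (by fun_prop) _ _)
    (Continuous.intervalIntegrable (continuous_const (y := 2 * φ p ^ 2 + 4 * (1 - ρ) * R ^ 2 * K))
      _ _) hpt
  rw [intervalIntegral.integral_const, smul_eq_mul] at this
  refine this.trans (le_of_eq ?_)
  ring

/-- At distance parameter r from the corner P, the jump between the two sides is the integral over s
of a derivative of size r ‖B - A‖ ‖∇φ‖. Its square carries r²; dividing by r leaves exactly the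
Jacobian r of the triangle coordinates, so the bound is uniform as δ → 0. -/
lemma integral_corner_le {φ : Plane → ℝ} (hφ : ContDiff ℝ 1 φ) {P A B : Plane}
    (hD : cross (A - P) (B - P) ≠ 0) {δ : ℝ} (hδ : 0 < δ) (hδ1 : δ ≤ 1) :
    ∫ r in δ..1, r⁻¹ * (φ (AffineMap.lineMap P A r) - φ (AffineMap.lineMap P B r)) ^ 2 ≤
      ‖B - A‖ ^ 2 / |cross (A - P) (B - P)| *
        ∫ x in triMap P A B '' triDom δ, ‖gradient φ x‖ ^ 2 := by
  have hφc := hφ.continuous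
  have hgc := continuous_gradient hφ
  rw [integral_image_triMap (measurableSet_triDom δ) hD (triDom_pos hδ.le), ← mul_assoc,
    div_mul_cancel₀ _ (abs_ne_zero.2 hD), integral_triDom_swap (by fun_prop) hδ1,
    ← intervalIntegral.integral_const_mul]
  have hcont : Continuous fun r : ℝ => ‖B - A‖ ^ 2 *
      ∫ s in (0 : ℝ)..1, r * ‖gradient φ (triMap P A B (s, r))‖ ^ 2 := by
    refine continuous_const.mul ?_
    exact intervalIntegral.continuous_parametric_intervalIntegral_of_continuous'
      (f := fun (r s : ℝ) => r * ‖gradient φ (triMap P A B (s, r))‖ ^ 2) (by fun_prop) 0 1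
  refine intervalIntegral.integral_mono_on hδ1 ?_ (hcont.intervalIntegrable _ _) fun r hr => ?_
  · refine ContinuousOn.intervalIntegrable (ContinuousOn.mul ?_ (by fun_prop))
    rw [Set.uIcc_of_le hδ1]
    exact continuousOn_inv₀.mono fun r hr => (hδ.trans_le hr.1).ne'
  have hr0 : 0 < r := hδ.trans_le hr.1
  have hder : ∀ s : ℝ, HasDerivAt (fun s : ℝ => φ (triMap P A B (s, r)))
      (fderiv ℝ φ (triMap P A B (s, r)) (r • (B - A))) s := by
    intro s
    refine ((hφ.differentiable (by simp)) _).hasFDerivAt.comp_hasDerivAt s ?_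
    simp only [triMap_eq]
    simpa using ((((hasDerivAt_id s).smul_const (B - A)).const_add (A - P)).const_smul r).const_add P
  have hdc : Continuous fun s : ℝ => fderiv ℝ φ (triMap P A B (s, r)) (r • (B - A)) :=
    PolygonalElement.continuous_fderiv_apply' hφ (by fun_prop) continuous_const
  have hftc := intervalIntegral.integral_eq_sub_of_hasDerivAt (fun s _ => hder s)
    (hdc.intervalIntegrable 0 1)
  have hcs := sq_intervalIntegral_le hdc zero_le_one
  rw [hftc, sub_zero, one_mul] at hcs
  have e1 : triMap P A B (1, r) = AffineMap.lineMap P B r := by simp [triMap]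
  have e0 : triMap P A B (0, r) = AffineMap.lineMap P A r := by simp [triMap]
  rw [e1, e0, ← neg_sub, neg_sq] at hcs
  have hle : ∫ s in (0 : ℝ)..1, fderiv ℝ φ (triMap P A B (s, r)) (r • (B - A)) ^ 2 ≤
      r * (‖B - A‖ ^ 2 * ∫ s in (0 : ℝ)..1, r * ‖gradient φ (triMap P A B (s, r))‖ ^ 2) := by
    rw [← intervalIntegral.integral_const_mul, ← intervalIntegral.integral_const_mul]
    refine intervalIntegral.integral_mono_on zero_le_one
      (Continuous.intervalIntegrable (by fun_prop) _ _)
      (Continuous.intervalIntegrable (by fun_prop) _ _) fun s _ => ?_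
    refine (sq_fderiv_le φ _ (R := r * ‖B - A‖) ?_).trans (le_of_eq (by ring))
    rw [norm_smul, Real.norm_eq_abs, abs_of_pos hr0]
  rw [inv_mul_le_iff₀ hr0]
  exact hcs.trans hle

/-! ### Trace, Poincaré, collar and corner estimates on the element -/

namespace PolygonalElement

variable {T : PolygonalElement}

/-- The Dirichlet energy. -/
noncomputable def energy (T : PolygonalElement) (φ : Plane → ℝ) : ℝ :=
  ∫ x in T.carrier, ‖gradient φ x‖ ^ 2

lemma exists_norm_sub_center_le (T : PolygonalElement) :
    ∃ R : ℝ, 0 < R ∧ ∀ x ∈ closure T.carrier, ‖x - T.center‖ ≤ R := by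
  obtain ⟨R, hR⟩ := T.isBounded_carrier.closure.subset_closedBall T.center
  refine ⟨|R| + 1, by positivity, fun x hx => ?_⟩
  have := mem_closedBall_iff_norm.1 (hR hx)
  linarith [le_abs_self R]

lemma integrable_energy {φ : Plane → ℝ} (hφ : ContDiff ℝ 1 φ) :
    IntegrableOn (fun x => ‖gradient φ x‖ ^ 2) T.carrier :=
  integrableOn_of_continuous ((continuous_gradient hφ).norm.pow 2)

lemma integrableOn_sq {φ : Plane → ℝ} (hφ : Continuous φ) :
    IntegrableOn (fun x => φ x ^ 2) T.carrier := integrableOn_of_continuous (hφ.pow 2)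

lemma continuous_mul_fderiv {φ : Plane → ℝ} (hφ : ContDiff ℝ 1 φ) (y : Plane) :
    Continuous fun x => 2 * φ x * fderiv ℝ φ x (x - y) :=
  (continuous_const.mul hφ.continuous).mul
    (continuous_fderiv_apply' hφ continuous_id (by fun_prop))

/-- The radial Green formula for `φ²`. -/
lemma green_radial_sq {φ : Plane → ℝ} (hφ : ContDiff ℝ 1 φ) :
    2 * (∫ x in T.carrier, φ x ^ 2) +
      ∫ x in T.carrier, 2 * φ x * fderiv ℝ φ x (x - T.center) =
      ∑ i, |T.apexDet T.center i| * ∫ s in (0 : ℝ)..1, φ (T.edgePt i s) ^ 2 := by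
  rw [← T.isKernelPt_center.green_radial (hφ.pow 2), ← integral_const_mul, ← integral_add]
  · simp only [fderiv_sq hφ]
  · exact (integrableOn_sq hφ.continuous).const_mul 2
  · exact integrableOn_of_continuous (continuous_mul_fderiv hφ _)

/-- In the radial Green formula for φ² the cross term 2 φ ∂φ is at most φ² + R² ‖∇φ‖², so every edge
integral is controlled by the H¹ norm. -/
lemma exists_trace_le (T : PolygonalElement) : ∃ C : ℝ, ∀ φ : Plane → ℝ, ContDiff ℝ 1 φ → ∀ i,
    ∫ s in (0 : ℝ)..1, φ (T.edgePt i s) ^ 2 ≤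
      C * ((∫ x in T.carrier, φ x ^ 2) + T.energy φ) := by
  obtain ⟨R, hR, hRT⟩ := T.exists_norm_sub_center_le
  have hDpos : ∀ i, 0 < |T.apexDet T.center i| := fun i =>
    abs_pos.2 (T.isKernelPt_center.apexDet_ne_zero i)
  refine ⟨∑ i, (3 + R ^ 2) / |T.apexDet T.center i|, fun φ hφ i => ?_⟩
  set N := ∫ x in T.carrier, φ x ^ 2 with hN
  have hN0 : 0 ≤ N := integral_nonneg fun x => sq_nonneg _
  have hE0 : 0 ≤ T.energy φ := integral_nonneg fun x => sq_nonneg _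
  have hg := green_radial_sq (T := T) hφ
  have h1 : ∫ x in T.carrier, 2 * φ x * fderiv ℝ φ x (x - T.center) ≤ N + R ^ 2 * T.energy φ := by
    rw [hN, energy, ← integral_const_mul, ← integral_add (integrableOn_sq hφ.continuous)
      ((integrable_energy hφ).const_mul _)]
    refine setIntegral_mono_on (integrableOn_of_continuous (continuous_mul_fderiv hφ _))
      ((integrableOn_sq hφ.continuous).add ((integrable_energy hφ).const_mul _))
      T.isOpen_carrier.measurableSet fun x hx => ?_
    have := sq_fderiv_le φ x (hRT x (subset_closure hx))
    nlinarith [sq_nonneg (φ x - fderiv ℝ φ x (x - T.center))]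
  have h2 : |T.apexDet T.center i| * ∫ s in (0 : ℝ)..1, φ (T.edgePt i s) ^ 2 ≤
      ∑ i, |T.apexDet T.center i| * ∫ s in (0 : ℝ)..1, φ (T.edgePt i s) ^ 2 :=
    Finset.single_le_sum (f := fun i => |T.apexDet T.center i| *
      ∫ s in (0 : ℝ)..1, φ (T.edgePt i s) ^ 2) (fun i _ => mul_nonneg (abs_nonneg _)
      (intervalIntegral.integral_nonneg zero_le_one fun s _ => sq_nonneg _)) (Finset.mem_univ i)
  have h3 : |T.apexDet T.center i| * ∫ s in (0 : ℝ)..1, φ (T.edgePt i s) ^ 2 ≤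
      (3 + R ^ 2) * (N + T.energy φ) := by nlinarith [sq_nonneg R]
  have h4 : (3 + R ^ 2) / |T.apexDet T.center i| ≤ ∑ i, (3 + R ^ 2) / |T.apexDet T.center i| :=
    Finset.single_le_sum (f := fun i => (3 + R ^ 2) / |T.apexDet T.center i|)
      (fun i _ => by positivity) (Finset.mem_univ i)
  refine le_trans ?_ (mul_le_mul_of_nonneg_right h4 (by positivity))
  rw [div_mul_eq_mul_div, le_div_iff₀ (hDpos i), mul_comm]
  exact h3

/-- Poincaré's inequality with a boundary term. -/
lemma exists_poincare_boundary (T : PolygonalElement) : ∃ C : ℝ, 0 < C ∧ ∀ φ : Plane → ℝ,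
    ContDiff ℝ 1 φ → ∫ x in T.carrier, φ x ^ 2 ≤
      C * (T.energy φ + ∑ i, ∫ s in (0 : ℝ)..1, φ (T.edgePt i s) ^ 2) := by
  obtain ⟨R, hR, hRT⟩ := T.exists_norm_sub_center_le
  refine ⟨R ^ 2 + ∑ i, |T.apexDet T.center i|, by positivity, fun φ hφ => ?_⟩
  have hg := green_radial_sq (T := T) hφ
  have hI : ∀ i, 0 ≤ ∫ s in (0 : ℝ)..1, φ (T.edgePt i s) ^ 2 := fun i =>
    intervalIntegral.integral_nonneg zero_le_one fun s _ => sq_nonneg _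
  have hE0 : 0 ≤ T.energy φ := integral_nonneg fun x => sq_nonneg _
  have hb : ∑ i, |T.apexDet T.center i| * ∫ s in (0 : ℝ)..1, φ (T.edgePt i s) ^ 2 ≤
      (∑ i, |T.apexDet T.center i|) * ∑ i, ∫ s in (0 : ℝ)..1, φ (T.edgePt i s) ^ 2 := by
    rw [Finset.sum_mul]
    refine Finset.sum_le_sum fun i _ => mul_le_mul_of_nonneg_left ?_ (abs_nonneg _)
    exact Finset.single_le_sum (f := fun i => ∫ s in (0 : ℝ)..1, φ (T.edgePt i s) ^ 2)
      (fun i _ => hI i) (Finset.mem_univ i)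
  -- Young's inequality leaves one copy of ∫ φ² on the right, to be absorbed by the two copies in
  -- the radial Green formula.
  have h1 : -(∫ x in T.carrier, 2 * φ x * fderiv ℝ φ x (x - T.center)) ≤
      (∫ x in T.carrier, φ x ^ 2) + R ^ 2 * T.energy φ := by
    rw [energy, ← integral_const_mul, ← integral_add (integrableOn_sq hφ.continuous)
      ((integrable_energy hφ).const_mul _), ← integral_neg]
    refine setIntegral_mono_on (integrableOn_of_continuous (continuous_mul_fderiv hφ _)).neg
      ((integrableOn_sq hφ.continuous).add ((integrable_energy hφ).const_mul _))
      T.isOpen_carrier.measurableSet fun x hx => ?_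
    have := sq_fderiv_le φ x (hRT x (subset_closure hx))
    nlinarith [sq_nonneg (φ x + fderiv ℝ φ x (x - T.center))]
  have h2 : 0 ≤ (∑ i, |T.apexDet T.center i|) * T.energy φ := by positivity
  have h3 : 0 ≤ R ^ 2 * ∑ i, ∫ s in (0 : ℝ)..1, φ (T.edgePt i s) ^ 2 :=
    mul_nonneg (sq_nonneg _) (Finset.sum_nonneg fun i _ => hI i)
  linarith

/-- Poincaré's inequality. -/
lemma exists_poincare (T : PolygonalElement) : ∃ C : ℝ, 0 < C ∧ ∀ φ : Plane → ℝ, ContDiff ℝ 1 φ →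
    (∀ x ∈ frontier T.carrier, φ x = 0) → ∫ x in T.carrier, φ x ^ 2 ≤ C * T.energy φ := by
  obtain ⟨C, hC, h⟩ := T.exists_poincare_boundary
  refine ⟨C, hC, fun φ hφ h0 => (h φ hφ).trans_eq ?_⟩
  rw [Finset.sum_eq_zero, add_zero]
  intro i _
  rw [intervalIntegral.integral_congr (g := fun _ => 0), intervalIntegral.integral_zero]
  intro s hs
  rw [Set.uIcc_of_le zero_le_one] at hs
  simp [h0 _ (edgePt_mem_frontier i hs)]

/-- A function is small near the boundary if its trace is small. -/
lemma exists_collar_le (T : PolygonalElement) : ∃ C : ℝ, 0 < C ∧ ∀ φ : Plane → ℝ,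
    ContDiff ℝ 1 φ → ∀ ρ : ℝ, 1 / 2 ≤ ρ → ρ ≤ 1 →
    ∫ x in T.collar T.center ρ, φ x ^ 2 ≤
      C * (∑ i, ∫ s in (0 : ℝ)..1, φ (T.edgePt i s) ^ 2) +
      C * (1 - ρ) ^ 2 * ∫ x in T.collar T.center ρ, ‖gradient φ x‖ ^ 2 := by
  obtain ⟨R, hR, hRT⟩ := T.exists_norm_sub_center_le
  have hc := T.isKernelPt_center
  obtain ⟨M, hM0, hMi⟩ : ∃ M : ℝ, 0 ≤ M ∧ ∀ i, |T.apexDet T.center i| ≤ M :=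
    ⟨∑ i, |T.apexDet T.center i|, Finset.sum_nonneg fun i _ => abs_nonneg _, fun i =>
      Finset.single_le_sum (f := fun i => |T.apexDet T.center i|)
        (fun i _ => abs_nonneg _) (Finset.mem_univ i)⟩
  refine ⟨2 * M + 4 * R ^ 2, by positivity, fun φ hφ ρ hρ hρ1 => ?_⟩
  have hφc := hφ.continuous
  have hgc := continuous_gradient hφ
  have hρ0 : 0 ≤ ρ := by linarith
  rw [hc.integral_collar hρ0 hρ1 (f := fun x => φ x ^ 2) (hφc.pow 2),
    hc.integral_collar hρ0 hρ1 (f := fun x => ‖gradient φ x‖ ^ 2) (hgc.norm.pow 2)]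
  set G : Fin T.numEdges → ℝ := fun i => ∫ s in (0 : ℝ)..1, ∫ r in ρ..1,
    r * ‖gradient φ (AffineMap.lineMap T.center (T.edgePt i s) r)‖ ^ 2 with hG
  have hG0 : ∀ i, 0 ≤ G i := fun i =>
    intervalIntegral.integral_nonneg zero_le_one fun s _ =>
      intervalIntegral.integral_nonneg hρ1 fun r hr =>
        mul_nonneg (hρ0.trans hr.1) (sq_nonneg _)
  set F : Fin T.numEdges → ℝ := fun i => ∫ s in (0 : ℝ)..1, φ (T.edgePt i s) ^ 2 with hF
  have hF0 : ∀ i, 0 ≤ F i := fun i =>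
    intervalIntegral.integral_nonneg zero_le_one fun s _ => sq_nonneg _
  have key : ∀ i, ∫ s in (0 : ℝ)..1, ∫ r in ρ..1,
      r * φ (AffineMap.lineMap T.center (T.edgePt i s) r) ^ 2 ≤
      2 * (1 - ρ) * F i + 4 * (1 - ρ) ^ 2 * R ^ 2 * G i := by
    intro i
    have c1 : Continuous fun s => ∫ r in ρ..1,
        r * φ (AffineMap.lineMap T.center (T.edgePt i s) r) ^ 2 :=
      intervalIntegral.continuous_parametric_intervalIntegral_of_continuous'
        (f := fun s r => r * φ (AffineMap.lineMap T.center (T.edgePt i s) r) ^ 2)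
        (by fun_prop) ρ 1
    have c2 : Continuous fun s => ∫ r in ρ..1,
        r * ‖gradient φ (AffineMap.lineMap T.center (T.edgePt i s) r)‖ ^ 2 :=
      intervalIntegral.continuous_parametric_intervalIntegral_of_continuous'
        (f := fun s r => r * ‖gradient φ (AffineMap.lineMap T.center (T.edgePt i s) r)‖ ^ 2)
        (by fun_prop) ρ 1
    rw [hF, hG, ← intervalIntegral.integral_const_mul, ← intervalIntegral.integral_const_mul,
      ← intervalIntegral.integral_add (Continuous.intervalIntegrable (by fun_prop) _ _)
      (Continuous.intervalIntegrable (by fun_prop) _ _)]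
    refine intervalIntegral.integral_mono_on zero_le_one (c1.intervalIntegrable _ _)
      (Continuous.intervalIntegrable (by fun_prop) _ _) fun s hs => ?_
    exact integral_collar_ray_le hφ (hRT _ (edgePt_mem_frontier i hs).1) hρ hρ1
  rw [Finset.mul_sum, Finset.mul_sum, ← Finset.sum_add_distrib]
  refine Finset.sum_le_sum fun i _ => ?_
  refine (mul_le_mul_of_nonneg_left (key i) (abs_nonneg _)).trans ?_
  rw [mul_add]
  refine add_le_add ?_ ?_
  · rw [← mul_assoc]
    refine mul_le_mul_of_nonneg_right ?_ (hF0 i)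
    nlinarith [hMi i, abs_nonneg (T.apexDet T.center i), sq_nonneg R]
  · have : 0 ≤ (1 - ρ) ^ 2 * (|T.apexDet T.center i| * G i) :=
      mul_nonneg (sq_nonneg _) (mul_nonneg (abs_nonneg _) (hG0 i))
    nlinarith

/-- `z` and `o` are the endpoints of the edge `i`. -/
def IsEnds (T : PolygonalElement) (i : Fin T.numEdges) (z o : Plane) : Prop :=
  (z = T.a i ∧ o = T.b i) ∨ (z = T.b i ∧ o = T.a i)

lemma IsEnds.lineMap_mem_frontier {i : Fin T.numEdges} {z o : Plane} (h : T.IsEnds i z o) {s : ℝ}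
    (hs : s ∈ Set.Icc (0 : ℝ) 1) : (AffineMap.lineMap z o s : Plane) ∈ frontier T.carrier := by
  rcases h with ⟨rfl, rfl⟩ | ⟨rfl, rfl⟩
  · exact edgePt_mem_frontier i hs
  · rw [← AffineMap.lineMap_apply_one_sub]
    exact edgePt_mem_frontier i ⟨by linarith [hs.2], by linarith [hs.1]⟩

lemma IsEnds.cross_ne_zero {i : Fin T.numEdges} {z o y : Plane} (h : T.IsEnds i z o)
    (hy : T.IsKernelPt y) : cross (o - z) (y - z) ≠ 0 := by
  have hD := hy.apexDet_ne_zero i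
  intro h0
  apply hD
  rcases h with ⟨rfl, rfl⟩ | ⟨rfl, rfl⟩
  · simp only [cross, apexDet, PiLp.sub_apply] at h0 ⊢
    linarith
  · simp only [cross, apexDet, PiLp.sub_apply] at h0 ⊢
    linarith

/-- The image is a part of the triangle with vertices z, o and y, each point of which lies on a
segment from the kernel point y to a point of the edge. -/
lemma IsEnds.image_subset {i : Fin T.numEdges} {z o y : Plane} (h : T.IsEnds i z o)
    (hy : T.IsKernelPt y) {δ : ℝ} (hδ : 0 ≤ δ) : triMap z o y '' triDom δ ⊆ T.carrier := by
  rintro _ ⟨⟨s, r⟩, ⟨hs, hr⟩, rfl⟩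
  simp only at hs hr
  have hr0 : 0 < r := hδ.trans_lt hr.1
  have h1 : 0 < 1 - r * s := by nlinarith [hs.2, hr.2, hs.1]
  -- The coordinate along y is r s. So the point is at polar radius 1 - r s from y, and normalising
  -- the remaining coordinates gives the position on the edge.
  have hmem := h.lineMap_mem_frontier (s := r * (1 - s) / (1 - r * s))
    ⟨div_nonneg (mul_nonneg hr0.le (by linarith [hs.2])) h1.le,
      (div_le_one h1).2 (by nlinarith [hr.2])⟩
  have := hy.lineMap_mem hmem.1 h1.le (by nlinarith [hs.1] : 1 - r * s < 1)
  convert this using 1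
  simp only [triMap, AffineMap.lineMap_apply, vadd_eq_add, vsub_eq_sub]
  match_scalars <;> field_simp <;> ring

/-- The traces on two edges with a common endpoint are close near that point. -/
lemma exists_corner_le {i j : Fin T.numEdges} {z o o' : Plane} (hi : T.IsEnds i z o)
    (hj : T.IsEnds j z o') : ∃ C : ℝ, ∀ φ : Plane → ℝ, ContDiff ℝ 1 φ → ∀ δ : ℝ, 0 < δ → δ ≤ 1 →
    ∫ r in δ..1, r⁻¹ * (φ (AffineMap.lineMap z o r) - φ (AffineMap.lineMap z o' r)) ^ 2 ≤
      C * T.energy φ := by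
  have hc := T.isKernelPt_center
  -- The two edges need not span a triangle inside the element, and they may even be aligned. Each
  -- is therefore compared with the segment from z to the centre, for which the triangle is
  -- nondegenerate and contained in the element.
  have key : ∀ {i : Fin T.numEdges} {z o : Plane}, T.IsEnds i z o → ∃ C : ℝ, ∀ φ : Plane → ℝ,
      ContDiff ℝ 1 φ → ∀ δ : ℝ, 0 < δ → δ ≤ 1 → ∫ r in δ..1, r⁻¹ *
        (φ (AffineMap.lineMap z o r) - φ (AffineMap.lineMap z T.center r)) ^ 2 ≤
        C * T.energy φ := by
    intro i z o hi
    refine ⟨_, fun φ hφ δ hδ hδ1 =>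
      (integral_corner_le hφ (hi.cross_ne_zero hc) hδ hδ1).trans
        (mul_le_mul_of_nonneg_left ?_ (by positivity))⟩
    exact setIntegral_mono_set (integrable_energy hφ) (Eventually.of_forall fun x => sq_nonneg _)
      (hi.image_subset hc hδ.le).eventuallyLE
  obtain ⟨C, hC⟩ := key hi
  obtain ⟨C', hC'⟩ := key hj
  refine ⟨2 * (C + C'), fun φ hφ δ hδ hδ1 => ?_⟩
  have hφc := hφ.continuous
  have hint : ∀ p q : Plane, IntervalIntegrable (fun r : ℝ => r⁻¹ *
      (φ (AffineMap.lineMap z p r) - φ (AffineMap.lineMap z q r)) ^ 2) volume δ 1 := by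
    intro p q
    refine ContinuousOn.intervalIntegrable (ContinuousOn.mul ?_ (by fun_prop))
    rw [Set.uIcc_of_le hδ1]
    exact continuousOn_inv₀.mono fun r hr => (hδ.trans_le hr.1).ne'
  have h1 := hC φ hφ δ hδ hδ1
  have h2 := hC' φ hφ δ hδ hδ1
  have h3 : ∫ r in δ..1, r⁻¹ *
      (φ (AffineMap.lineMap z o r) - φ (AffineMap.lineMap z o' r)) ^ 2 ≤
      ∫ r in δ..1, (2 * (r⁻¹ * (φ (AffineMap.lineMap z o r) -
        φ (AffineMap.lineMap z T.center r)) ^ 2) + 2 * (r⁻¹ * (φ (AffineMap.lineMap z o' r) -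
        φ (AffineMap.lineMap z T.center r)) ^ 2)) := by
    refine intervalIntegral.integral_mono_on hδ1 (hint _ _)
      (((hint _ _).const_mul 2).add ((hint _ _).const_mul 2)) fun r hr => ?_
    have hr0 : 0 < r⁻¹ := inv_pos.2 (hδ.trans_le hr.1)
    rw [← mul_assoc, ← mul_assoc, mul_comm 2, mul_assoc, mul_assoc, ← mul_add]
    refine mul_le_mul_of_nonneg_left ?_ hr0.le
    nlinarith [sq_nonneg (φ (AffineMap.lineMap z o r) + φ (AffineMap.lineMap z o' r) -
      2 * φ (AffineMap.lineMap z T.center r))]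
  rw [intervalIntegral.integral_add ((hint _ _).const_mul 2) ((hint _ _).const_mul 2),
    intervalIntegral.integral_const_mul, intervalIntegral.integral_const_mul] at h3
  linarith

end PolygonalElement

/-! ### Convergence in `L²` -/

section L2

variable {α E : Type*} [MeasurableSpace α] [NormedAddCommGroup E]
  {μ ν : Measure α}

/-- Convergence of functions in `L²(μ)`. -/
def L2Tendsto (μ : Measure α) (F : ℕ → α → E) (f : α → E) : Prop :=
  Tendsto (fun n => eLpNorm (fun x => F n x - f x) 2 μ) atTop (𝓝 0)

lemma memLp_integrable_inner [InnerProductSpace ℝ E] {f g : α → E} (hf : MemLp f 2 μ) (hg : MemLp g 2 μ) :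
    Integrable (fun x => inner ℝ (f x) (g x)) μ := by
  refine (L2.integrable_inner (𝕜 := ℝ) (hf.toLp f) (hg.toLp g)).congr ?_
  filter_upwards [hf.coeFn_toLp, hg.coeFn_toLp] with x h1 h2
  rw [h1, h2]

lemma memLp_integrable_mul {f g : α → ℝ} (hf : MemLp f 2 μ) (hg : MemLp g 2 μ) :
    Integrable (fun x => f x * g x) μ := hf.integrable_mul hg

lemma inner_toLp [InnerProductSpace ℝ E] {f g : α → E} (hf : MemLp f 2 μ) (hg : MemLp g 2 μ) :
    inner ℝ (hf.toLp f) (hg.toLp g) = ∫ x, inner ℝ (f x) (g x) ∂μ := by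
  rw [L2.inner_def]
  refine integral_congr_ae ?_
  filter_upwards [hf.coeFn_toLp, hg.coeFn_toLp] with x h1 h2
  rw [h1, h2]

lemma L2Tendsto.integral_inner [InnerProductSpace ℝ E] {F G : ℕ → α → E} {f g : α → E} (hF : L2Tendsto μ F f)
    (hG : L2Tendsto μ G g) (mF : ∀ n, MemLp (F n) 2 μ) (mf : MemLp f 2 μ)
    (mG : ∀ n, MemLp (G n) 2 μ) (mg : MemLp g 2 μ) :
    Tendsto (fun n => ∫ x, inner ℝ (F n x) (G n x) ∂μ) atTop (𝓝 (∫ x, inner ℝ (f x) (g x) ∂μ)) := by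
  have h1 := (Lp.tendsto_Lp_iff_tendsto_eLpNorm'' F mF f mf).2 hF
  have h2 := (Lp.tendsto_Lp_iff_tendsto_eLpNorm'' G mG g mg).2 hG
  have h3 := h1.inner (𝕜 := ℝ) h2
  simp only [inner_toLp] at h3
  exact h3

lemma L2Tendsto.const (f : α → E) : L2Tendsto μ (fun _ => f) f := by
  simp [L2Tendsto]

lemma L2Tendsto.integral_norm_sq [InnerProductSpace ℝ E] {F : ℕ → α → E} {f : α → E} (hF : L2Tendsto μ F f)
    (mF : ∀ n, MemLp (F n) 2 μ) (mf : MemLp f 2 μ) :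
    Tendsto (fun n => ∫ x, ‖F n x‖ ^ 2 ∂μ) atTop (𝓝 (∫ x, ‖f x‖ ^ 2 ∂μ)) := by
  simpa only [real_inner_self_eq_norm_sq] using hF.integral_inner hF mF mf mF mf

lemma L2Tendsto.integral_mul {F G : ℕ → α → ℝ} {f g : α → ℝ} (hF : L2Tendsto μ F f)
    (hG : L2Tendsto μ G g) (mF : ∀ n, MemLp (F n) 2 μ) (mf : MemLp f 2 μ)
    (mG : ∀ n, MemLp (G n) 2 μ) (mg : MemLp g 2 μ) :
    Tendsto (fun n => ∫ x, F n x * G n x ∂μ) atTop (𝓝 (∫ x, f x * g x ∂μ)) := by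
  simpa only [RCLike.inner_apply, conj_trivial] using hG.integral_inner hF mG mg mF mf

lemma L2Tendsto.integral_sq {F : ℕ → α → ℝ} {f : α → ℝ} (hF : L2Tendsto μ F f)
    (mF : ∀ n, MemLp (F n) 2 μ) (mf : MemLp f 2 μ) :
    Tendsto (fun n => ∫ x, F n x ^ 2 ∂μ) atTop (𝓝 (∫ x, f x ^ 2 ∂μ)) := by
  simpa only [← sq] using hF.integral_mul hF mF mf mF mf

lemma L2Tendsto.sub {F G : ℕ → α → E} {f g : α → E} (hF : L2Tendsto μ F f)
    (hG : L2Tendsto μ G g) (mF : ∀ n, AEStronglyMeasurable (F n) μ)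
    (mf : AEStronglyMeasurable f μ) (mG : ∀ n, AEStronglyMeasurable (G n) μ)
    (mg : AEStronglyMeasurable g μ) :
    L2Tendsto μ (fun n x => F n x - G n x) (fun x => f x - g x) := by
  have h := hF.add hG
  rw [add_zero] at h
  refine tendsto_of_tendsto_of_tendsto_of_le_of_le tendsto_const_nhds h (fun _ => zero_le) fun n => ?_
  have e : (fun x => F n x - G n x - (f x - g x)) =
      (fun x => F n x - f x) - fun x => G n x - g x := by
    ext x
    simp only [Pi.sub_apply]
    abel
  rw [e]
  exact eLpNorm_sub_le ((mF n).sub mf) ((mG n).sub mg) (by norm_num)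

lemma L2Tendsto.mono_measure {F : ℕ → α → E} {f : α → E} (hF : L2Tendsto μ F f) (h : ν ≤ μ) :
    L2Tendsto ν F f :=
  tendsto_of_tendsto_of_tendsto_of_le_of_le tendsto_const_nhds hF (fun _ => zero_le) fun _ =>
    eLpNorm_mono_measure _ h

lemma L2Tendsto.congr_limit {F : ℕ → α → E} {f f' : α → E} (hF : L2Tendsto μ F f)
    (h : f =ᵐ[μ] f') : L2Tendsto μ F f' := by
  refine hF.congr fun n => eLpNorm_congr_ae ?_
  filter_upwards [h] with x hx
  rw [hx]

lemma L2Tendsto.smul_bdd [NormedSpace ℝ E] {F : ℕ → α → E} {f : α → E} (hF : L2Tendsto μ F f) {w : α → ℝ} {C : ℝ}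
    (hw : ∀ᵐ x ∂μ, |w x| ≤ C) : L2Tendsto μ (fun n x => w x • F n x) (fun x => w x • f x) := by
  have h := ENNReal.Tendsto.const_mul (a := ENNReal.ofReal C) hF (Or.inr ENNReal.ofReal_ne_top)
  rw [mul_zero] at h
  refine tendsto_of_tendsto_of_tendsto_of_le_of_le tendsto_const_nhds h (fun _ => zero_le) fun n => ?_
  refine eLpNorm_le_mul_eLpNorm_of_ae_le_mul ?_ 2
  filter_upwards [hw] with x hx
  rw [← smul_sub, norm_smul]
  gcongr
  exact hx

end L2

lemma MemLp_smul_bdd {α E : Type*} [MeasurableSpace α] [NormedAddCommGroup E] [NormedSpace ℝ E]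
    {μ : Measure α} {f : α → E} {w : α → ℝ} {C : ℝ} (hf : MemLp f 2 μ)
    (hwm : AEStronglyMeasurable w μ) (hw : ∀ᵐ x ∂μ, |w x| ≤ C) :
    MemLp (fun x => w x • f x) 2 μ := by
  refine hf.of_le_mul (c := C) (hwm.smul hf.1) ?_
  filter_upwards [hw] with x hx
  rw [norm_smul]
  gcongr
  exact hx

lemma gradient_sub' {φ ψ : Plane → ℝ} {x : Plane} (hφ : DifferentiableAt ℝ φ x)
    (hψ : DifferentiableAt ℝ ψ x) :
    gradient (fun x => φ x - ψ x) x = gradient φ x - gradient ψ x := by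
  rw [gradient, gradient, gradient, ← map_sub]
  congr 1
  exact (hφ.hasFDerivAt.sub hψ.hasFDerivAt).fderiv

/-- Lebesgue measure on the parameter interval of an edge. -/
noncomputable abbrev edgeVol : Measure ℝ := volume.restrict (Set.Icc (0 : ℝ) 1)

lemma integral_edgeVol (f : ℝ → ℝ) : ∫ s, f s ∂edgeVol = ∫ s in (0 : ℝ)..1, f s := by
  rw [intervalIntegral.integral_of_le zero_le_one, integral_Icc_eq_integral_Ioc]

namespace PolygonalElement

variable {T : PolygonalElement}

instance : IsFiniteMeasure T.vol :=
  ⟨by rw [Measure.restrict_apply_univ]; exact T.isBounded_carrier.measure_lt_top⟩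

lemma memLp_of_continuous {E : Type*} [NormedAddCommGroup E] [SecondCountableTopology E]
    {f : Plane → E} (hf : Continuous f) : MemLp f 2 T.vol := by
  obtain ⟨C, hC⟩ := T.isBounded_carrier.isCompact_closure.exists_bound_of_continuousOn
    hf.continuousOn
  exact MemLp.of_bound hf.aestronglyMeasurable C
    (ae_restrict_of_forall_mem T.isOpen_carrier.measurableSet fun x hx => hC x (subset_closure hx))

end PolygonalElement

lemma memLp_edge_of_continuousOn {f : ℝ → ℝ} (hf : ContinuousOn f (Set.Icc 0 1)) :
    MemLp f 2 edgeVol := by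
  obtain ⟨C, hC⟩ := isCompact_Icc.exists_bound_of_continuousOn hf
  exact MemLp.of_bound (hf.aestronglyMeasurable measurableSet_Icc) C
    (ae_restrict_of_forall_mem measurableSet_Icc hC)

/-! ### Smooth approximation in H¹ with prescribed boundary limits -/

namespace PolygonalElement

variable {T : PolygonalElement}

/-- Smooth functions `φ n` converge to `(f, g)` in `H¹(T)`, and to `γ` on the boundary. -/
structure Approx (T : PolygonalElement) (φ : ℕ → Plane → ℝ) (f : Plane → ℝ) (g : Plane → Plane)
    (γ : Plane → ℝ) : Prop where
  smooth : ∀ n, ContDiff ℝ ∞ (φ n)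
  fn : L2Tendsto T.vol φ f
  grad : L2Tendsto T.vol (fun n => gradient (φ n)) g
  edge : ∀ i, L2Tendsto edgeVol (fun n s => φ n (T.edgePt i s)) fun s => γ (T.edgePt i s)

lemma hasTrace_iff {v : T.H1} {γ : Plane → ℝ} :
    T.HasTrace v γ ↔ ∃ φ, T.Approx φ v.fn v.grad γ :=
  ⟨fun ⟨φ, h1, h2, h3, h4⟩ => ⟨φ, h1, h2, h3, h4⟩, fun ⟨φ, h1, h2, h3, h4⟩ => ⟨φ, h1, h2, h3, h4⟩⟩

lemma H1.memLp_fn (v : T.H1) : MemLp v.fn 2 T.vol := Lp.memLp _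

lemma H1.memLp_grad (v : T.H1) : MemLp v.grad 2 T.vol := Lp.memLp _

section Approx

variable {φ ψ : ℕ → Plane → ℝ} {f f' : Plane → ℝ} {g g' : Plane → Plane} {γ γ' : Plane → ℝ}

lemma Approx.contDiff (h : T.Approx φ f g γ) (n : ℕ) : ContDiff ℝ 1 (φ n) :=
  (h.smooth n).of_le (by exact_mod_cast le_top)

lemma Approx.continuous (h : T.Approx φ f g γ) (n : ℕ) : Continuous (φ n) :=
  (h.smooth n).continuous

lemma Approx.memLp (h : T.Approx φ f g γ) (n : ℕ) : MemLp (φ n) 2 T.vol :=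
  memLp_of_continuous (h.continuous n)

lemma Approx.memLp_grad (h : T.Approx φ f g γ) (n : ℕ) : MemLp (gradient (φ n)) 2 T.vol :=
  memLp_of_continuous (continuous_gradient (h.contDiff n))

lemma Approx.memLp_edge (h : T.Approx φ f g γ) (n : ℕ) (i : Fin T.numEdges) :
    MemLp (fun s => φ n (T.edgePt i s)) 2 edgeVol :=
  memLp_edge_of_continuousOn ((h.continuous n).comp (continuous_edgePt i)).continuousOn

lemma Approx.sub (h : T.Approx φ f g γ) (h' : T.Approx ψ f' g' γ')
    (mf : MemLp f 2 T.vol) (mf' : MemLp f' 2 T.vol) (mg : MemLp g 2 T.vol)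
    (mg' : MemLp g' 2 T.vol) (mγ : ∀ i, MemLp (fun s => γ (T.edgePt i s)) 2 edgeVol)
    (mγ' : ∀ i, MemLp (fun s => γ' (T.edgePt i s)) 2 edgeVol) :
    T.Approx (fun n x => φ n x - ψ n x) (fun x => f x - f' x) (fun x => g x - g' x)
      (fun x => γ x - γ' x) where
  smooth n := (h.smooth n).sub (h'.smooth n)
  fn := h.fn.sub h'.fn (fun n => (h.memLp n).1) mf.1 (fun n => (h'.memLp n).1) mf'.1
  grad := by
    have e : ∀ n, gradient (fun x => φ n x - ψ n x) =
        fun x => gradient (φ n) x - gradient (ψ n) x := fun n => funext fun x =>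
      gradient_sub' ((h.contDiff n).differentiable (by simp) x)
        ((h'.contDiff n).differentiable (by simp) x)
    simp only [e]
    exact h.grad.sub h'.grad (fun n => (h.memLp_grad n).1) mg.1 (fun n => (h'.memLp_grad n).1) mg'.1
  edge i := (h.edge i).sub (h'.edge i) (fun n => (h.memLp_edge n i).1) (mγ i).1
    (fun n => (h'.memLp_edge n i).1) (mγ' i).1

lemma Approx.congr (h : T.Approx φ f g γ) (hf : f =ᵐ[T.vol] f') (hg : g =ᵐ[T.vol] g')
    (hγ : ∀ i, (fun s => γ (T.edgePt i s)) =ᵐ[edgeVol] fun s => γ' (T.edgePt i s)) :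
    T.Approx φ f' g' γ' where
  smooth := h.smooth
  fn := h.fn.congr_limit hf
  grad := h.grad.congr_limit hg
  edge i := (h.edge i).congr_limit (hγ i)

/-! ### Green's formula in `H¹` -/

lemma inner_evVec (τ : Fin 2 → MvPolynomial (Fin 2) ℝ) (x v : Plane) :
    inner ℝ (evVec τ x) v = ∑ j, ev (τ j) x * v j := by
  rw [inner_plane, Fin.sum_univ_two]
  rfl

lemma gradient_apply (φ : Plane → ℝ) (x : Plane) (j : Fin 2) :
    gradient φ x j = fderiv ℝ φ x (EuclideanSpace.single j 1) := by
  rw [← inner_gradient_left, EuclideanSpace.inner_single_right]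
  simp

/-- This is `green` applied to the product φ τ_j in the j-th coordinate direction, summed over j. -/
lemma green_vec {φ : Plane → ℝ} (hφ : ContDiff ℝ 1 φ) (τ : Fin 2 → MvPolynomial (Fin 2) ℝ) :
    ∫ x in T.carrier, inner ℝ (gradient φ x) (evVec τ x) =
      -(∫ x in T.carrier, φ x * ev (divPoly τ) x) + T.boundaryFlux φ τ := by
  have hφc := hφ.continuous
  have hgc := continuous_gradient hφ
  have hj : ∀ j, (∫ x in T.carrier, φ x * ev (MvPolynomial.pderiv j (τ j)) x) +
      ∫ x in T.carrier, ev (τ j) x * gradient φ x j =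
      ∑ i, dist (T.a i) (T.b i) *
        ∫ s in (0 : ℝ)..1, φ (T.edgePt i s) * (ev (τ j) (T.edgePt i s) * T.normal i j) := by
    intro j
    have h := green (T := T) (hφ.mul (contDiff_ev (τ j))) (EuclideanSpace.single j 1)
    rw [← integral_add]
    · convert h using 2 with x i
      · funext x
        have hd : fderiv ℝ (fun x => φ x * ev (τ j) x) x (EuclideanSpace.single j 1) =
            φ x * ev (MvPolynomial.pderiv j (τ j)) x + ev (τ j) x * gradient φ x j := by
          rw [fderiv_fun_mul ((hφ.differentiable (by simp)) x)
            (((contDiff_ev (τ j) (n := 1)).differentiable (by simp)) x), gradient_apply]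
          simp [fderiv_ev_apply]
        exact hd.symm
      · rw [EuclideanSpace.inner_single_left, map_one, one_mul, mul_assoc]
        congr 1
        rw [← intervalIntegral.integral_const_mul]
        refine intervalIntegral.integral_congr fun s _ => ?_
        ring
    · exact integrableOn_of_continuous (by fun_prop)
    · exact integrableOn_of_continuous (by fun_prop)
  have h1 : ∫ x in T.carrier, φ x * ev (divPoly τ) x =
      ∑ j, ∫ x in T.carrier, φ x * ev (MvPolynomial.pderiv j (τ j)) x := by
    rw [← integral_finsetSum _ fun j _ => integrableOn_of_continuous (by fun_prop)]
    simp only [divPoly, ev_sum, Finset.mul_sum]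
  have h2 : ∫ x in T.carrier, inner ℝ (gradient φ x) (evVec τ x) =
      ∑ j, ∫ x in T.carrier, ev (τ j) x * gradient φ x j := by
    rw [← integral_finsetSum _ fun j _ => integrableOn_of_continuous (by fun_prop)]
    simp only [real_inner_comm, inner_evVec]
  have h3 : T.boundaryFlux φ τ = ∑ j, ∑ i, dist (T.a i) (T.b i) *
      ∫ s in (0 : ℝ)..1, φ (T.edgePt i s) * (ev (τ j) (T.edgePt i s) * T.normal i j) := by
    rw [boundaryFlux, Finset.sum_comm]
    refine Finset.sum_congr rfl fun i _ => ?_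
    rw [edgeIntegral, ← Finset.mul_sum, ← intervalIntegral.integral_finsetSum fun j _ =>
      Continuous.intervalIntegrable (by fun_prop) _ _]
    simp only [inner_evVec, Finset.mul_sum]
  rw [h1, h2, h3, ← Finset.sum_congr rfl fun j _ => hj j, Finset.sum_add_distrib]
  ring

lemma Approx.green (h : T.Approx φ f g γ) (mf : MemLp f 2 T.vol) (mg : MemLp g 2 T.vol)
    (mγ : ∀ i, MemLp (fun s => γ (T.edgePt i s)) 2 edgeVol)
    (τ : Fin 2 → MvPolynomial (Fin 2) ℝ) :
    ∫ x in T.carrier, inner ℝ (g x) (evVec τ x) =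
      -(∫ x in T.carrier, f x * ev (divPoly τ) x) + T.boundaryFlux γ τ := by
  have h1 := h.grad.integral_inner (L2Tendsto.const (evVec τ)) h.memLp_grad mg
    (fun _ => memLp_of_continuous (continuous_evVec τ)) (memLp_of_continuous (continuous_evVec τ))
  have h2 := h.fn.integral_mul (L2Tendsto.const (ev (divPoly τ))) h.memLp mf
    (fun _ => memLp_of_continuous (continuous_ev _)) (memLp_of_continuous (continuous_ev _))
  have h3 : Tendsto (fun n => T.boundaryFlux (φ n) τ) atTop (𝓝 (T.boundaryFlux γ τ)) := by
    refine tendsto_finsetSum _ fun i _ => Tendsto.const_mul _ ?_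
    have hm : MemLp (fun s => inner ℝ (evVec τ (T.edgePt i s)) (T.normal i)) 2 edgeVol :=
      memLp_edge_of_continuousOn (by fun_prop)
    have := (h.edge i).integral_mul (L2Tendsto.const _) (fun n => h.memLp_edge n i) (mγ i)
      (fun _ => hm) hm
    simpa only [integral_edgeVol] using this
  refine tendsto_nhds_unique h1 (((h2.neg).add h3).congr fun n => ?_)
  exact (green_vec (h.contDiff n) τ).symm

/-! ### Uniqueness of traces, weak gradients -/

/-- The trace inequality passes to the limit; applied to differences this gives uniqueness of
traces. -/
lemma Approx.trace_eq_zero (h : T.Approx φ f g γ) (hf : f =ᵐ[T.vol] 0) (hg : g =ᵐ[T.vol] 0)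
    (mγ : ∀ i, MemLp (fun s => γ (T.edgePt i s)) 2 edgeVol) (i : Fin T.numEdges) :
    (fun s => γ (T.edgePt i s)) =ᵐ[edgeVol] 0 := by
  obtain ⟨C, hC⟩ := T.exists_trace_le
  have h' := h.congr hf hg fun i => EventuallyEq.rfl
  have h1 := h'.fn.integral_sq h.memLp MemLp.zero
  have h2 := h'.grad.integral_norm_sq h.memLp_grad MemLp.zero
  have h3 := (h.edge i).integral_sq (fun n => h.memLp_edge n i) (mγ i)
  have h4 := le_of_tendsto_of_tendsto' h3 ((h1.add h2).const_mul C) fun n => by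
    rw [integral_edgeVol]
    exact hC (φ n) (h.contDiff n) i
  have h5 : ∫ s, γ (T.edgePt i s) ^ 2 ∂edgeVol = 0 := by
    refine le_antisymm (h4.trans (by simp)) (integral_nonneg fun s => sq_nonneg _)
  rw [integral_eq_zero_iff_of_nonneg (fun s => sq_nonneg _) (mγ i).integrable_sq] at h5
  filter_upwards [h5] with s hs
  exact pow_eq_zero_iff two_ne_zero |>.1 hs

lemma IsTest.contDiff {ψ : Plane → ℝ} (h : T.IsTest ψ) : ContDiff ℝ 1 ψ :=
  h.1.of_le (by exact_mod_cast le_top)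

lemma IsTest.eq_zero_of_notMem {ψ : Plane → ℝ} (h : T.IsTest ψ) {x : Plane}
    (hx : x ∉ T.carrier) : ψ x = 0 := image_eq_zero_of_notMem_tsupport fun hx' => hx (h.2.2 hx')

lemma IsTest.eq_zero {ψ : Plane → ℝ} (h : T.IsTest ψ) {x : Plane} (hx : x ∈ frontier T.carrier) :
    ψ x = 0 := h.eq_zero_of_notMem (notMem_of_mem_frontier hx)

lemma integral_fderiv_mul_test {φ ψ : Plane → ℝ} (hφ : ContDiff ℝ 1 φ) (hψ : T.IsTest ψ)
    (e : Plane) : ∫ x in T.carrier, φ x * fderiv ℝ ψ x e =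
      -∫ x in T.carrier, ψ x * fderiv ℝ φ x e := by
  have h := green (T := T) (hφ.mul hψ.contDiff) e
  have c1 : Continuous fun x => φ x * fderiv ℝ ψ x e :=
    hφ.continuous.mul (continuous_fderiv_apply' hψ.contDiff continuous_id continuous_const)
  have c2 : Continuous fun x => ψ x * fderiv ℝ φ x e :=
    hψ.1.continuous.mul (continuous_fderiv_apply' hφ continuous_id continuous_const)
  have hd : ∀ x, fderiv ℝ (fun x => φ x * ψ x) x e = φ x * fderiv ℝ ψ x e + ψ x * fderiv ℝ φ x e := by
    intro x
    rw [fderiv_fun_mul ((hφ.differentiable (by simp)) x)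
      ((hψ.contDiff.differentiable (by simp)) x)]
    simp
  have hb : ∀ i, ∫ s in (0 : ℝ)..1, φ (T.edgePt i s) * ψ (T.edgePt i s) = 0 := by
    intro i
    rw [intervalIntegral.integral_congr (g := fun _ => 0), intervalIntegral.integral_zero]
    intro s hs
    rw [Set.uIcc_of_le zero_le_one] at hs
    simp [hψ.eq_zero (edgePt_mem_frontier i hs)]
  simp only [hb, mul_zero, Finset.sum_const_zero] at h
  rw [eq_neg_iff_add_eq_zero, ← integral_add (integrableOn_of_continuous c1)
    (integrableOn_of_continuous c2), ← h]
  exact integral_congr_ae (Eventually.of_forall fun x => (hd x).symm)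

/-- Integration by parts against a test function has no boundary term, so it survives the limit.
Pairing with a fixed vector e reduces the vector identity to scalar ones. This is how elements of
`H1` are built in the surjectivity proof. -/
lemma Approx.isWeakGrad (h : T.Approx φ f g γ) (mf : MemLp f 2 T.vol) (mg : MemLp g 2 T.vol) :
    T.IsWeakGrad f g := by
  intro ψ hψ
  have mψ : MemLp ψ 2 T.vol := memLp_of_continuous hψ.1.continuous
  have mdψ : MemLp (gradient ψ) 2 T.vol := memLp_of_continuous (continuous_gradient hψ.contDiff)
  have i1 : Integrable (fun x => f x • gradient ψ x) T.vol :=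
    memLp_one_iff_integrable.1 (mdψ.smul mf)
  have i2 : Integrable (fun x => ψ x • g x) T.vol := memLp_one_iff_integrable.1 (mg.smul mψ)
  refine ext_inner_left ℝ fun e => ?_
  rw [inner_neg_right, ← integral_inner i1, ← integral_inner i2]
  simp only [inner_smul_right]
  have me : ∀ {u : Plane → Plane}, MemLp u 2 T.vol → MemLp (fun x => inner ℝ e (u x)) 2 T.vol :=
    fun hu => hu.const_inner e
  have h1 := h.fn.integral_mul (L2Tendsto.const (fun x => inner ℝ e (gradient ψ x))) h.memLp mf
    (fun _ => me mdψ) (me mdψ)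
  have mψe : MemLp (fun x => ψ x • e) 2 T.vol :=
    memLp_of_continuous (hψ.1.continuous.smul continuous_const)
  have h2 := (L2Tendsto.const (fun x => ψ x • e)).integral_inner h.grad (fun _ => mψe) mψe
    h.memLp_grad mg
  simp only [real_inner_smul_left] at h2
  refine tendsto_nhds_unique h1 (h2.neg.congr fun n => ?_)
  simp only [← real_inner_comm e, inner_gradient_left]
  exact (integral_fderiv_mul_test (h.contDiff n) hψ e).symm

end Approx

end PolygonalElement

namespace PolygonalElement

variable {T : PolygonalElement}

/-! ### Projections onto polynomials -/

lemma memLp_ev (p : MvPolynomial (Fin 2) ℝ) : MemLp (ev p) 2 T.vol :=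
  memLp_of_continuous (continuous_ev p)

lemma memLp_evVec (τ : Fin 2 → MvPolynomial (Fin 2) ℝ) : MemLp (evVec τ) 2 T.vol :=
  memLp_of_continuous (continuous_evVec τ)

/-- The pairing of an `L²` function with polynomials. -/
noncomputable def pairing {f : Plane → ℝ} (hf : MemLp f 2 T.vol) (l : ℤ) : Poly l →ₗ[ℝ] ℝ where
  toFun q := ∫ x in T.carrier, f x * ev q x
  map_add' q q' := by
    rw [← integral_add (memLp_integrable_mul hf (memLp_ev _))
      (memLp_integrable_mul hf (memLp_ev _))]
    simp [mul_add]
  map_smul' c q := by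
    rw [RingHom.id_apply, smul_eq_mul, ← integral_const_mul]
    congr 1 with x
    simp
    ring

/-- The weighted inner product of polynomials on the element. -/
noncomputable def mass (T : PolygonalElement) {b : Plane → ℝ} (hb : Continuous b) (l : ℤ) :
    Poly l →ₗ[ℝ] Poly l →ₗ[ℝ] ℝ where
  toFun p := pairing (T := T) (f := fun x => b x * ev p x)
    (memLp_of_continuous (hb.mul (continuous_ev _))) l
  map_add' p p' := by
    ext q
    simp only [pairing, LinearMap.coe_mk, AddHom.coe_mk, LinearMap.add_apply]
    rw [← integral_add (integrableOn_of_continuous (by fun_prop))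
      (integrableOn_of_continuous (by fun_prop))]
    simp [mul_add, add_mul]
  map_smul' c p := by
    ext q
    simp only [pairing, LinearMap.coe_mk, AddHom.coe_mk, LinearMap.smul_apply, RingHom.id_apply,
      smul_eq_mul]
    rw [← integral_const_mul]
    congr 1 with x
    simp
    ring

lemma mass_apply {b : Plane → ℝ} (hb : Continuous b) (l : ℤ) (p q : Poly l) :
    T.mass hb l p q = ∫ x in T.carrier, b x * ev p x * ev q x := rfl

lemma eqOn_zero_of_integral {f : Plane → ℝ} (hf : Continuous f) (h0 : ∀ x, 0 ≤ f x)
    (h : ∫ x in T.carrier, f x = 0) : ∀ x ∈ T.carrier, f x = 0 := by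
  rw [integral_eq_zero_iff_of_nonneg h0 (integrableOn_of_continuous hf)] at h
  exact Measure.eqOn_open_of_ae_eq h T.isOpen_carrier hf.continuousOn continuousOn_const

/-- Positivity of the weight on one nonempty open set suffices, since polynomials are determined
there. This permits compactly supported weights, with which moments can be corrected without
touching the boundary. -/
lemma mass_definite {b : Plane → ℝ} (hb : Continuous b) (hb0 : ∀ x, 0 ≤ b x) {U : Set Plane}
    (hU : IsOpen U) (hUT : U ⊆ T.carrier) (hUne : U.Nonempty) (hbU : ∀ x ∈ U, 0 < b x) (l : ℤ)
    (p : Poly l) (h : T.mass hb l p p = 0) : p = 0 := by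
  refine Subtype.ext (eq_zero_of_ev_eq_zero hU hUne fun x hx => ?_)
  have h1 : ∀ x, b x * ev p x * ev p x = b x * ev p x ^ 2 := fun x => by ring
  rw [mass_apply] at h
  simp only [h1] at h
  have := eqOn_zero_of_integral (by fun_prop) (fun x => mul_nonneg (hb0 x) (sq_nonneg _)) h x (hUT hx)
  rcases mul_eq_zero.1 this with h2 | h2
  · exact absurd h2 (hbU x hx).ne'
  · exact pow_eq_zero_iff two_ne_zero |>.1 h2

lemma poly_eq_zero {l : ℤ} (p : Poly l) (h : ∫ x in T.carrier, ev p x * ev p x = 0) : p = 0 :=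
  mass_definite (T := T) (b := fun _ => 1) continuous_const (fun _ => zero_le_one) T.isOpen_carrier
    subset_rfl ⟨_, T.center_mem⟩ (fun _ _ => one_pos) l p (by simpa [mass_apply] using h)

lemma integral_sub_mul_ev {f : Plane → ℝ} (hf : MemLp f 2 T.vol) (p q : MvPolynomial (Fin 2) ℝ) :
    ∫ x in T.carrier, (f x - ev p x) * ev q x =
      (∫ x in T.carrier, f x * ev q x) - ∫ x in T.carrier, ev p x * ev q x := by
  rw [← integral_sub (memLp_integrable_mul hf (memLp_ev _))
    (memLp_integrable_mul (memLp_ev _) (memLp_ev _))]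
  simp only [sub_mul]

/-- Square integrability makes the projection problem solvable, so the default value in `proj` is
not taken. -/
lemma proj_spec {f : Plane → ℝ} (hf : MemLp f 2 T.vol) {l : ℤ} {q : MvPolynomial (Fin 2) ℝ}
    (hq : q ∈ Poly l) :
    ∫ x in T.carrier, ev (T.proj l f) x * ev q x = ∫ x in T.carrier, f x * ev q x := by
  have h : ∃ p : Poly l, ∀ q : Poly l,
      ∫ x in T.carrier, (f x - ev (p : MvPolynomial (Fin 2) ℝ) x) * ev q x = 0 := by
    obtain ⟨p, hp⟩ := exists_represents (T.mass (b := fun _ => 1) continuous_const l)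
      (fun w hw => poly_eq_zero w (by simpa [mass_apply] using hw w)) (pairing hf l)
    refine ⟨p, fun q => ?_⟩
    rw [integral_sub_mul_ev hf, sub_eq_zero]
    have := hp q
    simp only [mass_apply, one_mul] at this
    exact this.symm
  have h1 := h.choose_spec ⟨q, hq⟩
  rw [integral_sub_mul_ev hf, sub_eq_zero] at h1
  rw [proj, dif_pos h]
  exact h1.symm

lemma proj_eq {f : Plane → ℝ} (hf : MemLp f 2 T.vol) {l : ℤ} {p : Poly l}
    (h : ∀ q : Poly l, ∫ x in T.carrier, ev p x * ev q x = ∫ x in T.carrier, f x * ev q x) :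
    T.proj l f = p := by
  rw [← sub_eq_zero]
  refine poly_eq_zero (T := T) _ ?_
  have h1 := proj_spec hf (T.proj l f - p : Poly l).2
  rw [← h, ← sub_eq_zero, ← integral_sub_mul_ev (memLp_ev _)] at h1
  simpa using h1

/-- The `L²` pairing of vector-valued polynomials. -/
noncomputable def vecPairing {f : Plane → Plane} (hf : MemLp f 2 T.vol) (l : ℤ) :
    VecPoly l →ₗ[ℝ] ℝ where
  toFun τ := ∫ x in T.carrier, inner ℝ (f x) (evVec τ x)
  map_add' q q' := by
    rw [← integral_add (memLp_integrable_inner hf (memLp_evVec _))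
      (memLp_integrable_inner hf (memLp_evVec _))]
    simp [inner_add_right]
  map_smul' c q := by
    rw [RingHom.id_apply, smul_eq_mul, ← integral_const_mul]
    congr 1 with x
    simp [inner_smul_right]

noncomputable def vecMass (T : PolygonalElement) (l : ℤ) :
    VecPoly l →ₗ[ℝ] VecPoly l →ₗ[ℝ] ℝ where
  toFun p := vecPairing (T := T) (f := evVec p) (memLp_evVec _) l
  map_add' p p' := by
    ext q
    simp only [vecPairing, LinearMap.coe_mk, AddHom.coe_mk, LinearMap.add_apply]
    rw [← integral_add (integrableOn_of_continuous (by fun_prop))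
      (integrableOn_of_continuous (by fun_prop))]
    simp [inner_add_left]
  map_smul' c p := by
    ext q
    simp only [vecPairing, LinearMap.coe_mk, AddHom.coe_mk, LinearMap.smul_apply, RingHom.id_apply,
      smul_eq_mul]
    rw [← integral_const_mul]
    congr 1 with x
    simp [real_inner_smul_left]

lemma vecPoly_eq_zero {l : ℤ} (p : VecPoly l)
    (h : ∫ x in T.carrier, inner ℝ (evVec p x) (evVec p x) = 0) : p = 0 := by
  have h1 := eqOn_zero_of_integral (by fun_prop) (fun x => real_inner_self_nonneg) h
  ext1
  funext j
  refine eq_zero_of_ev_eq_zero T.isOpen_carrier ⟨_, T.center_mem⟩ fun x hx => ?_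
  have h2 := inner_self_eq_zero.1 (h1 x hx)
  exact congrFun (congrArg WithLp.ofLp h2) j

lemma integral_inner_sub {f : Plane → Plane} (hf : MemLp f 2 T.vol)
    (p q : Fin 2 → MvPolynomial (Fin 2) ℝ) :
    ∫ x in T.carrier, inner ℝ (f x - evVec p x) (evVec q x) =
      (∫ x in T.carrier, inner ℝ (f x) (evVec q x)) -
        ∫ x in T.carrier, inner ℝ (evVec p x) (evVec q x) := by
  rw [← integral_sub (memLp_integrable_inner hf (memLp_evVec _))
    (memLp_integrable_inner (memLp_evVec _) (memLp_evVec _))]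
  simp only [inner_sub_left]

lemma vecPoly_unique {l : ℤ} {G G' : VecPoly l}
    (h : ∀ τ : VecPoly l, ∫ x in T.carrier, inner ℝ (evVec G x) (evVec τ x) =
      ∫ x in T.carrier, inner ℝ (evVec G' x) (evVec τ x)) : G = G' := by
  rw [← sub_eq_zero]
  refine vecPoly_eq_zero (T := T) _ ?_
  have h1 := h (G - G')
  rw [← sub_eq_zero, ← integral_inner_sub (memLp_evVec _)] at h1
  simpa using h1

lemma exists_vecPoly {l : ℤ} (L : VecPoly l →ₗ[ℝ] ℝ) : ∃ G : VecPoly l, ∀ τ : VecPoly l,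
    ∫ x in T.carrier, inner ℝ (evVec G x) (evVec τ x) = L τ :=
  exists_represents (T.vecMass l) (fun w hw => vecPoly_eq_zero (T := T) w (hw w)) L

lemma vecProj_spec {f : Plane → Plane} (hf : MemLp f 2 T.vol) {l : ℤ}
    {τ : Fin 2 → MvPolynomial (Fin 2) ℝ} (hτ : τ ∈ VecPoly l) :
    ∫ x in T.carrier, inner ℝ (evVec (T.vecProj l f) x) (evVec τ x) =
      ∫ x in T.carrier, inner ℝ (f x) (evVec τ x) := by
  have h : ∃ p : VecPoly l, ∀ τ : VecPoly l, ∫ x in T.carrier,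
      inner ℝ (f x - evVec (p : Fin 2 → MvPolynomial (Fin 2) ℝ) x) (evVec τ x) = 0 := by
    obtain ⟨p, hp⟩ := exists_vecPoly (T := T) (vecPairing hf l)
    refine ⟨p, fun q => ?_⟩
    rw [integral_inner_sub hf, sub_eq_zero]
    exact (hp q).symm
  have h1 := h.choose_spec ⟨τ, hτ⟩
  rw [integral_inner_sub hf, sub_eq_zero] at h1
  rw [vecProj, dif_pos h]
  exact h1.symm

/-! ### Continuity of traces at the vertices -/

/-- Edges are oriented arbitrarily, so a common vertex may be the end of one parametrization and the
start of another. -/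
lemma tendsto_edgeVol_reverse {F : ℕ → ℝ → ℝ} {f : ℝ → ℝ} (h : L2Tendsto edgeVol F f)
    (mF : ∀ n, AEStronglyMeasurable (F n) edgeVol) (mf : AEStronglyMeasurable f edgeVol) :
    L2Tendsto edgeVol (fun n r => F n (1 - r)) fun r => f (1 - r) := by
  have hp : MeasurePreserving (fun r : ℝ => 1 - r) edgeVol edgeVol := by
    have h1 := (Measure.measurePreserving_sub_left (volume : Measure ℝ) (1 : ℝ)).restrict_preimage
      (measurableSet_Icc (a := (0 : ℝ)) (b := 1))
    have h2 : (fun r : ℝ => 1 - r) ⁻¹' Set.Icc 0 1 = Set.Icc 0 1 := by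
      ext r
      simp only [Set.mem_preimage, Set.mem_Icc]
      constructor <;> rintro ⟨_, _⟩ <;> constructor <;> linarith
    rwa [h2] at h1
  refine h.congr fun n => ?_
  exact (eLpNorm_comp_measurePreserving ((mF n).sub mf) hp).symm

/-- A polynomial-like jump cannot be square integrable against `dr / r`. -/
lemma eq_zero_of_log_bound {h : ℝ → ℝ} (hc : Continuous h) {C : ℝ}
    (hC : ∀ δ : ℝ, 0 < δ → δ ≤ 1 → ∫ r in δ..1, r⁻¹ * h r ^ 2 ≤ C) : h 0 = 0 := by
  by_contra hne
  set η := h 0 ^ 2 / 2 with hη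
  have hη0 : 0 < η := by positivity
  obtain ⟨r0, hr0, hr1, hlow⟩ : ∃ r0 : ℝ, 0 < r0 ∧ r0 ≤ 1 ∧ ∀ r ∈ Set.Icc 0 r0, η ≤ h r ^ 2 := by
    have : ∀ᶠ r in 𝓝 (0 : ℝ), η < h r ^ 2 :=
      ((hc.pow 2).tendsto 0).eventually (lt_mem_nhds (by
        have : 0 < h 0 ^ 2 := by positivity
        simp only [hη, Pi.pow_apply]
        linarith))
    obtain ⟨ε, hε, hb⟩ := Metric.eventually_nhds_iff.1 this
    refine ⟨min (ε / 2) 1, by positivity, min_le_right _ _, fun r hr => (hb ?_).le⟩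
    rw [Real.dist_eq, sub_zero, abs_of_nonneg hr.1]
    linarith [hr.2, min_le_left (ε / 2) 1]
  -- Near 0 the integrand is at least η / r, and δ = r0 exp(-M) is chosen so that η log(r0 / δ) =
  -- |C| + 1 exceeds the assumed bound.
  set M := (|C| + 1) / η with hM
  have hM0 : 0 < M := by positivity
  let δ := r0 * Real.exp (-M)
  have hδ0 : 0 < δ := by positivity
  have hδr : δ ≤ r0 := mul_le_of_le_one_right hr0.le (Real.exp_le_one_iff.2 (by linarith))
  have hint : ∀ {u v : ℝ}, 0 < u → u ≤ v → IntervalIntegrable (fun r => r⁻¹ * h r ^ 2) volume u v := by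
    intro u v hu huv
    refine ContinuousOn.intervalIntegrable (ContinuousOn.mul ?_ (by fun_prop))
    rw [Set.uIcc_of_le huv]
    exact continuousOn_inv₀.mono fun r hr => (hu.trans_le hr.1).ne'
  have hint' : IntervalIntegrable (fun r : ℝ => η * r⁻¹) volume δ r0 := by
    refine ContinuousOn.intervalIntegrable (ContinuousOn.mul (by fun_prop) ?_)
    rw [Set.uIcc_of_le hδr]
    exact continuousOn_inv₀.mono fun r hr => (hδ0.trans_le hr.1).ne'
  have h1 : ∫ r in δ..r0, η * r⁻¹ = |C| + 1 := by
    rw [intervalIntegral.integral_const_mul, integral_inv_of_pos hδ0 hr0]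
    have : r0 / δ = Real.exp M := by
      simp only [δ]
      rw [Real.exp_neg]
      field_simp
    rw [this, Real.log_exp, hM]
    field_simp
  have h2 : ∫ r in δ..r0, η * r⁻¹ ≤ ∫ r in δ..r0, r⁻¹ * h r ^ 2 := by
    refine intervalIntegral.integral_mono_on hδr hint' (hint hδ0 hδr) fun r hr => ?_
    rw [mul_comm]
    exact mul_le_mul_of_nonneg_left (hlow r ⟨hδ0.le.trans hr.1, hr.2⟩)
      (inv_nonneg.2 (hδ0.le.trans hr.1))
  have h3 : ∫ r in δ..r0, r⁻¹ * h r ^ 2 ≤ ∫ r in δ..1, r⁻¹ * h r ^ 2 := by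
    rw [← intervalIntegral.integral_add_adjacent_intervals (hint hδ0 hδr) (hint hr0 hr1)]
    have : 0 ≤ ∫ r in r0..1, r⁻¹ * h r ^ 2 :=
      intervalIntegral.integral_nonneg hr1 fun r hr =>
        mul_nonneg (inv_nonneg.2 (hr0.le.trans hr.1)) (sq_nonneg _)
    linarith
  have h4 := hC δ hδ0 (hδr.trans hr1)
  linarith [le_abs_self C]

section

variable {φ : ℕ → Plane → ℝ} {f : Plane → ℝ} {g : Plane → Plane} {γ : Plane → ℝ}

/-- The corner estimate holds for the smooth approximations with a constant independent of δ. Its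
limit bounds the integral of (e - e')² / r over [δ, 1] uniformly, and the divergence of ∫ dr / r
forces e and e' to agree at the vertex. -/
lemma Approx.corner (h : T.Approx φ f g γ) (mg : MemLp g 2 T.vol) {i j : Fin T.numEdges}
    {z o o' : Plane} (hi : T.IsEnds i z o) (hj : T.IsEnds j z o') {e e' : ℝ → ℝ}
    (he : Continuous e) (he' : Continuous e')
    (hte : L2Tendsto edgeVol (fun n r => φ n (AffineMap.lineMap z o r)) e)
    (hte' : L2Tendsto edgeVol (fun n r => φ n (AffineMap.lineMap z o' r)) e') : e 0 = e' 0 := by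
  obtain ⟨C, hC⟩ := exists_corner_le hi hj
  rw [← sub_eq_zero]
  refine eq_zero_of_log_bound (h := fun r => e r - e' r) (C := C * ∫ x in T.carrier, ‖g x‖ ^ 2)
    (by fun_prop) fun δ hδ hδ1 => ?_
  have hφc := fun n => h.continuous n
  have hle : volume.restrict (Set.Ioc δ 1) ≤ edgeVol :=
    Measure.restrict_mono (Set.Ioc_subset_Icc_self.trans (Set.Icc_subset_Icc_left hδ.le)) le_rfl
  have memc : ∀ {u : ℝ → ℝ}, Continuous u → MemLp u 2 (volume.restrict (Set.Ioc δ 1)) :=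
    fun hu => (memLp_edge_of_continuousOn hu.continuousOn).mono_measure hle
  have hψ : L2Tendsto (volume.restrict (Set.Ioc δ 1)) (fun n r => φ n (AffineMap.lineMap z o r) -
      φ n (AffineMap.lineMap z o' r)) (fun r => e r - e' r) :=
    (hte.sub hte'
      (fun n => (Continuous.aestronglyMeasurable (by have := hφc n; fun_prop)))
      he.aestronglyMeasurable
      (fun n => (Continuous.aestronglyMeasurable (by have := hφc n; fun_prop)))
      he'.aestronglyMeasurable).mono_measure hle
  -- Away from the vertex the weight 1 / r is bounded, so L² convergence suffices to pass to the
  -- limit for fixed δ.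
  have hw : ∀ᵐ r ∂(volume.restrict (Set.Ioc δ 1)), |r⁻¹| ≤ δ⁻¹ :=
    ae_restrict_of_forall_mem measurableSet_Ioc fun r hr => by
      rw [abs_of_pos (inv_pos.2 (hδ.trans hr.1))]
      exact inv_anti₀ hδ hr.1.le
  have hwm : AEStronglyMeasurable (fun r : ℝ => r⁻¹) (volume.restrict (Set.Ioc δ 1)) :=
    measurable_inv.aestronglyMeasurable
  have mψ : ∀ n, MemLp (fun r : ℝ => φ n (AffineMap.lineMap z o r) -
      φ n (AffineMap.lineMap z o' r)) 2 (volume.restrict (Set.Ioc δ 1)) :=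
    fun n => memc (by have := hφc n; fun_prop)
  have me : MemLp (fun r => e r - e' r) 2 (volume.restrict (Set.Ioc δ 1)) :=
    memc (he.sub he')
  have h1 := (hψ.smul_bdd hw).integral_mul hψ (fun n => MemLp_smul_bdd (mψ n) hwm hw)
    (MemLp_smul_bdd me hwm hw) mψ me
  have h2 := (h.grad.integral_norm_sq h.memLp_grad mg).const_mul C
  have h3 := le_of_tendsto_of_tendsto' h1 h2 fun n => by
    have := hC (φ n) (h.contDiff n) δ hδ hδ1
    rw [intervalIntegral.integral_of_le hδ1] at this
    simpa only [sq, smul_eq_mul, mul_assoc, energy] using this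
  rw [intervalIntegral.integral_of_le hδ1]
  simpa only [sq, smul_eq_mul, mul_assoc] using h3

lemma Approx.exists_end (h : T.Approx φ f g γ) {i : Fin T.numEdges} {q : ℝ → ℝ}
    (hq : Continuous q) (hγ : (fun s => γ (T.edgePt i s)) =ᵐ[edgeVol] q) {s : ℝ}
    (hs : s = 0 ∨ s = 1) : ∃ o, T.IsEnds i (T.edgePt i s) o ∧ ∃ e : ℝ → ℝ, Continuous e ∧
      e 0 = q s ∧ L2Tendsto edgeVol
        (fun n r => φ n (AffineMap.lineMap (T.edgePt i s) o r)) e := by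
  have h1 : L2Tendsto edgeVol (fun n s => φ n (T.edgePt i s)) q := (h.edge i).congr_limit hγ
  rcases hs with rfl | rfl
  · refine ⟨T.b i, Or.inl ⟨edgePt_zero i, rfl⟩, q, hq, rfl, ?_⟩
    rw [edgePt_zero]
    exact h1
  · refine ⟨T.a i, Or.inr ⟨edgePt_one i, rfl⟩, fun r => q (1 - r), by fun_prop, by simp, ?_⟩
    have h2 := tendsto_edgeVol_reverse h1 (fun n => (h.memLp_edge n i).1) hq.aestronglyMeasurable
    simpa only [edgePt, AffineMap.lineMap_apply_one_sub, AffineMap.lineMap_apply_one] using h2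

lemma eq_zero_or_one {i j : Fin T.numEdges} {s t : ℝ} (hs : s ∈ Set.Icc (0 : ℝ) 1)
    (ht : t ∈ Set.Icc (0 : ℝ) 1) (hij : i ≠ j) (h : T.edgePt i s = T.edgePt j t) :
    s = 0 ∨ s = 1 := by
  by_contra! hne
  refine hij (eq_of_mem_openSegment (z := T.edgePt i s) ?_ ?_)
  · rw [openSegment_eq]
    exact Set.mem_image_of_mem _ ⟨hs.1.lt_of_ne' hne.1, hs.2.lt_of_ne hne.2⟩
  · rw [h, segment_eq]
    exact Set.mem_image_of_mem _ ht

/-- Edge functions that agree at common points. -/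
def Compatible (T : PolygonalElement) (q : Fin T.numEdges → ℝ → ℝ) : Prop :=
  ∀ i j, ∀ s ∈ Set.Icc (0 : ℝ) 1, ∀ t ∈ Set.Icc (0 : ℝ) 1, T.edgePt i s = T.edgePt j t → q i s = q j t

/-- An `H¹` function whose trace is continuous on each edge has a continuous trace. -/
lemma Approx.compatible (h : T.Approx φ f g γ) (mg : MemLp g 2 T.vol)
    {q : Fin T.numEdges → ℝ → ℝ} (hq : ∀ i, Continuous (q i))
    (hγ : ∀ i, (fun s => γ (T.edgePt i s)) =ᵐ[edgeVol] q i) : T.Compatible q := by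
  intro i j s hs t ht hst
  by_cases hij : i = j
  · subst hij
    rw [edgePt_injective i hst]
  obtain ⟨o, hi, e, he, he0, hte⟩ := h.exists_end (hq i) (hγ i) (eq_zero_or_one hs ht hij hst)
  obtain ⟨o', hj, e', he', he0', hte'⟩ := h.exists_end (hq j) (hγ j)
    (eq_zero_or_one ht hs (Ne.symm hij) hst.symm)
  rw [← hst] at hj hte'
  rw [← he0, ← he0']
  exact h.corner mg hi hj he he' hte hte'

end

/-- Gluing of compatible edge functions. -/
lemma Compatible.exists_glue {q : Fin T.numEdges → ℝ → ℝ} (h : T.Compatible q)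
    (hq : ∀ i, Continuous (q i)) : ∃ g : Plane → ℝ, ContinuousOn g (frontier T.carrier) ∧
      ∀ i, ∀ s ∈ Set.Icc (0 : ℝ) 1, g (T.edgePt i s) = q i s := by
  classical
  obtain ⟨g, hg⟩ : ∃ g : Plane → ℝ, ∀ i, ∀ s ∈ Set.Icc (0 : ℝ) 1, g (T.edgePt i s) = q i s := by
    refine ⟨fun x => if hx : ∃ p : Fin T.numEdges × ℝ, p.2 ∈ Set.Icc (0 : ℝ) 1 ∧
      T.edgePt p.1 p.2 = x then q hx.choose.1 hx.choose.2 else 0, fun i s hs => ?_⟩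
    have hx : ∃ p : Fin T.numEdges × ℝ, p.2 ∈ Set.Icc (0 : ℝ) 1 ∧
        T.edgePt p.1 p.2 = T.edgePt i s := ⟨(i, s), hs, rfl⟩
    refine (dif_pos hx).trans ?_
    -- Compatibility makes the value independent of the chosen edge and parameter.
    exact h _ _ _ hx.choose_spec.1 _ hs hx.choose_spec.2
  refine ⟨g, ?_, hg⟩
  rw [T.frontier_eq]
  refine (locallyFinite_of_finite _).continuousOn_iUnion (fun i => ?_) fun i => ?_
  · rw [segment_eq]
    exact (isCompact_Icc.image (continuous_edgePt i)).isClosed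
  · rw [segment_eq]
    have he : ‖T.b i - T.a i‖ ^ 2 ≠ 0 := by
      simpa using sub_ne_zero.2 (T.a_ne_b i).symm
    -- On its own edge the glued function is q composed with the orthogonal projection onto the edge
    -- line, a continuous inverse of the parametrization.
    have hcont : Continuous fun x : Plane =>
        q i (inner ℝ (T.b i - T.a i) (x - T.a i) / ‖T.b i - T.a i‖ ^ 2) := by
      have := hq i
      fun_prop
    refine hcont.continuousOn.congr ?_
    rintro _ ⟨s, hs, rfl⟩
    dsimp only
    rw [hg i s hs, edgePt_eq, add_sub_cancel_left, inner_smul_right, real_inner_self_eq_norm_sq,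
      mul_div_cancel_right₀ _ he]

end PolygonalElement

namespace PolygonalElement

variable {T : PolygonalElement} {k : ℕ}

/-! ### The continuous trace -/

lemma memLp_edge_of_continuousOn_frontier {g : Plane → ℝ} (hg : ContinuousOn g (frontier T.carrier))
    (i : Fin T.numEdges) : MemLp (fun s => g (T.edgePt i s)) 2 edgeVol :=
  memLp_edge_of_continuousOn (hg.comp (continuous_edgePt i).continuousOn fun _ hs =>
    edgePt_mem_frontier i hs)

lemma continuousOn_edge {g : Plane → ℝ} (hg : ContinuousOn g (frontier T.carrier))
    (i : Fin T.numEdges) : ContinuousOn (fun s => g (T.edgePt i s)) (Set.Icc 0 1) :=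
  hg.comp (continuous_edgePt i).continuousOn fun _ hs => edgePt_mem_frontier i hs

lemma eqOn_Icc_of_ae_eq {u v : ℝ → ℝ} (hu : ContinuousOn u (Set.Icc 0 1))
    (hv : ContinuousOn v (Set.Icc 0 1)) (h : u =ᵐ[edgeVol] v) : Set.EqOn u v (Set.Icc 0 1) :=
  Measure.eqOn_Icc_of_ae_eq volume zero_ne_one h hu hv

lemma eqOn_frontier {u v : Plane → ℝ}
    (h : ∀ i, ∀ s ∈ Set.Icc (0 : ℝ) 1, u (T.edgePt i s) = v (T.edgePt i s)) :
    Set.EqOn u v (frontier T.carrier) := by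
  intro x hx
  obtain ⟨i, s, hs, rfl⟩ := exists_edgePt hx
  exact h i s hs

lemma IsContTrace.eqOn {v : T.H1} {g g' : Plane → ℝ} (h : T.IsContTrace v g)
    (h' : T.IsContTrace v g') : Set.EqOn g g' (frontier T.carrier) := by
  obtain ⟨φ, hφ⟩ := hasTrace_iff.1 h.2
  obtain ⟨ψ, hψ⟩ := hasTrace_iff.1 h'.2
  have mγ := fun i => memLp_edge_of_continuousOn_frontier h.1 i
  have mγ' := fun i => memLp_edge_of_continuousOn_frontier h'.1 i
  have hs := hφ.sub hψ v.memLp_fn v.memLp_fn v.memLp_grad v.memLp_grad mγ mγ'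
  refine eqOn_frontier fun i => eqOn_Icc_of_ae_eq (continuousOn_edge h.1 i)
    (continuousOn_edge h'.1 i) ?_
  filter_upwards [hs.trace_eq_zero (Eventually.of_forall fun x => sub_self _)
    (Eventually.of_forall fun x => sub_self _) (fun i => (mγ i).sub (mγ' i)) i] with s hs
  exact sub_eq_zero.1 hs

lemma IsContTrace.trace {v : T.H1} {g : Plane → ℝ} (h : T.IsContTrace v g) :
    T.IsContTrace v (T.trace v) := by
  have h' : ∃ g : Plane → ℝ, T.IsContTrace v g := ⟨g, h⟩
  rw [PolygonalElement.trace, dif_pos h']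
  exact h'.choose_spec

lemma IsContTrace.congr {v : T.H1} {g g' : Plane → ℝ} (h : T.IsContTrace v g)
    (hg : Set.EqOn g' g (frontier T.carrier)) : T.IsContTrace v g' := by
  refine ⟨h.1.congr hg, ?_⟩
  obtain ⟨φ, hφ⟩ := hasTrace_iff.1 h.2
  refine hasTrace_iff.2 ⟨φ, hφ.congr EventuallyEq.rfl EventuallyEq.rfl fun i => ?_⟩
  exact (ae_restrict_of_forall_mem measurableSet_Icc fun s hs => (hg (edgePt_mem_frontier i hs)).symm)

/-- Functions with edgewise polynomial trace have a continuous trace. -/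
lemma trace_spec {v : T.H1} (hv : ∃ g : Plane → ℝ, T.HasTrace v g ∧
    ∀ i, ∃ q ∈ EdgePoly ((k : ℤ) + 1),
      ∀ᵐ s ∂(volume.restrict (Set.Icc (0 : ℝ) 1)), g (T.edgePt i s) = q.eval s) :
    T.IsContTrace v (T.trace v) ∧ ∃ q : Fin T.numEdges → EdgePoly ((k : ℤ) + 1),
      ∀ i, ∀ s ∈ Set.Icc (0 : ℝ) 1, T.trace v (T.edgePt i s) = (q i : Polynomial ℝ).eval s := by
  obtain ⟨g, hg, hq⟩ := hv
  choose q hqm hq using hq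
  obtain ⟨φ, hφ⟩ := hasTrace_iff.1 hg
  obtain ⟨G, hG, hGq⟩ := (hφ.compatible v.memLp_grad (q := fun i s => (q i).eval s)
    (fun i => by fun_prop) hq).exists_glue fun i => by fun_prop
  have hGt : T.IsContTrace v G := by
    refine ⟨hG, hasTrace_iff.2 ⟨φ, hφ.congr EventuallyEq.rfl EventuallyEq.rfl fun i => ?_⟩⟩
    filter_upwards [hq i, ae_restrict_mem measurableSet_Icc] with s hs hs'
    rw [hs, hGq i s hs']
  refine ⟨hGt.trace, fun i => ⟨q i, hqm i⟩, fun i s hs => ?_⟩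
  rw [← hGq i s hs]
  exact hGt.trace.eqOn hGt (edgePt_mem_frontier i hs)

/-! ### The reconstructions -/

lemma edgeRec_spec (d : T.DOF k) (i : Fin T.numEdges) :
    edgeProj ((k : ℤ) - 1) (fun s => (edgeRec d i : Polynomial ℝ).eval s) = d.2.1 i ∧
      (edgeRec d i : Polynomial ℝ).eval 0 = d.2.2 ⟨T.a i, T.a_mem i⟩ ∧
      (edgeRec d i : Polynomial ℝ).eval 1 = d.2.2 ⟨T.b i, T.b_mem i⟩ := by
  have h := exists_edgePoly k (d.2.1 i) (d.2.2 ⟨T.a i, T.a_mem i⟩) (d.2.2 ⟨T.b i, T.b_mem i⟩)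
  rw [edgeRec, dif_pos h]
  exact h.choose_spec

lemma edgeRec_eq {d : T.DOF k} {i : Fin T.numEdges} {q : EdgePoly ((k : ℤ) + 1)}
    (h : edgeProj ((k : ℤ) - 1) (fun s => (q : Polynomial ℝ).eval s) = d.2.1 i)
    (h0 : (q : Polynomial ℝ).eval 0 = d.2.2 ⟨T.a i, T.a_mem i⟩)
    (h1 : (q : Polynomial ℝ).eval 1 = d.2.2 ⟨T.b i, T.b_mem i⟩) : edgeRec d i = q := by
  obtain ⟨e, e0, e1⟩ := edgeRec_spec d i
  exact edgePoly_unique (e.trans h.symm) (e0.trans h0.symm) (e1.trans h1.symm)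

lemma edgePt_mem_vertices (i : Fin T.numEdges) {s : ℝ} (hs : s = 0 ∨ s = 1) :
    T.edgePt i s ∈ T.vertices := by
  rcases hs with rfl | rfl
  · rw [edgePt_zero]
    exact T.a_mem i
  · rw [edgePt_one]
    exact T.b_mem i

lemma edgeRec_eval (d : T.DOF k) (i : Fin T.numEdges) {s : ℝ} (hs : s = 0 ∨ s = 1) {x : Plane}
    (hx : x = T.edgePt i s) (hxv : x ∈ T.vertices) :
    (edgeRec d i : Polynomial ℝ).eval s = d.2.2 ⟨x, hxv⟩ := by
  obtain ⟨-, e0, e1⟩ := edgeRec_spec d i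
  subst hx
  rcases hs with rfl | rfl
  · simp only [edgePt_zero]
    exact e0
  · simp only [edgePt_one]
    exact e1

/-- Distinct edges meet only at common endpoints, where both reconstructions take the value stored
for that vertex. -/
lemma compatible_edgeRec (d : T.DOF k) :
    T.Compatible fun i s => (edgeRec d i : Polynomial ℝ).eval s := by
  intro i j s hs t ht hst
  by_cases hij : i = j
  · subst hij
    rw [edgePt_injective i hst]
  · have hs' := eq_zero_or_one hs ht hij hst
    have ht' := eq_zero_or_one ht hs (Ne.symm hij) hst.symm
    show (edgeRec d i : Polynomial ℝ).eval s = (edgeRec d j : Polynomial ℝ).eval t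
    rw [edgeRec_eval d i hs' rfl (edgePt_mem_vertices i hs'),
      edgeRec_eval d j ht' hst (edgePt_mem_vertices i hs')]

lemma traceRec_spec (d : T.DOF k) : ContinuousOn (traceRec d) (frontier T.carrier) ∧
    ∀ i, ∀ s ∈ Set.Icc (0 : ℝ) 1,
      traceRec d (T.edgePt i s) = (edgeRec d i : Polynomial ℝ).eval s := by
  have h := (compatible_edgeRec d).exists_glue fun i => by fun_prop
  rw [traceRec, dif_pos h]
  exact h.choose_spec

lemma boundaryFlux_integrable {g : Plane → ℝ} (hg : ContinuousOn g (frontier T.carrier))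
    (τ : Fin 2 → MvPolynomial (Fin 2) ℝ) (i : Fin T.numEdges) : IntervalIntegrable
      (fun s => g (T.edgePt i s) * inner ℝ (evVec τ (T.edgePt i s)) (T.normal i)) volume 0 1 := by
  refine ContinuousOn.intervalIntegrable ?_
  rw [Set.uIcc_of_le zero_le_one]
  exact (continuousOn_edge hg i).mul (by fun_prop)

lemma boundaryFlux_add {g : Plane → ℝ} (hg : ContinuousOn g (frontier T.carrier))
    (σ τ : Fin 2 → MvPolynomial (Fin 2) ℝ) :
    T.boundaryFlux g (σ + τ) = T.boundaryFlux g σ + T.boundaryFlux g τ := by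
  rw [boundaryFlux, boundaryFlux, boundaryFlux, ← Finset.sum_add_distrib]
  refine Finset.sum_congr rfl fun i _ => ?_
  rw [edgeIntegral, edgeIntegral, edgeIntegral, ← mul_add, ← intervalIntegral.integral_add
    (boundaryFlux_integrable hg σ i) (boundaryFlux_integrable hg τ i)]
  simp only [evVec_add, inner_add_left, mul_add]

lemma boundaryFlux_smul (g : Plane → ℝ) (c : ℝ) (τ : Fin 2 → MvPolynomial (Fin 2) ℝ) :
    T.boundaryFlux g (c • τ) = c * T.boundaryFlux g τ := by
  rw [boundaryFlux, boundaryFlux, Finset.mul_sum]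
  refine Finset.sum_congr rfl fun i _ => ?_
  rw [edgeIntegral, edgeIntegral, mul_left_comm]
  congr 1
  rw [← intervalIntegral.integral_const_mul]
  refine intervalIntegral.integral_congr fun s _ => ?_
  simp only [evVec_smul, real_inner_smul_left]
  ring

lemma divPoly_add (σ τ : Fin 2 → MvPolynomial (Fin 2) ℝ) :
    divPoly (σ + τ) = divPoly σ + divPoly τ := by
  simp only [divPoly, Pi.add_apply, map_add, Finset.sum_add_distrib]

lemma divPoly_smul (c : ℝ) (τ : Fin 2 → MvPolynomial (Fin 2) ℝ) :
    divPoly (c • τ) = c • divPoly τ := by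
  simp only [divPoly, Pi.smul_apply, Derivation.map_smul, Finset.smul_sum]

lemma radial_add (c : Plane) (u w : MvPolynomial (Fin 2) ℝ) :
    radial c (u + w) = radial c u + radial c w := by
  ext1 j
  simp only [radial, Pi.add_apply, mul_add]

lemma radial_smul (c : Plane) (r : ℝ) (w : MvPolynomial (Fin 2) ℝ) :
    radial c (r • w) = r • radial c w := by
  ext1 j
  simp only [radial, Pi.smul_apply, mul_smul_comm]

lemma gradRec_spec (d : T.DOF k) {τ : Fin 2 → MvPolynomial (Fin 2) ℝ} (hτ : τ ∈ VecPoly k) :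
    ∫ x in T.carrier, inner ℝ (evVec (gradRec d) x) (evVec τ x) =
      -(∫ x in T.carrier, ev d.1 x * ev (divPoly τ) x) + T.boundaryFlux (traceRec d) τ := by
  have hc := (traceRec_spec d).1
  let L : VecPoly k →ₗ[ℝ] ℝ :=
    { toFun := fun τ => -(∫ x in T.carrier, ev d.1 x * ev (divPoly τ) x) +
        T.boundaryFlux (traceRec d) τ
      map_add' := fun σ τ => by
        rw [Submodule.coe_add, boundaryFlux_add hc, divPoly_add]
        simp only [ev_add, mul_add]
        rw [integral_add (integrableOn_of_continuous (by fun_prop))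
          (integrableOn_of_continuous (by fun_prop))]
        ring
      map_smul' := fun c τ => by
        rw [Submodule.coe_smul, boundaryFlux_smul, divPoly_smul]
        simp only [ev_smul, mul_left_comm _ c]
        rw [integral_const_mul, RingHom.id_apply, smul_eq_mul]
        ring }
  have h : ∃ G : VecPoly k, ∀ τ : VecPoly k,
      ∫ x in T.carrier, inner ℝ (evVec (G : Fin 2 → MvPolynomial (Fin 2) ℝ) x) (evVec τ x) =
        -(∫ x in T.carrier, ev d.1 x * ev (divPoly τ) x) + T.boundaryFlux (traceRec d) τ :=
    exists_vecPoly (T := T) L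
  rw [gradRec, dif_pos h]
  exact h.choose_spec ⟨τ, hτ⟩

/-- The trial and test spaces are both P^{k+1}, so it is enough that the left kernel is trivial. A
polynomial R in the kernel may be written div((x - x_T) w), and testing with this w gives ∫ R² = 0.
-/
lemma potRec_spec (d : T.DOF k) {w : MvPolynomial (Fin 2) ℝ} (hw : w ∈ Poly ((k : ℤ) + 1)) :
    ∫ x in T.carrier, ev (potRec d) x * ev (divPoly (radial T.center w)) x =
      -(∫ x in T.carrier, inner ℝ (evVec (gradRec d) x) (evVec (radial T.center w) x)) +
        T.boundaryFlux (traceRec d) (radial T.center w) := by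
  have hc := (traceRec_spec d).1
  let L : Poly ((k : ℤ) + 1) →ₗ[ℝ] ℝ :=
    { toFun := fun w =>
        -(∫ x in T.carrier, inner ℝ (evVec (gradRec d) x) (evVec (radial T.center w) x)) +
        T.boundaryFlux (traceRec d) (radial T.center w)
      map_add' := fun u w => by
        rw [Submodule.coe_add, radial_add, boundaryFlux_add hc]
        simp only [evVec_add, inner_add_right]
        rw [integral_add (integrableOn_of_continuous (by fun_prop))
          (integrableOn_of_continuous (by fun_prop))]
        ring
      map_smul' := fun c w => by
        rw [Submodule.coe_smul, radial_smul, boundaryFlux_smul]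
        simp only [evVec_smul, inner_smul_right]
        rw [integral_const_mul, RingHom.id_apply, smul_eq_mul]
        ring }
  let D : Poly ((k : ℤ) + 1) →ₗ[ℝ] Poly ((k : ℤ) + 1) :=
    { toFun := fun w => ⟨divPoly (radial T.center w), divPoly_radial_mem_poly w.2 _⟩
      map_add' := fun u w => Subtype.ext (by
        simp only [Submodule.coe_add, radial_add, divPoly_add])
      map_smul' := fun c w => Subtype.ext (by
        simp only [Submodule.coe_smul, radial_smul, divPoly_smul, RingHom.id_apply]) }
  obtain ⟨R, hR⟩ := exists_represents
    ((T.mass (b := fun _ => 1) continuous_const ((k : ℤ) + 1)).compl₂ D) (fun R hR => by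
      obtain ⟨w, hw, hwR⟩ := exists_divPoly_radial_eq T.center R.2
      refine poly_eq_zero (T := T) R ?_
      have := hR ⟨w, hw⟩
      rw [LinearMap.compl₂_apply, mass_apply] at this
      simpa only [D, LinearMap.coe_mk, AddHom.coe_mk, hwR, one_mul] using this) L
  have h : ∃ R : Poly ((k : ℤ) + 1), ∀ w ∈ Poly ((k : ℤ) + 1),
      ∫ x in T.carrier,
          ev (R : MvPolynomial (Fin 2) ℝ) x * ev (divPoly (radial T.center w)) x =
        - (∫ x in T.carrier, inner ℝ (evVec (gradRec d) x) (evVec (radial T.center w) x)) +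
          T.boundaryFlux (traceRec d) (radial T.center w) := by
    refine ⟨R, fun w hw => ?_⟩
    have := hR ⟨w, hw⟩
    rw [LinearMap.compl₂_apply, mass_apply] at this
    simp only [one_mul] at this
    exact this
  rw [potRec, dif_pos h]
  exact h.choose_spec w hw

lemma IsContTrace.green {v : T.H1} {g : Plane → ℝ} (h : T.IsContTrace v g)
    (τ : Fin 2 → MvPolynomial (Fin 2) ℝ) :
    ∫ x in T.carrier, inner ℝ (v.grad x) (evVec τ x) =
      -(∫ x in T.carrier, v.fn x * ev (divPoly τ) x) + T.boundaryFlux g τ := by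
  obtain ⟨φ, hφ⟩ := hasTrace_iff.1 h.2
  exact hφ.green v.memLp_fn v.memLp_grad (fun i => memLp_edge_of_continuousOn_frontier h.1 i) τ

/-- If the boundary values and the moments of `v` are those given by `d`, then `G_T d` is the
projection of the gradient. -/
lemma gradRec_integral {v : T.H1} {d : T.DOF k} (ht : T.IsContTrace v (traceRec d))
    (hm : ∀ q ∈ Poly ((k : ℤ) - 1),
      ∫ x in T.carrier, ev d.1 x * ev q x = ∫ x in T.carrier, v.fn x * ev q x)
    {τ : Fin 2 → MvPolynomial (Fin 2) ℝ} (hτ : τ ∈ VecPoly k) :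
    ∫ x in T.carrier, inner ℝ (evVec (gradRec d) x) (evVec τ x) =
      ∫ x in T.carrier, inner ℝ (v.grad x) (evVec τ x) := by
  rw [gradRec_spec d hτ, ht.green, hm _ (divPoly_mem_poly hτ)]

lemma gradRec_eq {v : T.H1} {d : T.DOF k} (ht : T.IsContTrace v (traceRec d))
    (hm : ∀ q ∈ Poly ((k : ℤ) - 1),
      ∫ x in T.carrier, ev d.1 x * ev q x = ∫ x in T.carrier, v.fn x * ev q x) :
    gradRec d = T.vecProj k v.grad :=
  vecPoly_unique (T := T) fun τ => by
    rw [gradRec_integral ht hm τ.2, vecProj_spec v.memLp_grad τ.2]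

lemma integral_radial {f : Plane → Plane} (w : MvPolynomial (Fin 2) ℝ) :
    ∫ x in T.carrier, inner ℝ (f x) (evVec (radial T.center w) x) =
      ∫ x in T.carrier, inner ℝ (f x) (x - T.center) * ev w x := by
  refine integral_congr_ae (Eventually.of_forall fun x => ?_)
  simp only [evVec_radial, inner_smul_right, mul_comm]

/-- The moment condition against all polynomials of degree `≤ k + 1` means that the potential
reconstruction is the projection of `v`. -/
lemma moment_iff {v : T.H1} {d : T.DOF k} (ht : T.IsContTrace v (traceRec d))
    (hm : ∀ q ∈ Poly ((k : ℤ) - 1),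
      ∫ x in T.carrier, ev d.1 x * ev q x = ∫ x in T.carrier, v.fn x * ev q x)
    {w : MvPolynomial (Fin 2) ℝ} (hw : w ∈ Poly ((k : ℤ) + 1)) :
    ∫ x in T.carrier, inner ℝ (v.grad x - evVec (T.vecProj k v.grad) x) (x - T.center) * ev w x = 0 ↔
      ∫ x in T.carrier, ev (potRec d) x * ev (divPoly (radial T.center w)) x =
        ∫ x in T.carrier, v.fn x * ev (divPoly (radial T.center w)) x := by
  rw [← integral_radial (f := fun x => v.grad x - evVec (T.vecProj k v.grad) x),
    integral_inner_sub v.memLp_grad, potRec_spec d hw, ht.green, gradRec_eq ht hm]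
  constructor <;> intro h <;> linarith

/-- The main identities on the virtual space. -/
lemma virtualSpace_spec {C : Submodule ℝ (MvPolynomial (Fin 2) ℝ)}
    (hC : Poly ((k : ℤ) - 1) ⊔ C = Poly ((k : ℤ) + 1)) {v : T.H1} (hv : v ∈ T.virtualSpace k C) :
    T.IsContTrace v (traceRec (T.dofs k v)) ∧
      Set.EqOn (traceRec (T.dofs k v)) (T.trace v) (frontier T.carrier) ∧
      gradRec (T.dofs k v) = T.vecProj k v.grad ∧
      potRec (T.dofs k v) = T.proj ((k : ℤ) + 1) v.fn := by
  obtain ⟨h1, -, h3⟩ := hv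
  obtain ⟨ht, q, hq⟩ := trace_spec h1
  have hrec : ∀ i, edgeRec (T.dofs k v) i = q i := fun i => by
    refine edgeRec_eq ?_ ?_ ?_
    · exact (edgeProj_congr (continuousOn_edge ht.1 i) fun s hs => hq i s hs).symm
    · rw [← hq i 0 (by simp), edgePt_zero]
      rfl
    · rw [← hq i 1 (by simp), edgePt_one]
      rfl
  have heq : Set.EqOn (traceRec (T.dofs k v)) (T.trace v) (frontier T.carrier) :=
    eqOn_frontier fun i s hs => by rw [(traceRec_spec _).2 i s hs, hrec, hq i s hs]
  have ht' := ht.congr heq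
  have hm : ∀ q ∈ Poly ((k : ℤ) - 1), ∫ x in T.carrier, ev (T.dofs k v).1 x * ev q x =
      ∫ x in T.carrier, v.fn x * ev q x := fun q hq => proj_spec v.memLp_fn hq
  refine ⟨ht', heq, gradRec_eq ht' hm, (proj_eq v.memLp_fn fun p => ?_).symm⟩
  -- Every test polynomial of degree ≤ k + 1 is div((x - x_T) w). It remains to check the moment
  -- condition for w = w1 + w2: the radial field of w1 has degree ≤ k and is killed by the
  -- projection, while w2 is covered by the definition of the virtual space.
  obtain ⟨w, hw, hwp⟩ := exists_divPoly_radial_eq T.center p.2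
  rw [← hwp, ← moment_iff ht' hm hw]
  obtain ⟨w1, hw1, w2, hw2, rfl⟩ := Submodule.mem_sup.1 (hC ▸ hw)
  have hrad : radial T.center w1 ∈ VecPoly k := by
    simpa using radial_mem_vecPoly hw1 T.center
  have e1 : ∫ x in T.carrier,
      inner ℝ (v.grad x - evVec (T.vecProj k v.grad) x) (evVec (radial T.center w1) x) = 0 := by
    rw [integral_inner_sub v.memLp_grad, vecProj_spec v.memLp_grad hrad, sub_self]
  have e2 := h3 w2 hw2
  rw [← integral_radial (f := fun x => v.grad x - evVec (T.vecProj k v.grad) x)] at e2 ⊢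
  rw [radial_add]
  have mg : MemLp (fun x => v.grad x - evVec (T.vecProj k v.grad) x) 2 T.vol :=
    v.memLp_grad.sub (memLp_evVec _)
  simp only [evVec_add, inner_add_right]
  rw [integral_add (memLp_integrable_inner mg (memLp_evVec _))
    (memLp_integrable_inner mg (memLp_evVec _)), e1, e2, add_zero]

end PolygonalElement

/-! ### Mollification of Lipschitz functions -/

section Mollify

open scoped Convolution NNReal

/-- The mollification of a function by a normalised bump. -/
noncomputable def moll (β : ContDiffBump (0 : Plane)) (f : Plane → ℝ) : Plane → ℝ :=
  β.normed volume ⋆[ContinuousLinearMap.lsmul ℝ ℝ, volume] f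

variable {β : ContDiffBump (0 : Plane)} {f : Plane → ℝ} {K : ℝ≥0}

lemma moll_apply (β : ContDiffBump (0 : Plane)) (f : Plane → ℝ) (x : Plane) :
    moll β f x = ∫ t, β.normed volume t * f (x - t) := rfl

lemma integrable_moll (hf : Continuous f) (x : Plane) :
    Integrable fun t => β.normed volume t * f (x - t) :=
  Continuous.integrable_of_hasCompactSupport
    (β.continuous_normed.mul (hf.comp (continuous_const.sub continuous_id)))
    β.hasCompactSupport_normed.mul_right

lemma contDiff_moll (hf : Continuous f) : ContDiff ℝ ∞ (moll β f) :=
  β.hasCompactSupport_normed.contDiff_convolution_left _ β.contDiff_normed hf.locallyIntegrable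

lemma norm_normed (β : ContDiffBump (0 : Plane)) (t : Plane) :
    ‖β.normed volume t‖ = β.normed volume t := Real.norm_of_nonneg (β.nonneg_normed t)

lemma lipschitzWith_moll (hf : LipschitzWith K f) : LipschitzWith K (moll β f) := by
  refine LipschitzWith.of_dist_le_mul fun x y => ?_
  rw [dist_eq_norm, moll_apply, moll_apply,
    ← integral_sub (integrable_moll hf.continuous x) (integrable_moll hf.continuous y)]
  refine (norm_integral_le_of_norm_le (g := fun t => β.normed volume t * (K * dist x y))
    (β.integrable_normed.mul_const _) (Eventually.of_forall fun t => ?_)).trans_eq ?_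
  · rw [← mul_sub, norm_mul, norm_normed]
    refine mul_le_mul_of_nonneg_left ?_ (β.nonneg_normed t)
    have := hf.dist_le_mul (x - t) (y - t)
    rwa [dist_eq_norm, dist_sub_right] at this
  · rw [integral_mul_const, β.integral_normed, one_mul]

lemma dist_moll_le (hf : LipschitzWith K f) (x : Plane) :
    dist (moll β f x) (f x) ≤ K * β.rOut :=
  β.dist_normed_convolution_le hf.continuous.aestronglyMeasurable fun y hy =>
    (hf.dist_le_mul y x).trans (mul_le_mul_of_nonneg_left (Metric.mem_ball.1 hy).le K.2)

lemma moll_eq {x : Plane} (h : ∀ y ∈ Metric.ball x β.rOut, f y = f x) : moll β f x = f x :=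
  β.normed_convolution_eq_right h

lemma norm_gradient_le (hf : LipschitzWith K f) (x : Plane) : ‖gradient f x‖ ≤ K := by
  rw [norm_gradient]
  exact norm_fderiv_le_of_lipschitz ℝ hf

lemma measurable_gradient (f : Plane → ℝ) : Measurable (gradient f) :=
  (InnerProductSpace.toDual ℝ Plane).symm.continuous.measurable.comp (measurable_fderiv ℝ f)

/-- A Lipschitz function is differentiable almost everywhere and its difference quotients are
bounded by K, which justifies differentiating under the integral. -/
lemma gradient_moll (hf : LipschitzWith K f) (x : Plane) : gradient (moll β f) x =
    (β.normed volume ⋆[ContinuousLinearMap.lsmul ℝ ℝ, volume] gradient f) x := by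
  have hd : ∀ᵐ t : Plane, DifferentiableAt ℝ f (x - t) :=
    (Measure.measurePreserving_sub_left volume x).quasiMeasurePreserving.ae
      hf.ae_differentiableAt_of_real
  have h := hasFDerivAt_integral_of_dominated_loc_of_lip' (𝕜 := ℝ) (μ := (volume : Measure Plane))
    (F := fun y t => β.normed volume t * f (y - t)) (x₀ := x)
    (F' := fun t => β.normed volume t • fderiv ℝ f (x - t))
    (bound := fun t => β.normed volume t * K) univ_mem
    (fun y _ => (integrable_moll hf.continuous y).1) (integrable_moll hf.continuous x)
    (β.continuous_normed.aestronglyMeasurable.smul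
      ((measurable_fderiv ℝ f).comp (measurable_const.sub measurable_id)).aestronglyMeasurable)
    (Eventually.of_forall fun t y _ => by
      rw [← mul_sub, norm_mul, norm_normed, mul_assoc]
      refine mul_le_mul_of_nonneg_left ?_ (β.nonneg_normed t)
      have := hf.dist_le_mul (y - t) (x - t)
      rwa [dist_sub_right, dist_eq_norm, dist_eq_norm] at this)
    (β.integrable_normed.mul_const _)
    (by
      filter_upwards [hd] with t ht
      have h1 := ht.hasFDerivAt.comp x ((hasFDerivAt_id x).sub_const t)
      rw [ContinuousLinearMap.comp_id] at h1
      exact h1.const_mul _)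
  have e : fderiv ℝ (moll β f) x = ∫ t, β.normed volume t • fderiv ℝ f (x - t) := h.2.fderiv
  rw [gradient, e, convolution_lsmul]
  have := (InnerProductSpace.toDual ℝ Plane).symm.toContinuousLinearEquiv.integral_comp_comm
    (fun t => β.normed volume t • fderiv ℝ f (x - t)) (μ := volume)
  refine Eq.trans this.symm (integral_congr_ae (Eventually.of_forall fun t => ?_))
  simp [gradient]

end Mollify

/-- Bounded pointwise convergence implies convergence in `L²`. -/
lemma L2Tendsto.of_ae {α E : Type*} [MeasurableSpace α] [NormedAddCommGroup E] {μ : Measure α}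
    [IsFiniteMeasure μ] {F : ℕ → α → E} {f : α → E} {C : ℝ}
    (hF : ∀ n, AEStronglyMeasurable (F n) μ) (hf : AEStronglyMeasurable f μ)
    (hb : ∀ n, ∀ᵐ x ∂μ, ‖F n x - f x‖ ≤ C)
    (h : ∀ᵐ x ∂μ, Tendsto (fun n => F n x) atTop (𝓝 (f x))) : L2Tendsto μ F f := by
  have h1 : Tendsto (fun n => ∫⁻ x, ‖F n x - f x‖ₑ ^ (2 : ℝ) ∂μ) atTop (𝓝 (∫⁻ _, 0 ∂μ)) := by
    refine tendsto_lintegral_of_dominated_convergence' (fun _ => ENNReal.ofReal C ^ (2 : ℝ))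
      (fun n => ((hF n).sub hf).enorm.pow_const _) (fun n => ?_) ?_ ?_
    · filter_upwards [hb n] with x hx
      rw [← ofReal_norm]
      gcongr
    · rw [lintegral_const]
      exact ENNReal.mul_ne_top (ENNReal.rpow_ne_top_of_nonneg (by norm_num) ENNReal.ofReal_ne_top)
        (measure_ne_top _ _)
    · filter_upwards [h] with x hx
      have h2 : Tendsto (fun n => ‖F n x - f x‖ₑ) atTop (𝓝 0) := by
        simpa using (hx.sub_const (f x)).enorm
      simpa using h2.ennrpow_const 2
  rw [lintegral_zero] at h1
  rw [L2Tendsto]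
  have h2 := h1.ennrpow_const (1 / 2 : ℝ)
  rw [ENNReal.zero_rpow_of_pos (by norm_num)] at h2
  refine h2.congr fun n => ?_
  rw [eLpNorm_eq_lintegral_rpow_enorm_toReal (by norm_num) (by norm_num)]
  simp

/-- A sequence of bumps shrinking to the origin. -/
noncomputable def shrinkingBump (n : ℕ) : ContDiffBump (0 : Plane) where
  rIn := (n + 1 : ℝ)⁻¹ / 2
  rOut := (n + 1 : ℝ)⁻¹
  rIn_pos := by positivity
  rIn_lt_rOut := half_lt_self (by positivity)

lemma tendsto_shrinkingBump : Tendsto (fun n => (shrinkingBump n).rOut) atTop (𝓝 0) := by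
  have h := tendsto_one_div_add_atTop_nhds_zero_nat (𝕜 := ℝ)
  simp only [one_div] at h
  exact h

open scoped NNReal in
lemma norm_moll_sub_le {f : Plane → ℝ} {K : ℝ≥0} (hf : LipschitzWith K f) (n : ℕ) (x : Plane) :
    ‖moll (shrinkingBump n) f x - f x‖ ≤ K := by
  rw [← dist_eq_norm]
  refine (dist_moll_le hf x).trans (mul_le_of_le_one_right K.2 ?_)
  exact inv_le_one_of_one_le₀ (by linarith [(n.cast_nonneg : (0 : ℝ) ≤ n)])

lemma tendsto_moll {f : Plane → ℝ} (hf : Continuous f) (x : Plane) :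
    Tendsto (fun n => moll (shrinkingBump n) f x) atTop (𝓝 (f x)) :=
  ContDiffBump.convolution_tendsto_right_of_continuous tendsto_shrinkingBump hf x

namespace PolygonalElement

open scoped NNReal

variable {T : PolygonalElement}

lemma memLp_gradient_of_lipschitz {f : Plane → ℝ} {K : ℝ≥0} (hf : LipschitzWith K f) :
    MemLp (gradient f) 2 T.vol :=
  MemLp.of_bound (measurable_gradient f).aestronglyMeasurable K
    (Eventually.of_forall (norm_gradient_le hf))

/-- Lipschitz functions belong to `H¹` and have their restriction as trace. -/
lemma Approx.of_lipschitz {f : Plane → ℝ} {K : ℝ≥0} (hf : LipschitzWith K f) :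
    T.Approx (fun n => moll (shrinkingBump n) f) f (gradient f) f where
  smooth n := contDiff_moll hf.continuous
  fn := by
    refine L2Tendsto.of_ae (C := K)
      (fun n => (contDiff_moll hf.continuous).continuous.aestronglyMeasurable)
      hf.continuous.aestronglyMeasurable (fun n => Eventually.of_forall fun x => ?_)
      (Eventually.of_forall fun x => ?_)
    · exact norm_moll_sub_le hf n x
    · exact tendsto_moll hf.continuous x
  grad := by
    refine L2Tendsto.of_ae (C := K + K) (fun n => (measurable_gradient _).aestronglyMeasurable)
      (measurable_gradient _).aestronglyMeasurable (fun n => Eventually.of_forall fun x =>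
        (norm_sub_le _ _).trans (add_le_add (norm_gradient_le (lipschitzWith_moll hf) x)
          (norm_gradient_le hf x))) (ae_restrict_of_ae ?_)
    have hl : LocallyIntegrable (gradient f) volume := by
      refine (locallyIntegrable_const (K : ℝ)).mono (measurable_gradient _).aestronglyMeasurable
        (Eventually.of_forall fun x => ?_)
      rw [Real.norm_of_nonneg (NNReal.coe_nonneg K)]
      exact norm_gradient_le hf x
    -- The gradient of the mollification is the mollified gradient, which converges almost
    -- everywhere by Lebesgue differentiation. Boundedness by the Lipschitz constant upgrades this
    -- to L².
    filter_upwards [ContDiffBump.ae_convolution_tendsto_right_of_locallyIntegrable (K := 2)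
      tendsto_shrinkingBump (Eventually.of_forall fun n => (mul_div_cancel₀ _ two_ne_zero).ge) hl] with x hx
    simpa only [gradient_moll hf] using hx
  edge i := by
    refine L2Tendsto.of_ae (C := K)
      (fun n => ((contDiff_moll hf.continuous).continuous.comp
        (continuous_edgePt i)).aestronglyMeasurable)
      (hf.continuous.comp (continuous_edgePt i)).aestronglyMeasurable
      (fun n => Eventually.of_forall fun x => ?_) (Eventually.of_forall fun x => ?_)
    · exact norm_moll_sub_le hf n _
    · exact tendsto_moll hf.continuous _

end PolygonalElement

namespace PolygonalElement

open scoped NNReal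

variable {T : PolygonalElement}

/-! ### Cut-off functions -/

lemma nonempty_compl (T : PolygonalElement) : (T.carrierᶜ).Nonempty := by
  obtain ⟨R, -, hRT⟩ := T.exists_norm_sub_center_le
  obtain ⟨x, hx⟩ := NormedSpace.exists_lt_norm ℝ Plane (R + ‖T.center‖)
  refine ⟨x, fun h => ?_⟩
  have h1 := hRT x (subset_closure h)
  have h2 := norm_sub_norm_le x T.center
  linarith

/-- The distance to the complement of the element. -/
noncomputable def depth (T : PolygonalElement) (x : Plane) : ℝ := Metric.infDist x T.carrierᶜ

lemma continuous_depth : Continuous T.depth := Metric.continuous_infDist_pt _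

lemma depth_pos {x : Plane} (hx : x ∈ T.carrier) : 0 < T.depth x := by
  refine (T.isOpen_carrier.isClosed_compl.notMem_iff_infDist_pos T.nonempty_compl).1 ?_
  exact fun h => h hx

lemma mem_of_depth_pos {x : Plane} (hx : 0 < T.depth x) : x ∈ T.carrier := by
  have := (T.isOpen_carrier.isClosed_compl.notMem_iff_infDist_pos T.nonempty_compl).2 hx
  exact not_not.1 this

lemma le_depth {x : Plane} {r : ℝ} (h : Metric.ball x r ⊆ T.carrier) : r ≤ T.depth x := by
  refine (Metric.le_infDist T.nonempty_compl).2 fun y hy => ?_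
  by_contra hlt
  exact hy (h (Metric.mem_ball'.2 (not_le.1 hlt)))

lemma abs_depth_sub_le (x y : Plane) : |T.depth x - T.depth y| ≤ dist x y := by
  have := (Metric.lipschitz_infDist_pt T.carrierᶜ).dist_le_mul x y
  rwa [NNReal.coe_one, one_mul, Real.dist_eq] at this

/-- Clamp depth / ε - 1 to [0, 1] and mollify at scale ε / 2. Mollification keeps the Lipschitz
constant 1 / ε, and the result vanishes where the depth is ≤ ε / 2 and is 1 where it is ≥ 5 ε / 2.
The threshold 3 ε leaves room for a neighbourhood on which it is constant. -/
lemma exists_cutoff (T : PolygonalElement) {ε : ℝ} (hε : 0 < ε) : ∃ χ : Plane → ℝ, T.IsTest χ ∧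
    (∀ x, |χ x| ≤ 2) ∧ (∀ x, ‖gradient χ x‖ ≤ ε⁻¹) ∧
    (∀ x, 3 * ε ≤ T.depth x → χ x = 1) ∧ ∀ x, 3 * ε ≤ T.depth x → gradient χ x = 0 := by
  let f : Plane → ℝ := fun x => max 0 (min 1 (ε⁻¹ * T.depth x - 1))
  have hεi : 0 < ε⁻¹ := inv_pos.2 hε
  have hf : LipschitzWith (⟨ε⁻¹, hεi.le⟩ : ℝ≥0) f := by
    refine LipschitzWith.const_max (LipschitzWith.const_min ?_ _) _
    refine LipschitzWith.of_dist_le_mul fun x y => ?_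
    rw [Real.dist_eq, sub_sub_sub_cancel_right, ← mul_sub, abs_mul, abs_of_pos hεi]
    exact mul_le_mul_of_nonneg_left (abs_depth_sub_le x y) hεi.le
  have hf1 : ∀ x, |f x| ≤ 1 := fun x => by
    rw [abs_of_nonneg (le_max_left _ _)]
    exact max_le zero_le_one (min_le_left _ _)
  have f_zero : ∀ x, T.depth x ≤ ε → f x = 0 := fun x hx => by
    refine max_eq_left ((min_le_right _ _).trans ?_)
    rw [sub_nonpos, inv_mul_le_iff₀ hε, mul_one]
    exact hx
  have f_one : ∀ x, 2 * ε ≤ T.depth x → f x = 1 := fun x hx => by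
    have : 1 ≤ ε⁻¹ * T.depth x - 1 := by
      have := mul_le_mul_of_nonneg_left hx hεi.le
      rw [mul_left_comm, inv_mul_cancel₀ hε.ne'] at this
      linarith
    simp only [f, min_eq_left this]
    exact max_eq_right zero_le_one
  let β : ContDiffBump (0 : Plane) := ⟨ε / 4, ε / 2, by positivity, by linarith⟩
  have hβ : β.rOut = ε / 2 := rfl
  have hball : ∀ {x y : Plane}, y ∈ Metric.ball x β.rOut → |T.depth y - T.depth x| ≤ ε / 2 :=
    fun hy => (abs_depth_sub_le _ _).trans (Metric.mem_ball.1 hy).le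
  have χ_zero : ∀ x, T.depth x ≤ ε / 2 → moll β f x = 0 := fun x hx => by
    have h0 := f_zero x (by linarith)
    rw [moll_eq, h0]
    intro y hy
    have := (abs_le.1 (hball hy)).2
    rw [h0, f_zero y (by linarith)]
  have χ_one : ∀ x, 5 / 2 * ε ≤ T.depth x → moll β f x = 1 := fun x hx => by
    have h0 := f_one x (by linarith)
    rw [moll_eq, h0]
    intro y hy
    have := (abs_le.1 (hball hy)).1
    rw [h0, f_one y (by linarith)]
  have hsub : tsupport (moll β f) ⊆ {x | ε / 2 ≤ T.depth x} := by
    refine closure_minimal (fun x hx => ?_) (isClosed_le continuous_const continuous_depth)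
    by_contra hlt
    exact hx (χ_zero x (not_le.1 hlt).le)
  have hsub' : tsupport (moll β f) ⊆ T.carrier := fun x hx =>
    mem_of_depth_pos ((half_pos hε).trans_le (hsub hx))
  refine ⟨moll β f, ⟨contDiff_moll hf.continuous, ?_, hsub'⟩, fun x => ?_, fun x =>
    norm_gradient_le (lipschitzWith_moll hf) x, fun x hx => χ_one x (by linarith), fun x hx => ?_⟩
  · exact (T.isBounded_carrier.isCompact_closure).of_isClosed_subset (isClosed_tsupport _)
      (hsub'.trans subset_closure)
  · have h1 := dist_moll_le (β := β) hf x
    rw [Real.dist_eq, hβ] at h1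
    have h2 : ((⟨ε⁻¹, hεi.le⟩ : ℝ≥0) : ℝ) * (ε / 2) = 1 / 2 := by
      change ε⁻¹ * (ε / 2) = 1 / 2
      field_simp
    have h3 := abs_sub_abs_le_abs_sub (moll β f x) (f x)
    linarith [hf1 x, h1.trans_eq h2]
  · have : moll β f =ᶠ[𝓝 x] fun _ => 1 := by
      filter_upwards [(isOpen_lt continuous_const continuous_depth).mem_nhds
        (show 5 / 2 * ε < T.depth x by linarith)] with y hy
      exact χ_one y (le_of_lt hy)
    rw [gradient, this.fderiv_eq]
    simp

/-- Outside of a collar, the depth is bounded below. -/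
lemma exists_depth_ge (T : PolygonalElement) : ∃ r : ℝ, 0 < r ∧ ∀ ρ : ℝ, 0 ≤ ρ → ρ < 1 →
    ∀ᵐ x ∂T.vol, x ∉ T.collar T.center ρ → (1 - ρ) * r ≤ T.depth x := by
  obtain ⟨r, hr, h⟩ := T.starShaped
  refine ⟨r, hr, fun ρ hρ hρ1 => ?_⟩
  have h0 : ∀ᵐ x ∂T.vol, x ∈ T.collar T.center 0 := by
    rw [ae_restrict_iff' T.isOpen_carrier.measurableSet]
    filter_upwards [T.isKernelPt_center.collar_ae_eq.mem_iff] with x hx hxT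
    exact hx.2 hxT
  filter_upwards [h0] with x hx hxρ
  obtain ⟨i, z, hz, rfl⟩ := Set.mem_iUnion.1 hx
  have hzρ : z.2 ≤ ρ := by
    by_contra hlt
    exact hxρ (Set.mem_iUnion.2 ⟨i, z, ⟨hz.1, not_le.1 hlt, hz.2.2⟩, rfl⟩)
  rw [triMap_edge]
  refine (mul_le_mul_of_nonneg_right (by linarith) hr.le).trans (le_depth
    (ball_subset_of_starConvex h (frontier_subset_closure
      (edgePt_mem_frontier i (Set.Ioo_subset_Icc_self hz.1))) (?_ : 0 ≤ z.2) (by linarith)))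
  exact le_of_lt hz.2.1

/-- This makes the collars shrink to the boundary: any fixed interior point eventually leaves them.
-/
lemma depth_le_of_mem_collar (T : PolygonalElement) : ∃ R : ℝ, 0 < R ∧ ∀ ρ : ℝ,
    ∀ x ∈ T.collar T.center ρ, T.depth x ≤ (1 - ρ) * R := by
  obtain ⟨R, hR, hRT⟩ := T.exists_norm_sub_center_le
  refine ⟨R, hR, fun ρ x hx => ?_⟩
  obtain ⟨i, z, hz, rfl⟩ := Set.mem_iUnion.1 hx
  have hp := edgePt_mem_frontier i (Set.Ioo_subset_Icc_self hz.1)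
  rw [triMap_edge]
  refine (Metric.infDist_le_dist_of_mem (notMem_of_mem_frontier hp)).trans ?_
  rw [dist_lineMap_right, Real.norm_of_nonneg (sub_nonneg.2 hz.2.2.le), dist_comm, dist_eq_norm]
  have h1 := hRT _ (frontier_subset_closure hp)
  have h2 : ρ < z.2 := hz.2.1
  have h3 : z.2 < 1 := hz.2.2
  exact mul_le_mul (by linarith) h1 (norm_nonneg _) (by linarith)

/-! ### Harmonic-type functions with vanishing trace -/

section Vanishing

variable {φ : ℕ → Plane → ℝ} {f : Plane → ℝ} {g : Plane → Plane} {γ : Plane → ℝ}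

lemma gradient_mul {φ χ : Plane → ℝ} {x : Plane} (hφ : DifferentiableAt ℝ φ x)
    (hχ : DifferentiableAt ℝ χ x) :
    gradient (fun x => χ x * φ x) x = χ x • gradient φ x + φ x • gradient χ x := by
  rw [gradient, show fderiv ℝ (fun x => χ x * φ x) x = _ from
    (hχ.hasFDerivAt.mul hφ.hasFDerivAt).fderiv, map_add, map_smulₛₗ, map_smulₛₗ]
  rfl

lemma IsTest.mul {φ χ : Plane → ℝ} (hχ : T.IsTest χ) (hφ : ContDiff ℝ ∞ φ) :
    T.IsTest fun x => χ x * φ x :=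
  ⟨hχ.1.mul hφ, hχ.2.1.mul_right, (tsupport_mul_subset_left).trans hχ.2.2⟩

lemma memLp_inner_bdd {w : Plane → Plane} {D : ℝ} (mg : MemLp g 2 T.vol) (hw : Continuous w)
    (hD : ∀ x, ‖w x‖ ≤ D) : MemLp (fun x => inner ℝ (g x) (w x)) 2 T.vol := by
  refine mg.of_le_mul (c := D) (mg.1.inner hw.aestronglyMeasurable)
    (Eventually.of_forall fun x => (norm_inner_le_norm _ _).trans ?_)
  rw [mul_comm]
  exact mul_le_mul_of_nonneg_right (hD x) (norm_nonneg _)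

/-- Testing the Laplacian with a truncation of the function itself. -/
lemma Approx.cutoff_identity (h : T.Approx φ f g γ) (mf : MemLp f 2 T.vol) (mg : MemLp g 2 T.vol)
    {p : Plane → ℝ} (hp : Continuous p) (hL : ∀ ψ : Plane → ℝ, T.IsTest ψ →
      ∫ x in T.carrier, inner ℝ (g x) (gradient ψ x) = -∫ x in T.carrier, p x * ψ x)
    {χ : Plane → ℝ} (hχ : T.IsTest χ) {C D : ℝ} (hC : ∀ x, |χ x| ≤ C)
    (hD : ∀ x, ‖gradient χ x‖ ≤ D) :
    (∫ x in T.carrier, χ x * ‖g x‖ ^ 2) + ∫ x in T.carrier, f x * inner ℝ (g x) (gradient χ x) =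
      -∫ x in T.carrier, χ x * (p x * f x) := by
  have m1 : MemLp (fun x => χ x • g x) 2 T.vol :=
    MemLp_smul_bdd mg hχ.1.continuous.aestronglyMeasurable (Eventually.of_forall hC)
  have m2 : MemLp (fun x => inner ℝ (g x) (gradient χ x)) 2 T.vol :=
    memLp_inner_bdd mg (continuous_gradient hχ.contDiff) hD
  have m3 : MemLp (fun x => χ x * p x) 2 T.vol := memLp_of_continuous (hχ.1.continuous.mul hp)
  have t1 := (L2Tendsto.const (μ := T.vol) fun x => χ x • g x).integral_inner h.grad
    (fun _ => m1) m1 h.memLp_grad mg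
  have t2 := h.fn.integral_mul (L2Tendsto.const fun x => inner ℝ (g x) (gradient χ x)) h.memLp mf
    (fun _ => m2) m2
  have t3 := (L2Tendsto.const (μ := T.vol) fun x => χ x * p x).integral_mul h.fn
    (fun _ => m3) m3 h.memLp mf
  -- The admissible test function is χ φ_n, as φ_n is smooth and f is not; the product rule gives an
  -- identity in which φ_n and its gradient appear linearly.
  have e : ∀ n, (∫ x in T.carrier, inner ℝ (χ x • g x) (gradient (φ n) x)) +
      ∫ x in T.carrier, φ n x * inner ℝ (g x) (gradient χ x) =
      -∫ x in T.carrier, χ x * p x * φ n x := fun n => by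
    rw [← integral_add (memLp_integrable_inner m1 (h.memLp_grad n))
      (memLp_integrable_mul (h.memLp n) m2)]
    refine Eq.trans (integral_congr_ae (Eventually.of_forall fun x => ?_))
      ((hL _ (hχ.mul (h.smooth n))).trans ?_)
    · rw [gradient_mul ((h.contDiff n).differentiable one_ne_zero x)
        (hχ.contDiff.differentiable one_ne_zero x), inner_add_right, inner_smul_right,
        inner_smul_right]
      change inner ℝ (χ x • g x) _ + _ = _
      rw [real_inner_smul_left]
    · congr 1
      refine integral_congr_ae (Eventually.of_forall fun x => ?_)
      change p x * (χ x * φ n x) = χ x * p x * φ n x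
      ring
  have := tendsto_nhds_unique (t1.add t2) (t3.neg.congr fun n => (e n).symm)
  simp only [real_inner_smul_left, real_inner_self_eq_norm_sq, mul_assoc] at this
  exact this

lemma Approx.tendsto_edge_sq (h : T.Approx φ f g γ)
    (hγ : ∀ i, ∀ s ∈ Set.Icc (0 : ℝ) 1, γ (T.edgePt i s) = 0) :
    Tendsto (fun n => ∑ i, ∫ s in (0 : ℝ)..1, φ n (T.edgePt i s) ^ 2) atTop (𝓝 0) := by
  have h1 : Tendsto (fun n => ∑ i, ∫ s in (0 : ℝ)..1, φ n (T.edgePt i s) ^ 2) atTop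
      (𝓝 (∑ _i : Fin T.numEdges, (0 : ℝ))) := by
    refine tendsto_finsetSum _ fun i _ => ?_
    have h2 := ((h.edge i).congr_limit (f' := fun _ => 0)
      (ae_restrict_of_forall_mem measurableSet_Icc (hγ i))).integral_sq
      (fun n => h.memLp_edge n i) MemLp.zero
    simp only [integral_edgeVol] at h2
    simpa using h2
  simpa using h1

/-- A Hardy-type estimate: with zero trace the boundary term of `exists_collar_le` disappears in the
limit. The factor (1 - ρ)² compensates the square of the gradient of a cut-off at that scale. -/
lemma Approx.collar_le (h : T.Approx φ f g γ) (mf : MemLp f 2 T.vol) (mg : MemLp g 2 T.vol)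
    (hγ : ∀ i, ∀ s ∈ Set.Icc (0 : ℝ) 1, γ (T.edgePt i s) = 0) :
    ∃ C : ℝ, 0 < C ∧ ∀ ρ : ℝ, 1 / 2 ≤ ρ → ρ ≤ 1 → ∫ x in T.collar T.center ρ, f x ^ 2 ≤
      C * (1 - ρ) ^ 2 * ∫ x in T.collar T.center ρ, ‖g x‖ ^ 2 := by
  obtain ⟨C, hC, hle⟩ := T.exists_collar_le
  refine ⟨C, hC, fun ρ hρ hρ1 => ?_⟩
  have hm : volume.restrict (T.collar T.center ρ) ≤ T.vol :=
    Measure.restrict_mono (T.isKernelPt_center.collar_subset (by linarith)) le_rfl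
  have t1 := (h.fn.mono_measure hm).integral_sq (fun n => (h.memLp n).mono_measure hm)
    (mf.mono_measure hm)
  have t2 := (h.grad.mono_measure hm).integral_norm_sq (fun n => (h.memLp_grad n).mono_measure hm)
    (mg.mono_measure hm)
  have t3 := h.tendsto_edge_sq hγ
  have := le_of_tendsto_of_tendsto' t1 ((t3.const_mul C).add (t2.const_mul (C * (1 - ρ) ^ 2)))
    fun n => hle (φ n) (h.contDiff n) ρ hρ hρ1
  rwa [mul_zero, zero_add] at this

lemma Approx.poincare (h : T.Approx φ f g γ) (mf : MemLp f 2 T.vol) (mg : MemLp g 2 T.vol)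
    (hγ : ∀ i, ∀ s ∈ Set.Icc (0 : ℝ) 1, γ (T.edgePt i s) = 0) :
    ∃ C : ℝ, ∫ x in T.carrier, f x ^ 2 ≤ C * ∫ x in T.carrier, ‖g x‖ ^ 2 := by
  obtain ⟨C, hC, hle⟩ := T.exists_poincare_boundary
  have t1 := h.fn.integral_sq h.memLp mf
  have t2 := h.grad.integral_norm_sq h.memLp_grad mg
  have t3 := h.tendsto_edge_sq hγ
  have := le_of_tendsto_of_tendsto' t1 ((t2.add t3).const_mul C)
    fun n => hle (φ n) (h.contDiff n)
  rw [add_zero] at this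
  exact ⟨C, this⟩

lemma integral_sq_eq_zero {E : Type*} [NormedAddCommGroup E] {f : Plane → E}
    (mf : MemLp f 2 T.vol) (h : ∫ x in T.carrier, ‖f x‖ ^ 2 ≤ 0) : f =ᵐ[T.vol] 0 := by
  have h1 := (integral_eq_zero_iff_of_nonneg (fun x => sq_nonneg _) (mf.integrable_norm_pow'
    (p := 2))).1 (le_antisymm h (integral_nonneg fun x => sq_nonneg _))
  filter_upwards [h1] with x hx
  exact norm_eq_zero.1 (pow_eq_zero_iff two_ne_zero |>.1 hx)

/-- A function with vanishing trace that is orthogonal to its Laplacian vanishes. -/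
lemma Approx.eq_zero (h : T.Approx φ f g γ) (mf : MemLp f 2 T.vol) (mg : MemLp g 2 T.vol)
    (hγ : ∀ i, ∀ s ∈ Set.Icc (0 : ℝ) 1, γ (T.edgePt i s) = 0)
    {p : Plane → ℝ} (hp : Continuous p) (hL : ∀ ψ : Plane → ℝ, T.IsTest ψ →
      ∫ x in T.carrier, inner ℝ (g x) (gradient ψ x) = -∫ x in T.carrier, p x * ψ x)
    (h0 : ∫ x in T.carrier, p x * f x = 0) : f =ᵐ[T.vol] 0 ∧ g =ᵐ[T.vol] 0 := by
  obtain ⟨C, hC, hcol⟩ := h.collar_le mf mg hγ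
  obtain ⟨r, hr, hdepth⟩ := T.exists_depth_ge
  obtain ⟨R, hR, hdepth'⟩ := T.depth_le_of_mem_collar
  let δ : ℕ → ℝ := fun n => 1 / ((n : ℝ) + 1) / 2
  have hδ0 : ∀ n, 0 < δ n := fun n => by positivity
  have hδ1 : ∀ n, δ n ≤ 1 / 2 := fun n => by
    have : 1 / ((n : ℝ) + 1) ≤ 1 := by
      rw [div_le_one (by positivity)]
      linarith [(n.cast_nonneg : (0 : ℝ) ≤ n)]
    simp only [δ]
    linarith
  have hδt : Tendsto δ atTop (𝓝 0) := by
    have h1 := (tendsto_one_div_add_atTop_nhds_zero_nat (𝕜 := ℝ)).div_const 2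
    rwa [zero_div] at h1
  -- With 3 ε = δ r, the cut-off is constant at almost every point outside the collar of relative
  -- width δ, so its gradient lives in the collar.
  let ε : ℕ → ℝ := fun n => δ n * r / 3
  have hε0 : ∀ n, 0 < ε n := fun n => by have := hδ0 n; positivity
  have hε3 : ∀ n, 3 * ε n = δ n * r := fun n => by simp only [ε]; ring
  choose χ hχ hχ2 hχD hχ1 hχ0 using fun n => T.exists_cutoff (hε0 n)
  have hev : ∀ x ∈ T.carrier, ∀ M : ℝ, ∀ᶠ n in atTop, δ n * M < T.depth x := fun x hx M => by
    have := hδt.mul_const M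
    rw [zero_mul] at this
    exact this.eventually_lt_const (depth_pos hx)
  have hlim : ∀ F : Plane → ℝ, Integrable F T.vol → Tendsto
      (fun n => ∫ x in T.carrier, χ n x * F x) atTop (𝓝 (∫ x in T.carrier, F x)) := by
    intro F hF
    refine tendsto_integral_of_dominated_convergence (fun x => 2 * ‖F x‖)
      (fun n => (hχ n).1.continuous.aestronglyMeasurable.mul hF.1) (hF.norm.const_mul 2)
      (fun n => Eventually.of_forall fun x => ?_)
      (ae_restrict_of_forall_mem T.isOpen_carrier.measurableSet fun x hx => ?_)
    · rw [norm_mul]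
      exact mul_le_mul_of_nonneg_right (hχ2 n x) (norm_nonneg _)
    · refine tendsto_const_nhds.congr' ?_
      filter_upwards [hev x hx r] with n hn
      rw [hχ1 n x (by rw [hε3]; exact hn.le), one_mul]
  have ig : Integrable (fun x => ‖g x‖ ^ 2) T.vol := mg.integrable_norm_pow' (p := 2)
  have jf : Integrable (fun x => f x ^ 2) T.vol := mf.integrable_sq
  let S : ℕ → Set Plane := fun n => T.collar T.center (1 - δ n)
  have hSm : ∀ n, MeasurableSet (S n) := fun n =>
    T.isKernelPt_center.measurableSet_collar (by linarith [hδ1 n])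
  have hST : ∀ n, S n ⊆ T.carrier := fun n =>
    T.isKernelPt_center.collar_subset (by linarith [hδ1 n])
  -- The energy in the shrinking collars tends to zero by dominated convergence.
  have hS : Tendsto (fun n => ∫ x in S n, ‖g x‖ ^ 2) atTop (𝓝 0) := by
    have h1 : Tendsto (fun n => ∫ x in T.carrier, (S n).indicator (fun x => ‖g x‖ ^ 2) x) atTop
        (𝓝 (∫ x in T.carrier, (0 : ℝ))) := by
      refine tendsto_integral_of_dominated_convergence (fun x => ‖g x‖ ^ 2)
        (fun n => ig.1.indicator (hSm n)) ig (fun n => Eventually.of_forall fun x => ?_)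
        (ae_restrict_of_forall_mem T.isOpen_carrier.measurableSet fun x hx => ?_)
      · refine (norm_indicator_le_norm_self _ _).trans_eq ?_
        exact Real.norm_of_nonneg (sq_nonneg _)
      · refine tendsto_const_nhds.congr' ?_
        filter_upwards [hev x hx R] with n hn
        rw [Set.indicator_of_notMem]
        intro hxS
        have := hdepth' _ x hxS
        rw [sub_sub_cancel] at this
        exact absurd hn this.not_gt
    rw [integral_zero] at h1
    refine h1.congr fun n => ?_
    rw [integral_indicator (hSm n), Measure.restrict_restrict (hSm n),
      Set.inter_eq_left.2 (hST n)]
  -- Young's inequality splits the cut-off error into ε⁻² f² and ‖g‖² on the collar. By the collar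
  -- estimate the first is at most C δ² / ε² = 9 C / r² times the energy there, with a constant
  -- independent of n.
  have hcross : ∀ n, |∫ x in T.carrier, f x * inner ℝ (g x) (gradient (χ n) x)| ≤
      (9 * C / r ^ 2 + 1) / 2 * ∫ x in S n, ‖g x‖ ^ 2 := by
    intro n
    have hrestr : (T.vol).restrict (S n) = volume.restrict (S n) := by
      rw [Measure.restrict_restrict (hSm n), Set.inter_eq_left.2 (hST n)]
    have iB : Integrable (fun x => ((ε n)⁻¹ ^ 2 * f x ^ 2 + ‖g x‖ ^ 2) / 2) T.vol :=
      ((jf.const_mul _).add ig).div_const 2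
    have h1 : ‖∫ x in T.carrier, f x * inner ℝ (g x) (gradient (χ n) x)‖ ≤
        ∫ x in T.carrier, (S n).indicator
          (fun x => ((ε n)⁻¹ ^ 2 * f x ^ 2 + ‖g x‖ ^ 2) / 2) x := by
      refine norm_integral_le_of_norm_le (iB.indicator (hSm n)) ?_
      filter_upwards [hdepth (1 - δ n) (by linarith [hδ1 n]) (by linarith [hδ0 n])] with x hx
      by_cases hxS : x ∈ S n
      · rw [Set.indicator_of_mem hxS, norm_mul]
        have h2 : ‖(inner ℝ (g x) (gradient (χ n) x) : ℝ)‖ ≤ ‖g x‖ * (ε n)⁻¹ :=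
          (norm_inner_le_norm _ _).trans (mul_le_mul_of_nonneg_left (hχD n x) (norm_nonneg _))
        have h3 := mul_le_mul_of_nonneg_left h2 (norm_nonneg (f x))
        rw [Real.norm_eq_abs (f x)] at h3 ⊢
        nlinarith [sq_nonneg ((ε n)⁻¹ * |f x| - ‖g x‖), sq_abs (f x)]
      · have := hx hxS
        rw [sub_sub_cancel, ← hε3] at this
        rw [Set.indicator_of_notMem hxS, hχ0 n x this, inner_zero_right, mul_zero, norm_zero]
    rw [integral_indicator (hSm n), hrestr, integral_div, integral_add] at h1
    rotate_left
    · exact (jf.const_mul _).mono_measure (Measure.restrict_mono (hST n) le_rfl)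
    · exact ig.mono_measure (Measure.restrict_mono (hST n) le_rfl)
    rw [integral_const_mul] at h1
    have h2 := hcol (1 - δ n) (by linarith [hδ1 n]) (by linarith [hδ0 n])
    rw [sub_sub_cancel] at h2
    have h3 := mul_le_mul_of_nonneg_left h2 (sq_nonneg (ε n)⁻¹)
    have h4 : (ε n)⁻¹ ^ 2 * (C * δ n ^ 2) = 9 * C / r ^ 2 := by
      have := (hδ0 n).ne'
      simp only [ε]
      field_simp
      norm_num
    rw [← mul_assoc, h4] at h3
    rw [Real.norm_eq_abs] at h1
    linarith
  have t1 := hlim _ ig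
  have t2 : Tendsto (fun n => ∫ x in T.carrier, f x * inner ℝ (g x) (gradient (χ n) x)) atTop
      (𝓝 0) := by
    refine squeeze_zero_norm hcross ?_
    simpa using hS.const_mul ((9 * C / r ^ 2 + 1) / 2)
  have t3 := hlim _ (memLp_integrable_mul (memLp_of_continuous hp) mf)
  -- In the limit the cut-off identity reads ∫ ‖g‖² = -∫ p f, which vanishes by assumption;
  -- Poincaré's inequality then gives f = 0.
  have hg : ∫ x in T.carrier, ‖g x‖ ^ 2 = 0 := by
    have := tendsto_nhds_unique (t1.add t2) (t3.neg.congr fun n =>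
      (h.cutoff_identity mf mg hp hL (hχ n) (hχ2 n) (hχD n)).symm)
    rwa [h0, add_zero, neg_zero] at this
  obtain ⟨C', hC'⟩ := h.poincare mf mg hγ
  rw [hg, mul_zero] at hC'
  refine ⟨integral_sq_eq_zero mf ?_, integral_sq_eq_zero mg hg.le⟩
  simpa only [Real.norm_eq_abs, sq_abs] using hC'

end Vanishing

end PolygonalElement

namespace PolygonalElement

variable {T : PolygonalElement} {k : ℕ}

/-! ### Unisolvence: injectivity -/

/-- The degrees of freedom determine the functions of the virtual space. -/
lemma dofs_injOn {C : Submodule ℝ (MvPolynomial (Fin 2) ℝ)}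
    (hC : Poly ((k : ℤ) - 1) ⊔ C = Poly ((k : ℤ) + 1)) :
    Set.InjOn (T.dofs k) (T.virtualSpace k C) := by
  intro v hv w hw hvw
  obtain ⟨tv, -, -, rv⟩ := virtualSpace_spec hC hv
  obtain ⟨tw, -, -, rw'⟩ := virtualSpace_spec hC hw
  rw [← hvw] at tw rw'
  obtain ⟨φ, hφ⟩ := hasTrace_iff.1 tv.2
  obtain ⟨ψ, hψ⟩ := hasTrace_iff.1 tw.2
  obtain ⟨-, ⟨p, hp, hpv⟩, -⟩ := hv
  obtain ⟨-, ⟨q, hq, hqw⟩, -⟩ := hw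
  have mγ := fun i => memLp_edge_of_continuousOn_frontier tv.1 i
  have hs := hφ.sub hψ v.memLp_fn w.memLp_fn v.memLp_grad w.memLp_grad mγ mγ
  -- Equal degrees of freedom give equal traces and, through `potRec`, equal projections on P^{k+1}.
  -- So v - w is orthogonal to its Laplacian, which belongs to P^{k+1}.
  have key := hs.eq_zero (v.memLp_fn.sub w.memLp_fn) (v.memLp_grad.sub w.memLp_grad)
    (fun i s _ => sub_self _) (p := ev (p - q)) (continuous_ev _) (fun χ hχ => ?_) ?_
  · refine Subtype.ext (Prod.ext (Lp.ext ?_) (Lp.ext ?_))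
    · filter_upwards [key.1] with x hx
      exact sub_eq_zero.1 hx
    · filter_upwards [key.2] with x hx
      exact sub_eq_zero.1 hx
  · have mχ : MemLp χ 2 T.vol := memLp_of_continuous hχ.1.continuous
    have mdχ : MemLp (gradient χ) 2 T.vol := memLp_of_continuous (continuous_gradient hχ.contDiff)
    simp only [inner_sub_left, ev_sub, sub_mul]
    rw [integral_sub (memLp_integrable_inner v.memLp_grad mdχ)
      (memLp_integrable_inner w.memLp_grad mdχ), integral_sub
      (memLp_integrable_mul (memLp_ev _) mχ) (memLp_integrable_mul (memLp_ev _) mχ),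
      hpv χ hχ, hqw χ hχ]
    ring
  · have h1 := proj_spec v.memLp_fn (sub_mem hp hq)
    have h2 := proj_spec w.memLp_fn (sub_mem hp hq)
    rw [← rv] at h1
    rw [← rw'] at h2
    have h3 : ∀ x, ev (p - q) x * (v.fn x - w.fn x) =
      v.fn x * ev (p - q) x - w.fn x * ev (p - q) x := fun x => by ring
    simp only [h3]
    rw [integral_sub (memLp_integrable_mul v.memLp_fn (memLp_ev _))
      (memLp_integrable_mul w.memLp_fn (memLp_ev _)), ← h1, ← h2, sub_self]

/-! ### Lipschitz boundary functions -/

lemma exists_edge_direction (i : Fin T.numEdges) {s₀ : ℝ} (h : s₀ = 0 ∨ s₀ = 1) :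
    ∃ u : Plane, u ≠ 0 ∧ (∀ s ∈ Set.Icc (0 : ℝ) 1, T.edgePt i s = T.edgePt i s₀ + |s - s₀| • u) ∧
      ∀ σ ∈ Set.Ioo (0 : ℝ) 1, T.edgePt i s₀ + σ • u ∈ openSegment ℝ (T.a i) (T.b i) := by
  rcases h with rfl | rfl
  · refine ⟨T.b i - T.a i, sub_ne_zero.2 (T.a_ne_b i).symm, fun s hs => ?_, fun σ hσ => ?_⟩
    · rw [sub_zero, abs_of_nonneg hs.1, edgePt_zero, edgePt_eq]
    · rw [openSegment_eq]
      exact ⟨σ, hσ, by rw [edgePt_zero, edgePt_eq]⟩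
  · refine ⟨T.a i - T.b i, sub_ne_zero.2 (T.a_ne_b i), fun s hs => ?_, fun σ hσ => ?_⟩
    · rw [abs_of_nonpos (by linarith [hs.2]), edgePt_one, edgePt_eq]
      module
    · rw [openSegment_eq]
      refine ⟨1 - σ, ⟨by linarith [hσ.2], by linarith [hσ.1]⟩, ?_⟩
      rw [edgePt_one, edgePt_eq]
      module

/-- Two different edges with a common vertex form a positive angle. -/
lemma exists_angle_bound {i j : Fin T.numEdges} (hij : i ≠ j) {u w z : Plane} (hu : u ≠ 0)
    (hw : w ≠ 0) (hi : ∀ σ ∈ Set.Ioo (0 : ℝ) 1, z + σ • u ∈ openSegment ℝ (T.a i) (T.b i))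
    (hj : ∀ σ ∈ Set.Ioo (0 : ℝ) 1, z + σ • w ∈ openSegment ℝ (T.a j) (T.b j)) :
    ∃ c : ℝ, 0 < c ∧ ∀ σ τ : ℝ, 0 ≤ σ → 0 ≤ τ → c * (σ + τ) ≤ ‖σ • u - τ • w‖ := by
  -- By homogeneity it suffices to bound the norm below for σ + τ = 1, a compact set. A zero there
  -- would give a common point of two open edges.
  obtain ⟨σ₀, hσ₀, hmin⟩ := isCompact_Icc.exists_isMinOn (Set.nonempty_Icc.2 zero_le_one)
    (f := fun σ : ℝ => ‖σ • u - (1 - σ) • w‖) (by fun_prop)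
  refine ⟨‖σ₀ • u - (1 - σ₀) • w‖, norm_pos_iff.2 fun h0 => ?_, fun σ τ hσ hτ => ?_⟩
  · have h1 : σ₀ ≠ 0 := fun h => hw (by simpa [h] using h0)
    have h2 : σ₀ ≠ 1 := fun h => hu (by simpa [h] using h0)
    have h3 : σ₀ ∈ Set.Ioo (0 : ℝ) 1 := ⟨hσ₀.1.lt_of_ne' h1, hσ₀.2.lt_of_ne h2⟩
    refine Set.disjoint_left.1 (T.disjoint_edges hij) (hi σ₀ h3) ?_
    rw [sub_eq_zero.1 h0]
    exact hj _ ⟨by linarith [h3.2], by linarith [h3.1]⟩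
  · rcases (add_nonneg hσ hτ).eq_or_lt with h | h
    · rw [← h, mul_zero]
      exact norm_nonneg _
    · have h1 := isMinOn_iff.1 hmin (σ / (σ + τ))
        ⟨by positivity, (div_le_one h).2 (by linarith)⟩
      have h2 : σ • u - τ • w =
          (σ + τ) • ((σ / (σ + τ)) • u - (1 - σ / (σ + τ)) • w) := by
        rw [smul_sub, smul_smul, smul_smul, mul_div_cancel₀ _ h.ne', mul_sub, mul_one,
          mul_div_cancel₀ _ h.ne', add_sub_cancel_left]
      rw [h2, norm_smul, Real.norm_of_nonneg h.le, mul_comm]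
      exact mul_le_mul_of_nonneg_left h1 h.le

/-- On one edge this is the mean value inequality. For two edges with a common point, both values
are compared with the value there and the positive angle bounds the distances along the edges. Edges
without a common point are a positive distance apart, so boundedness is enough. -/
lemma Compatible.exists_le {q : Fin T.numEdges → ℝ → ℝ} (h : T.Compatible q)
    (hq : ∀ i, ContDiff ℝ 1 (q i)) (i j : Fin T.numEdges) :
    ∃ K : ℝ, 0 ≤ K ∧ ∀ s ∈ Set.Icc (0 : ℝ) 1, ∀ t ∈ Set.Icc (0 : ℝ) 1,
      |q i s - q j t| ≤ K * ‖T.edgePt i s - T.edgePt j t‖ := by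
  have hlip : ∀ i, ∃ L : ℝ, 0 ≤ L ∧ ∀ s ∈ Set.Icc (0 : ℝ) 1, ∀ t ∈ Set.Icc (0 : ℝ) 1,
      |q i s - q i t| ≤ L * |s - t| := fun i => by
    obtain ⟨L, hL⟩ := (isCompact_Icc (a := (0 : ℝ)) (b := 1)).exists_bound_of_continuousOn
      ((hq i).continuous_deriv le_rfl).continuousOn
    refine ⟨L, (norm_nonneg _).trans (hL 0 (by simp)), fun s hs t ht => ?_⟩
    exact (convex_Icc 0 1).norm_image_sub_le_of_norm_deriv_le
      (fun x _ => (hq i).differentiable one_ne_zero x) hL ht hs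
  by_cases hij : i = j
  · subst hij
    obtain ⟨L, hL0, hL⟩ := hlip i
    have hd : 0 < ‖T.b i - T.a i‖ := norm_pos_iff.2 (sub_ne_zero.2 (T.a_ne_b i).symm)
    refine ⟨L / ‖T.b i - T.a i‖, by positivity, fun s hs t ht => (hL s hs t ht).trans_eq ?_⟩
    have : T.edgePt i s - T.edgePt i t = (s - t) • (T.b i - T.a i) := by
      rw [edgePt_eq, edgePt_eq]
      module
    rw [this, norm_smul, Real.norm_eq_abs]
    field_simp
  by_cases hmeet : ∃ s₀ ∈ Set.Icc (0 : ℝ) 1, ∃ t₀ ∈ Set.Icc (0 : ℝ) 1, T.edgePt i s₀ = T.edgePt j t₀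
  · obtain ⟨s₀, hs₀, t₀, ht₀, hst⟩ := hmeet
    obtain ⟨u, hu, hui, huo⟩ := exists_edge_direction i (eq_zero_or_one hs₀ ht₀ hij hst)
    obtain ⟨w, hw, hwi, hwo⟩ := exists_edge_direction j
      (eq_zero_or_one ht₀ hs₀ (Ne.symm hij) hst.symm)
    rw [← hst] at hwi hwo
    obtain ⟨c, hc, hcle⟩ := exists_angle_bound hij hu hw huo hwo
    obtain ⟨L, hL0, hL⟩ := hlip i
    obtain ⟨M, hM0, hM⟩ := hlip j
    refine ⟨(L + M) / c, by positivity, fun s hs t ht => ?_⟩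
    have h1 := hcle |s - s₀| |t - t₀| (abs_nonneg _) (abs_nonneg _)
    rw [hui s hs, hwi t ht, add_sub_add_left_eq_sub, div_mul_eq_mul_div, le_div_iff₀ hc]
    have h2 := hL s hs s₀ hs₀
    have h3 := hM t ht t₀ ht₀
    have h4 : |q i s - q j t| ≤ |q i s - q i s₀| + |q j t - q j t₀| := by
      rw [h i j s₀ hs₀ t₀ ht₀ hst, abs_sub_comm (q j t)]
      exact abs_sub_le _ _ _
    have h5 : |q i s - q j t| ≤ (L + M) * (|s - s₀| + |t - t₀|) := by
      nlinarith [abs_nonneg (s - s₀), abs_nonneg (t - t₀)]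
    calc |q i s - q j t| * c ≤ (L + M) * (|s - s₀| + |t - t₀|) * c :=
          mul_le_mul_of_nonneg_right h5 hc.le
      _ = (L + M) * (c * (|s - s₀| + |t - t₀|)) := by ring
      _ ≤ _ := mul_le_mul_of_nonneg_left h1 (by positivity)
  · push Not at hmeet
    have hcp : IsCompact (Set.Icc (0 : ℝ) 1 ×ˢ Set.Icc (0 : ℝ) 1) := isCompact_Icc.prod isCompact_Icc
    obtain ⟨z, hz, hmin⟩ := hcp.exists_isMinOn ⟨(0, 0), by simp⟩
      (f := fun z : ℝ × ℝ => ‖T.edgePt i z.1 - T.edgePt j z.2‖)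
      ((((continuous_edgePt i).comp continuous_fst).sub
        ((continuous_edgePt j).comp continuous_snd)).norm.continuousOn)
    have hd : 0 < ‖T.edgePt i z.1 - T.edgePt j z.2‖ :=
      norm_pos_iff.2 (sub_ne_zero.2 (hmeet _ hz.1 _ hz.2))
    obtain ⟨M, hM⟩ := hcp.exists_bound_of_continuousOn (f := fun z : ℝ × ℝ => q i z.1 - q j z.2)
      ((((hq i).continuous.comp continuous_fst).sub
        ((hq j).continuous.comp continuous_snd)).continuousOn)
    have hM0 : 0 ≤ M := (norm_nonneg _).trans (hM z hz)
    refine ⟨M / ‖T.edgePt i z.1 - T.edgePt j z.2‖, by positivity, fun s hs t ht => ?_⟩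
    rw [div_mul_eq_mul_div, le_div_iff₀ hd]
    exact mul_le_mul (hM (s, t) ⟨hs, ht⟩) (isMinOn_iff.1 hmin (s, t) ⟨hs, ht⟩) hd.le hM0

/-- Compatible edge functions are the restriction of a Lipschitz function. -/
lemma Compatible.exists_lipschitz {q : Fin T.numEdges → ℝ → ℝ} (h : T.Compatible q)
    (hq : ∀ i, ContDiff ℝ 1 (q i)) : ∃ (K : NNReal) (F : Plane → ℝ), LipschitzWith K F ∧
      ∀ i, ∀ s ∈ Set.Icc (0 : ℝ) 1, F (T.edgePt i s) = q i s := by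
  obtain ⟨g, -, hg⟩ := h.exists_glue fun i => (hq i).continuous
  choose K hK0 hK using h.exists_le hq
  have hlip : LipschitzOnWith (∑ i, ∑ j, K i j).toNNReal g (frontier T.carrier) := by
    refine LipschitzOnWith.of_dist_le_mul fun x hx y hy => ?_
    obtain ⟨i, s, hs, rfl⟩ := exists_edgePt hx
    obtain ⟨j, t, ht, rfl⟩ := exists_edgePt hy
    rw [Real.coe_toNNReal _ (Finset.sum_nonneg fun i _ => Finset.sum_nonneg fun j _ => hK0 i j),
      Real.dist_eq, dist_eq_norm, hg i s hs, hg j t ht]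
    refine (hK i j s hs t ht).trans (mul_le_mul_of_nonneg_right ?_ (norm_nonneg _))
    exact (Finset.single_le_sum (f := fun j => K i j) (fun j _ => hK0 i j)
      (Finset.mem_univ j)).trans (Finset.single_le_sum (f := fun i => ∑ j, K i j)
        (fun i _ => Finset.sum_nonneg fun j _ => hK0 i j) (Finset.mem_univ i))
  -- A real-valued Lipschitz function on a subset extends to the whole plane with the same constant.
  obtain ⟨F, hF, hFg⟩ := hlip.extend_real
  exact ⟨_, F, hF, fun i s hs => by rw [← hFg (edgePt_mem_frontier i hs), hg i s hs]⟩

end PolygonalElement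

namespace PolygonalElement

variable {T : PolygonalElement} {k : ℕ}

/-! ### Test functions -/

lemma isTest_zero : T.IsTest 0 :=
  ⟨contDiff_const, HasCompactSupport.zero, by simp [tsupport]⟩

lemma IsTest.add {φ ψ : Plane → ℝ} (hφ : T.IsTest φ) (hψ : T.IsTest ψ) :
    T.IsTest fun x => φ x + ψ x :=
  ⟨hφ.1.add hψ.1, hφ.2.1.add hψ.2.1,
    (tsupport_add φ ψ).trans (Set.union_subset hφ.2.2 hψ.2.2)⟩

lemma isTest_const_mul {φ : Plane → ℝ} (hφ : T.IsTest φ) (c : ℝ) : T.IsTest fun x => c * φ x := by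
  simpa only [mul_comm] using hφ.mul (contDiff_const (c := c))

lemma IsTest.sub {φ ψ : Plane → ℝ} (hφ : T.IsTest φ) (hψ : T.IsTest ψ) :
    T.IsTest fun x => φ x - ψ x := by
  have := hφ.add (isTest_const_mul hψ (-1))
  simpa only [neg_one_mul, ← sub_eq_add_neg] using this

lemma gradient_add' {φ ψ : Plane → ℝ} {x : Plane} (hφ : DifferentiableAt ℝ φ x)
    (hψ : DifferentiableAt ℝ ψ x) :
    gradient (fun x => φ x + ψ x) x = gradient φ x + gradient ψ x := by
  rw [gradient, gradient, gradient, ← map_add]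
  congr 1
  exact (hφ.hasFDerivAt.add hψ.hasFDerivAt).fderiv

lemma gradient_const_mul {φ : Plane → ℝ} {x : Plane} (c : ℝ) (hφ : DifferentiableAt ℝ φ x) :
    gradient (fun x => c * φ x) x = c • gradient φ x := by
  rw [gradient_mul hφ (differentiableAt_const c)]
  simp [gradient]

lemma IsTest.differentiableAt {φ : Plane → ℝ} (hφ : T.IsTest φ) (x : Plane) :
    DifferentiableAt ℝ φ x := hφ.contDiff.differentiable one_ne_zero x

lemma IsTest.memLp {φ : Plane → ℝ} (hφ : T.IsTest φ) : MemLp φ 2 T.vol :=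
  memLp_of_continuous hφ.1.continuous

lemma IsTest.memLp_gradient {φ : Plane → ℝ} (hφ : T.IsTest φ) : MemLp (gradient φ) 2 T.vol :=
  memLp_of_continuous (continuous_gradient hφ.contDiff)

lemma exists_bump (T : PolygonalElement) : ∃ b : Plane → ℝ, T.IsTest b ∧ (∀ x, 0 ≤ b x) ∧
    ∃ U : Set Plane, IsOpen U ∧ U ⊆ T.carrier ∧ U.Nonempty ∧ ∀ x ∈ U, 0 < b x := by
  obtain ⟨r, hr, h⟩ := Metric.isOpen_iff.1 T.isOpen_carrier _ T.center_mem
  let b : ContDiffBump T.center := ⟨r / 4, r / 2, by positivity, by linarith⟩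
  have hsub : Metric.closedBall T.center (r / 2) ⊆ T.carrier :=
    (Metric.closedBall_subset_ball (half_lt_self hr)).trans h
  refine ⟨b, ⟨b.contDiff, b.hasCompactSupport, ?_⟩, fun x => b.nonneg, Metric.ball T.center (r / 2),
    Metric.isOpen_ball, Metric.ball_subset_closedBall.trans hsub,
    ⟨_, Metric.mem_ball_self (half_pos hr)⟩, fun x hx => b.pos_of_mem_ball hx⟩
  rw [b.tsupport_eq]
  exact hsub

/-! ### Gradients of constrained test functions -/

/-- Test functions orthogonal to the polynomials of degree `≤ l`. -/
def IsOrthTest (T : PolygonalElement) (l : ℤ) (ψ : Plane → ℝ) : Prop :=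
  T.IsTest ψ ∧ ∀ q ∈ Poly l, ∫ x in T.carrier, ψ x * ev q x = 0

lemma IsOrthTest.add {l : ℤ} {φ ψ : Plane → ℝ} (hφ : T.IsOrthTest l φ) (hψ : T.IsOrthTest l ψ) :
    T.IsOrthTest l fun x => φ x + ψ x := by
  refine ⟨hφ.1.add hψ.1, fun q hq => ?_⟩
  simp only [add_mul]
  rw [integral_add (memLp_integrable_mul hφ.1.memLp (memLp_ev _))
    (memLp_integrable_mul hψ.1.memLp (memLp_ev _)), hφ.2 q hq, hψ.2 q hq, add_zero]

lemma IsOrthTest.const_mul {l : ℤ} {φ : Plane → ℝ} (hφ : T.IsOrthTest l φ) (c : ℝ) :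
    T.IsOrthTest l fun x => c * φ x := by
  refine ⟨isTest_const_mul hφ.1 c, fun q hq => ?_⟩
  simp only [mul_assoc]
  rw [integral_const_mul, hφ.2 q hq, mul_zero]

/-- The gradients of the test functions orthogonal to the polynomials of degree `≤ l`. -/
noncomputable def orthGradients (T : PolygonalElement) (l : ℤ) : Submodule ℝ (Lp Plane 2 T.vol) where
  carrier := {G | ∃ ψ, T.IsOrthTest l ψ ∧ G =ᵐ[T.vol] gradient ψ}
  zero_mem' := by
    refine ⟨0, ⟨isTest_zero, fun q _ => by simp⟩, ?_⟩
    filter_upwards [Lp.coeFn_zero Plane 2 T.vol] with x hx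
    rw [hx]
    simp [gradient]
  add_mem' := by
    rintro G H ⟨φ, hφ, hG⟩ ⟨ψ, hψ, hH⟩
    refine ⟨_, hφ.add hψ, ?_⟩
    filter_upwards [Lp.coeFn_add G H, hG, hH] with x h1 h2 h3
    rw [h1, Pi.add_apply, h2, h3, gradient_add' (hφ.1.differentiableAt x) (hψ.1.differentiableAt x)]
  smul_mem' := by
    rintro c G ⟨φ, hφ, hG⟩
    refine ⟨_, hφ.const_mul c, ?_⟩
    filter_upwards [Lp.coeFn_smul c G, hG] with x h1 h2
    rw [h1, Pi.smul_apply, h2, gradient_const_mul c (hφ.1.differentiableAt x)]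

lemma norm_toLp_sq {E : Type*} [NormedAddCommGroup E] [InnerProductSpace ℝ E] {f : Plane → E}
    (hf : MemLp f 2 T.vol) : ‖hf.toLp f‖ ^ 2 = ∫ x in T.carrier, ‖f x‖ ^ 2 := by
  rw [← real_inner_self_eq_norm_sq, inner_toLp]
  simp only [real_inner_self_eq_norm_sq]

/-- If the gradients of test functions converge, then so do the functions. -/
lemma exists_limit {ψ : ℕ → Plane → ℝ} (hψ : ∀ n, T.IsTest (ψ n)) {P : Lp Plane 2 T.vol}
    (hP : Tendsto (fun n => (hψ n).memLp_gradient.toLp) atTop (𝓝 P)) :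
    ∃ u : Lp ℝ 2 T.vol, T.Approx ψ u P fun _ => 0 := by
  obtain ⟨C, hC, hle⟩ := T.exists_poincare
  have hd : ∀ m n, dist ((hψ m).memLp.toLp) ((hψ n).memLp.toLp) ≤
      √C * dist ((hψ m).memLp_gradient.toLp) ((hψ n).memLp_gradient.toLp) := by
    intro m n
    rw [dist_eq_norm, dist_eq_norm, ← MemLp.toLp_sub, ← MemLp.toLp_sub]
    refine abs_le_of_sq_le_sq' ?_ (by positivity) |>.2
    rw [mul_pow, Real.sq_sqrt hC.le, norm_toLp_sq, norm_toLp_sq]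
    -- Differences of test functions vanish on the boundary, so Poincaré's inequality turns
    -- convergence of the gradients into a Cauchy property of the functions.
    have h := hle (fun x => ψ m x - ψ n x) ((hψ m).sub (hψ n)).contDiff
      fun x hx => ((hψ m).sub (hψ n)).eq_zero hx
    rw [energy] at h
    simp only [gradient_sub' ((hψ m).differentiableAt _) ((hψ n).differentiableAt _)] at h
    simpa only [Pi.sub_apply, Real.norm_eq_abs, sq_abs] using h
  have hc : CauchySeq fun n => (hψ n).memLp.toLp := by
    rw [cauchySeq_iff_tendsto_dist_atTop_0]
    have h1 := (cauchySeq_iff_tendsto_dist_atTop_0.1 hP.cauchySeq).const_mul √C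
    rw [mul_zero] at h1
    exact squeeze_zero (fun _ => dist_nonneg) (fun z => hd z.1 z.2) h1
  obtain ⟨u, hu⟩ := cauchySeq_tendsto_of_complete hc
  refine ⟨u, fun n => (hψ n).1, ?_, ?_, fun i => ?_⟩
  · refine (Lp.tendsto_Lp_iff_tendsto_eLpNorm'' ψ (fun n => (hψ n).memLp) u (Lp.memLp u)).1 ?_
    rwa [Lp.toLp_coeFn]
  · refine (Lp.tendsto_Lp_iff_tendsto_eLpNorm'' (fun n => gradient (ψ n))
      (fun n => (hψ n).memLp_gradient) P (Lp.memLp P)).1 ?_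
    rwa [Lp.toLp_coeFn]
  · refine (L2Tendsto.const (μ := edgeVol) fun _ : ℝ => (0 : ℝ)).congr fun n => ?_
    refine eLpNorm_congr_ae (ae_restrict_of_forall_mem measurableSet_Icc fun s hs => ?_)
    change (0 : ℝ) - 0 = ψ n (T.edgePt i s) - 0
    rw [(hψ n).eq_zero (edgePt_mem_frontier i hs)]

/-- The orthogonal projection of a vector field onto the gradients of the functions with vanishing
trace that are orthogonal to the polynomials of degree `≤ l`. -/
lemma exists_gradient_projection {G : Plane → Plane} (mG : MemLp G 2 T.vol) (l : ℤ) :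
    ∃ (ψ : ℕ → Plane → ℝ) (u : Lp ℝ 2 T.vol) (P : Lp Plane 2 T.vol),
      T.Approx ψ u P (fun _ => 0) ∧ (∀ q ∈ Poly l, ∫ x in T.carrier, u x * ev q x = 0) ∧
      ∀ χ, T.IsOrthTest l χ → ∫ x in T.carrier, inner ℝ (G x - P x) (gradient χ x) = 0 := by
  -- Gradients of constrained test functions need not form a closed space. The projection is onto
  -- the closure and is realised as a limit of such gradients, whose potentials also converge.
  let W := (T.orthGradients l).topologicalClosure
  let P := W.starProjection (mG.toLp G)
  have hP : P ∈ closure (T.orthGradients l : Set (Lp Plane 2 T.vol)) := by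
    rw [← Submodule.topologicalClosure_coe]
    exact W.starProjection_apply_mem _
  obtain ⟨H, hH, hHP⟩ := mem_closure_iff_seq_limit.1 hP
  choose ψ hψ hHψ using hH
  have he : ∀ n, H n = (hψ n).1.memLp_gradient.toLp := fun n =>
    Lp.ext ((hHψ n).trans (MemLp.coeFn_toLp _).symm)
  obtain ⟨u, hu⟩ := exists_limit (fun n => (hψ n).1) (hHP.congr he)
  refine ⟨ψ, u, P, hu, fun q hq => ?_, fun χ hχ => ?_⟩
  · have h1 := hu.fn.integral_mul (L2Tendsto.const (ev q)) hu.memLp (Lp.memLp u)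
      (fun _ => memLp_ev _) (memLp_ev _)
    simp only [(hψ _).2 q hq] at h1
    exact tendsto_nhds_unique h1 tendsto_const_nhds |>.symm ▸ rfl
  · have h1 : hχ.1.memLp_gradient.toLp ∈ W :=
      subset_closure ⟨χ, hχ, MemLp.coeFn_toLp _⟩
    have h2 := (Submodule.mem_orthogonal' W _).1
      (W.sub_starProjection_mem_orthogonal (mG.toLp G)) _ h1
    rw [L2.inner_def] at h2
    refine Eq.trans (integral_congr_ae ?_) h2
    filter_upwards [Lp.coeFn_sub (mG.toLp G) P, mG.coeFn_toLp,
      hχ.1.memLp_gradient.coeFn_toLp] with x e1 e2 e3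
    rw [e1, Pi.sub_apply, e2, e3]

/-- Lagrange multipliers: a vector field that is orthogonal to the gradients of the constrained test
functions has a polynomial divergence. -/
lemma exists_multiplier {g : Plane → Plane} (mg : MemLp g 2 T.vol) {l : ℤ}
    (h : ∀ χ, T.IsOrthTest l χ → ∫ x in T.carrier, inner ℝ (g x) (gradient χ x) = 0) :
    ∃ p ∈ Poly l, ∀ ψ, T.IsTest ψ →
      ∫ x in T.carrier, inner ℝ (g x) (gradient ψ x) = -∫ x in T.carrier, ev p x * ψ x := by
  obtain ⟨b, hb, hb0, U, hU, hUT, hUne, hbU⟩ := T.exists_bump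
  have hdef : ∀ w : Poly l, (∀ r, T.mass hb.1.continuous l w r = 0) → w = 0 := fun w hw =>
    mass_definite hb.1.continuous hb0 hU hUT hUne hbU l w (hw w)
  have htest : ∀ r : MvPolynomial (Fin 2) ℝ, T.IsTest fun x => b x * ev r x := fun r =>
    hb.mul (contDiff_ev r)
  let L : Poly l →ₗ[ℝ] ℝ :=
    { toFun := fun r => -∫ x in T.carrier, inner ℝ (g x) (gradient (fun x => b x * ev r x) x)
      map_add' := fun r s => by
        rw [← neg_add, ← integral_add
          (memLp_integrable_inner mg (htest _).memLp_gradient)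
          (memLp_integrable_inner mg (htest _).memLp_gradient)]
        simp only [Submodule.coe_add, ev_add, mul_add, ← inner_add_right]
        simp only [gradient_add' ((htest _).differentiableAt _) ((htest _).differentiableAt _)]
      map_smul' := fun c r => by
        simp only [Submodule.coe_smul, ev_smul, mul_left_comm _ c]
        simp only [gradient_const_mul c ((htest _).differentiableAt _), inner_smul_right]
        rw [integral_const_mul, RingHom.id_apply, smul_eq_mul, mul_neg] }
  obtain ⟨p, hp⟩ := exists_represents (T.mass hb.1.continuous l) hdef L
  refine ⟨p, p.2, fun ψ hψ => ?_⟩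
  -- The moments of ψ are matched by those of b r, so ψ - b r is a constrained test function and the
  -- functional takes the same value on ψ and on b r. On b r it is represented by p, and symmetry of
  -- the weighted mass form returns the pairing of p with ψ.
  obtain ⟨r, hr⟩ := exists_represents (T.mass hb.1.continuous l) hdef (pairing hψ.memLp l)
  have hdiff : T.IsOrthTest l fun x => ψ x - b x * ev r x := by
    refine ⟨hψ.sub (htest r), fun q hq => ?_⟩
    simp only [sub_mul]
    rw [integral_sub (memLp_integrable_mul hψ.memLp (memLp_ev _))
      (memLp_integrable_mul (htest r).memLp (memLp_ev _))]
    exact sub_eq_zero.2 (hr ⟨q, hq⟩).symm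
  have h1 := h _ hdiff
  simp only [gradient_sub' (hψ.differentiableAt _) ((htest r).differentiableAt _),
    inner_sub_right] at h1
  rw [integral_sub (memLp_integrable_inner mg hψ.memLp_gradient)
    (memLp_integrable_inner mg (htest r).memLp_gradient), sub_eq_zero] at h1
  have h2 : T.mass hb.1.continuous l p r =
      -∫ x in T.carrier, inner ℝ (g x) (gradient (fun x => b x * ev r x) x) := hp r
  have h3 : T.mass hb.1.continuous l r p = ∫ x in T.carrier, ψ x * ev p x := hr p
  rw [mass_apply] at h2 h3
  rw [h1, ← neg_eq_iff_eq_neg, ← h2]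
  refine Eq.trans ?_ (h3.trans ?_)
  · exact integral_congr_ae (Eventually.of_forall fun x => by ring)
  · exact integral_congr_ae (Eventually.of_forall fun x => by ring)

end PolygonalElement

namespace PolygonalElement

open scoped NNReal

variable {T : PolygonalElement} {k : ℕ}

/-! ### Unisolvence: surjectivity -/

/-- There are Lipschitz functions with prescribed compatible boundary values and moments. -/
lemma Compatible.exists_lipschitz_moments {q : Fin T.numEdges → ℝ → ℝ} (h : T.Compatible q)
    (hq : ∀ i, ContDiff ℝ 1 (q i)) {l : ℤ} (p : Poly l) :
    ∃ (K : ℝ≥0) (F : Plane → ℝ), LipschitzWith K F ∧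
      (∀ i, ∀ s ∈ Set.Icc (0 : ℝ) 1, F (T.edgePt i s) = q i s) ∧
      ∀ r ∈ Poly l, ∫ x in T.carrier, F x * ev r x = ∫ x in T.carrier, ev p x * ev r x := by
  obtain ⟨K, F, hF, hFq⟩ := h.exists_lipschitz hq
  obtain ⟨b, hb, hb0, U, hU, hUT, hUne, hbU⟩ := T.exists_bump
  have mF : MemLp F 2 T.vol := memLp_of_continuous hF.continuous
  -- The correction b r supplies the missing moments p - F and vanishes on the boundary.
  obtain ⟨r, hr⟩ := exists_represents (T.mass hb.1.continuous l)
    (fun w hw => mass_definite hb.1.continuous hb0 hU hUT hUne hbU l w (hw w))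
    (pairing (T := T) ((memLp_ev p).sub mF) l)
  have ht : T.IsTest fun x => b x * ev r x := hb.mul (contDiff_ev r)
  obtain ⟨K', hK'⟩ := ht.contDiff.lipschitzWith_of_hasCompactSupport ht.2.1 one_ne_zero
  refine ⟨K + K', fun x => F x + b x * ev r x, hF.add hK', fun i s hs => ?_, fun r' hr' => ?_⟩
  · change F (T.edgePt i s) + b (T.edgePt i s) * _ = _
    rw [hb.eq_zero (edgePt_mem_frontier i hs), zero_mul, add_zero, hFq i s hs]
  · have h1 : ∫ x in T.carrier, b x * ev r x * ev r' x =
      ∫ x in T.carrier, (ev p x - F x) * ev r' x := hr ⟨r', hr'⟩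
    simp only [sub_mul] at h1
    rw [integral_sub (memLp_integrable_mul (memLp_ev _) (memLp_ev _))
      (memLp_integrable_mul mF (memLp_ev _))] at h1
    simp only [add_mul]
    rw [integral_add (memLp_integrable_mul mF (memLp_ev _))
      (memLp_integrable_mul ht.memLp (memLp_ev _)), h1]
    ring

lemma Approx.exists_h1 {φ : ℕ → Plane → ℝ} {f : Plane → ℝ} {g : Plane → Plane} {γ : Plane → ℝ}
    (h : T.Approx φ f g γ) (mf : MemLp f 2 T.vol) (mg : MemLp g 2 T.vol) :
    ∃ v : T.H1, T.HasTrace v γ ∧ v.fn =ᵐ[T.vol] f ∧ v.grad =ᵐ[T.vol] g := by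
  have h' := h.congr (mf.coeFn_toLp).symm (mg.coeFn_toLp).symm fun _ => EventuallyEq.rfl
  let v : T.H1 := ⟨(mf.toLp f, mg.toLp g), h'.isWeakGrad (Lp.memLp _) (Lp.memLp _)⟩
  exact ⟨v, hasTrace_iff.2 ⟨φ, h'⟩, mf.coeFn_toLp, mg.coeFn_toLp⟩

/-- A Dirichlet problem with constrained moments. -/
lemma exists_constrained_solution {F : Plane → ℝ} {K : ℝ≥0} (hF : LipschitzWith K F) (l : ℤ) :
    ∃ v : T.H1, T.HasTrace v F ∧ (∃ p ∈ Poly l, T.HasLaplacian v (ev p)) ∧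
      ∀ q ∈ Poly l, ∫ x in T.carrier, v.fn x * ev q x = ∫ x in T.carrier, F x * ev q x := by
  have mF : MemLp F 2 T.vol := memLp_of_continuous hF.continuous
  have mG : MemLp (gradient F) 2 T.vol := memLp_gradient_of_lipschitz hF
  -- The solution is F - u. Since u has zero trace and zero moments, the data of F are kept; since
  -- ∇F - P is orthogonal to the constrained gradients, the multiplier lemma provides the Laplacian.
  obtain ⟨ψ, u, P, hu, huq, hP⟩ := exists_gradient_projection mG l
  obtain ⟨p, hp, hpψ⟩ := exists_multiplier (mG.sub (Lp.memLp P)) hP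
  have ha := (Approx.of_lipschitz (T := T) hF).sub hu mF (Lp.memLp u) mG (Lp.memLp P)
    (fun i => memLp_edge_of_continuousOn (hF.continuous.comp (continuous_edgePt i)).continuousOn)
    (fun _ => MemLp.zero)
  obtain ⟨v, hv, hvf, hvg⟩ := ha.exists_h1 (mF.sub (Lp.memLp u)) (mG.sub (Lp.memLp P))
  refine ⟨v, ?_, ⟨p, hp, fun χ hχ => ?_⟩, fun q hq => ?_⟩
  · simpa only [sub_zero] using hv
  · rw [← hpψ χ hχ]
    refine integral_congr_ae ?_
    filter_upwards [hvg] with x hx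
    rw [hx]
    rfl
  · have h1 : ∫ x in T.carrier, v.fn x * ev q x = ∫ x in T.carrier, (F x - u x) * ev q x := by
      refine integral_congr_ae ?_
      filter_upwards [hvf] with x hx
      rw [hx]
    rw [h1]
    simp only [sub_mul]
    rw [integral_sub (memLp_integrable_mul mF (memLp_ev _))
      (memLp_integrable_mul (Lp.memLp u) (memLp_ev _)), huq q hq, sub_zero]

/-- The potential reconstruction has the prescribed moments of low degree. -/
lemma integral_potRec (d : T.DOF k) {q : MvPolynomial (Fin 2) ℝ} (hq : q ∈ Poly ((k : ℤ) - 1)) :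
    ∫ x in T.carrier, ev (potRec d) x * ev q x = ∫ x in T.carrier, ev d.1 x * ev q x := by
  obtain ⟨w, hw, rfl⟩ := exists_divPoly_radial_eq T.center hq
  have hrad : radial T.center w ∈ VecPoly k := by
    simpa using radial_mem_vecPoly hw T.center
  -- For w of degree ≤ k - 1 the radial field is also admissible in the equation of G_T, and the
  -- boundary fluxes cancel.
  rw [potRec_spec d (poly_mono (by omega) hw), gradRec_spec d hrad]
  ring

/-- Elements of the virtual space with degrees of freedom d must project to R^a_T d on P^{k+1}, so
all moments up to degree k + 1 are prescribed. The constrained Dirichlet problem then has exactly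
these data, and `moment_iff` turns the moments into the defining condition of the virtual space. -/
lemma exists_dofs_eq {C : Submodule ℝ (MvPolynomial (Fin 2) ℝ)}
    (hC : Poly ((k : ℤ) - 1) ⊔ C = Poly ((k : ℤ) + 1)) (d : T.DOF k) :
    ∃ v ∈ T.virtualSpace k C, T.dofs k v = d := by
  obtain ⟨K, F, hF, hFq, hFm⟩ := (compatible_edgeRec d).exists_lipschitz_moments
    (fun i => by
      simp only [← Polynomial.coe_aeval_eq_eval]
      exact Polynomial.contDiff_aeval (edgeRec d i : Polynomial ℝ) 1) (potRec d)
  obtain ⟨v, hv, hΔ, hvm⟩ := exists_constrained_solution (T := T) hF ((k : ℤ) + 1)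
  have ht : T.IsContTrace v (traceRec d) := by
    refine IsContTrace.congr ⟨hF.continuous.continuousOn, hv⟩ (eqOn_frontier fun i s hs => ?_)
    rw [(traceRec_spec d).2 i s hs, hFq i s hs]
  have hm : ∀ q ∈ Poly ((k : ℤ) + 1),
      ∫ x in T.carrier, ev (potRec d) x * ev q x = ∫ x in T.carrier, v.fn x * ev q x :=
    fun q hq => by rw [hvm q hq, hFm q hq]
  have hm' : ∀ q ∈ Poly ((k : ℤ) - 1),
      ∫ x in T.carrier, ev d.1 x * ev q x = ∫ x in T.carrier, v.fn x * ev q x :=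
    fun q hq => by rw [← integral_potRec d hq, hm q (poly_mono (by omega) hq)]
  have hedge : ∀ i, ∀ s ∈ Set.Icc (0 : ℝ) 1,
      T.trace v (T.edgePt i s) = (edgeRec d i : Polynomial ℝ).eval s := fun i s hs => by
    rw [← (traceRec_spec d).2 i s hs]
    exact ht.trace.eqOn ht (edgePt_mem_frontier i hs)
  refine ⟨v, ⟨⟨traceRec d, ht.2, fun i => ⟨edgeRec d i, (edgeRec d i).2, ?_⟩⟩, hΔ, fun w hw => ?_⟩, ?_⟩
  · exact ae_restrict_of_forall_mem measurableSet_Icc fun s hs => (traceRec_spec d).2 i s hs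
  · have hw' : w ∈ Poly ((k : ℤ) + 1) := hC ▸ Submodule.mem_sup_right hw
    exact (moment_iff ht hm' hw').2 (hm _ (divPoly_radial_mem_poly hw' _))
  · refine Prod.ext (proj_eq v.memLp_fn fun q => hm' q q.2) (Prod.ext (funext fun i => ?_)
      (funext fun x => ?_))
    · rw [← (edgeRec_spec d i).1]
      exact edgeProj_congr (continuousOn_edge ht.trace.1 i) (hedge i)
    · obtain ⟨x, hx⟩ := x
      obtain ⟨i, s, hs, rfl⟩ : ∃ i, ∃ s : ℝ, (s = 0 ∨ s = 1) ∧ x = T.edgePt i s := by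
        rcases hx with ⟨i, rfl⟩ | ⟨i, rfl⟩
        · exact ⟨i, 0, Or.inl rfl, (edgePt_zero i).symm⟩
        · exact ⟨i, 1, Or.inr rfl, (edgePt_one i).symm⟩
      refine (hedge i s ?_).trans (edgeRec_eval d i hs rfl hx)
      rcases hs with rfl | rfl <;> simp

end PolygonalElement

end NodalVEM

/-! ### The theorem -/

theorem mainTheorem11 (T : NodalVEM.PolygonalElement) (k : ℕ)
    (C : Submodule ℝ (MvPolynomial (Fin 2) ℝ))
    (hC_disjoint : Disjoint (NodalVEM.Poly ((k : ℤ) - 1)) C)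
    (hC_sup : NodalVEM.Poly ((k : ℤ) - 1) ⊔ C = NodalVEM.Poly ((k : ℤ) + 1)) :
    (∀ v ∈ T.virtualSpace k C,
      T.IsContTrace v (NodalVEM.PolygonalElement.traceRec (T.dofs k v)) ∧
      Set.EqOn (NodalVEM.PolygonalElement.traceRec (T.dofs k v)) (T.trace v)
        (frontier T.carrier) ∧
      NodalVEM.PolygonalElement.gradRec (T.dofs k v) = T.vecProj k v.grad ∧
      T.projA k v = NodalVEM.PolygonalElement.potRec (T.dofs k v) ∧
      NodalVEM.PolygonalElement.potRec (T.dofs k v) = T.proj ((k : ℤ) + 1) v.fn) ∧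
    Function.Bijective (fun v : T.virtualSpace k C => T.dofs k v.1) ∧
    ∀ d : T.DOF k,
      T.recL k C d =
        T.proj k (NodalVEM.ev (NodalVEM.PolygonalElement.potRec d)) := by
  classical
  have hspec := fun v hv => NodalVEM.PolygonalElement.virtualSpace_spec (T := T) hC_sup (v := v) hv
  have hsurj := NodalVEM.PolygonalElement.exists_dofs_eq (T := T) hC_sup
  refine ⟨fun v hv => ?_, ⟨fun v w h => ?_, fun d => ?_⟩, fun d => ?_⟩
  · obtain ⟨h1, h2, h3, h4⟩ := hspec v hv
    exact ⟨h1, h2, h3, rfl, h4⟩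
  · exact Subtype.ext (NodalVEM.PolygonalElement.dofs_injOn hC_sup v.2 w.2 h)
  · obtain ⟨v, hv, h⟩ := hsurj d
    exact ⟨⟨v, hv⟩, h⟩
  · have h : ∃ v : T.virtualSpace k C, T.dofs k v = d := by
      obtain ⟨v, hv, h⟩ := hsurj d
      exact ⟨⟨v, hv⟩, h⟩
    rw [NodalVEM.PolygonalElement.recL, dif_pos h]
    have h4 := (hspec _ h.choose.2).2.2.2
    rw [h.choose_spec] at h4
    -- The preimage v chosen in `recL` satisfies R^a_T d = π^{k+1} v, and π^k v = π^k π^{k+1} v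
    -- because P^k is contained in P^{k+1}.
    refine NodalVEM.PolygonalElement.proj_eq (NodalVEM.PolygonalElement.H1.memLp_fn _) fun q => ?_
    rw [NodalVEM.PolygonalElement.proj_spec (NodalVEM.PolygonalElement.memLp_ev _) q.2, h4,
      NodalVEM.PolygonalElement.proj_spec (NodalVEM.PolygonalElement.H1.memLp_fn _)
        (NodalVEM.poly_mono (by omega) q.2)]
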